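/- **Setting.** Let $U\subset\mathbb R^2$ be an open neighbourhood of the origin, $V\subset\mathbb R^m$ open, $D\subset V$ compact, and let $H\colon U\to\mathbb R$ and $p,q\colon U\times V\to\mathbb R$ be $C^\infty$. Consider the near-Hamiltonian system $$\dot x=H_y+\varepsilon\,p(x,y,\delta),\qquad \dot y=-H_x+\varepsilon\,q(x,y,\delta),\qquad \delta\in D.$$ Suppose that for some $\omega>0$ the expansion of $H$ at the origin has one of the forms $$H=\tfrac{\omega}{2}(x^2+y^2)+\sum_{i+j\ge 3}h_{ij}x^iy^j\qquad\text{or}\qquad H=\tfrac{\omega}{2}y^2+\sum_{i+j\ge 3}h_{ij}x^iy^j .$$ Let $\varphi$ be the (unique) $C^\infty$ function near $0$ with $\varphi(0)=0$ and $H_y(x,\varphi(x))=0$, put $H_0^*(x)=H(x,\varphi(x))$, and suppose that for an integer $p\ge 1$ $$H_0^*(x)=\sum_{j\ge 2p}h_jx^j,\qquad h_{2p}>0 .$$ (Expansions of $C^\infty$ functions are Taylor expansions; the integer $p$ is not to be confused with the function $p$.) **Theorem.** For some $\beta>0$ the system with $\varepsilon=0$ has a family of periodic orbits $L_h$, $0<h<\beta$,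 where $L_h$ is the level set $H=h$ in a fixed neighbourhood of the origin and $L_h$ shrinks to the origin as $h\to0$. Let $$M(h,\delta)=\oint_{L_h}(H_yq+H_xp)\,dt=\oint_{L_h}q\,dx-p\,dy$$ be the Melnikov function. Then, as $h\to0^+$, $$M(h,\delta)= h^{\frac{p+1}{2p}}\sum_{l\ge0}b_l(\delta)\,h^{l/p},$$ that is, for every $n$ there are $C$ and $\eta>0$ such that for all $\delta\in D$ and $0<h<\eta$ $$\Big|M(h,\delta)-h^{\frac{p+1}{2p}}\sum_{l<n}b_l(\delta)h^{l/p}\Big|\le C\,h^{\frac{p+1}{2p}+\frac np}.$$ In particular, for $p=1$, $M(h,\delta)=h\sum_{l\ge0}b_l(\delta)h^l$ in the same sense. The coefficients are $$b_l(\delta)=\sum_{i+pj=l}r_{ij}(\delta)\,\beta_{ij},\qquad \beta_{ij}=\frac1p\int_0^1v^{\frac{2i+1-p}{p}}(1-v^2)^j\sqrt{1-v^2}\,dv=\int_0^1u^{2i}(1-u^{2p})^{j}\sqrt{1-u^{2p}}\,du,$$ where the $r_{ij}(\delta)$ are computed by the following steps: 1. $H_j^*(x)=\frac1{(j+1)!}\frac{\partial^{j+1}H}{\partial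 y^{j+1}}(x,\varphi(x))$ and $q_j(x)=\frac1{j!}\frac{\partial^{j-1}(p_x+q_y)}{\partial y^{j-1}}(x,\varphi(x),\delta)$ for $j\ge1$. 2. $a_1(x)=H_1^*(x)^{-1/2}$, and $a_2(x),a_3(x),\dots$ are found recursively by equating the coefficients of the powers of $w$ in $\sum_{j\ge1}H_j^*(x)\,v_1^{j+1}=w^2$, where $v_1=\sum_{n\ge1}a_n(x)w^n$. 3. $\bar q_j(x)$ is twice the coefficient of $w^{2j+1}$ in $\sum_{k\ge1}q_k(x)\,v_1^k$, $j\ge0$. 4. $\psi(x)=\operatorname{sgn}(x)\,H_0^*(x)^{1/(2p)}$ (a local $C^\infty$ diffeomorphism at $0$) and $\tilde q_j(u)=\dfrac{\bar q_j(x)}{\psi'(x)}\Big|_{x=\psi^{-1}(u)}$. 5. $r_{ij}(\delta)$ is the coefficient of $u^{2i}$ in the Taylor expansion of $\tilde q_j(u)+\tilde q_j(-u)$ at $u=0$. If moreover $H$ is analytic on $U$ and $p,q$ are analytic on $U\times V$, then there is $\eta>0$ such that for all $\delta\in D$ the series $h^{\frac{p+1}{2p}}\sum_{l\ge0}b_l(\delta)h^{l/p}$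 converges to $M(h,\delta)$ for $0<h<\eta$, and $M(\cdot,\delta)$ is analytic on $(0,\eta)$. -/

import Mathlib

open Set Filter Topology
open scoped ContDiff

noncomputable section

namespace Melnikov

/-- The partial derivative `F_x`. -/
def dX (F : ℝ × ℝ → ℝ) (z : ℝ × ℝ) : ℝ := deriv (fun s => F (s, z.2)) z.1

/-- The partial derivative `F_y`. -/
def dY (F : ℝ × ℝ → ℝ) (z : ℝ × ℝ) : ℝ := deriv (fun s => F (z.1, s)) z.2

/-- Elementary-center normal form: the Taylor expansion of `H` at the origin is
`(om/2)(x² + y²)` plus terms of degree at least three. -/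
def ElementaryForm (H : ℝ × ℝ → ℝ) (om : ℝ) : Prop :=
  (fun z : ℝ × ℝ => H z - om / 2 * (z.1 ^ 2 + z.2 ^ 2)) =O[𝓝 0] fun z => ‖z‖ ^ 3

/-- Nilpotent normal form: the Taylor expansion of `H` at the origin is
`(om/2) y²` plus terms of degree at least three. -/
def NilpotentForm (H : ℝ × ℝ → ℝ) (om : ℝ) : Prop :=
  (fun z : ℝ × ℝ => H z - om / 2 * z.2 ^ 2) =O[𝓝 0] fun z => ‖z‖ ^ 3

/-! ### The periodic orbits and the Melnikov function -/

/-- `γ h` (with least period `T h`), `0 < h < β`, are the periodic orbits `L_h : H = h` of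
`x' = H_y`, `y' = -H_x` around the origin: each is a closed solution curve, run through exactly once
in time `T h`, whose trace is the level set of `H` in a fixed neighbourhood of the origin, and the
traces shrink to the origin as `h → 0`. -/
structure IsCenterFamily (H : ℝ × ℝ → ℝ) (U : Set (ℝ × ℝ)) (β : ℝ)
    (γ : ℝ → ℝ → ℝ × ℝ) (T : ℝ → ℝ) : Prop where
  beta_pos : 0 < β
  period_pos : ∀ h ∈ Ioo 0 β, 0 < T h
  periodic : ∀ h ∈ Ioo 0 β, Function.Periodic (γ h) (T h)
  injOn : ∀ h ∈ Ioo 0 β, InjOn (γ h) (Ico 0 (T h))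
  solution : ∀ h ∈ Ioo 0 β, ∀ t, HasDerivAt (γ h) (dY H (γ h t), -dX H (γ h t)) t
  level_set : ∃ N ∈ 𝓝 (0 : ℝ × ℝ), N ⊆ U ∧ ∀ h ∈ Ioo 0 β, range (γ h) = {z ∈ N | H z = h}
  shrinks : ∀ W ∈ 𝓝 (0 : ℝ × ℝ), ∀ᶠ h in 𝓝[>] (0 : ℝ), range (γ h) ⊆ W

variable {E : Type*}

/-- The Melnikov function `M(h,δ) = ∮_{L_h} (H_y q + H_x p) dt = ∮_{L_h} q dx - p dy` of
`x' = H_y + ε p`, `y' = -H_x + ε q`; the perturbation terms are called `P` and `Q`. -/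
def melnikov (H : ℝ × ℝ → ℝ) (P Q : ℝ × ℝ → E → ℝ) (γ : ℝ → ℝ → ℝ × ℝ) (T : ℝ → ℝ)
    (h : ℝ) (δ : E) : ℝ :=
  ∫ t in (0 : ℝ)..T h, (dY H (γ h t) * Q (γ h t) δ + dX H (γ h t) * P (γ h t) δ)

/-! ### The coefficients -/

/-- `φ` is smooth near `0`, vanishes at `0`, and `H_y(x, φ(x)) = 0` for `|x|` small. -/
def IsCriticalCurve (H : ℝ × ℝ → ℝ) (φ : ℝ → ℝ) : Prop :=
  φ 0 = 0 ∧ ∃ ε > 0, ContDiffOn ℝ ∞ φ (Ioo (-ε) ε) ∧ ∀ x ∈ Ioo (-ε) ε, dY H (x, φ x) = 0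

/-- The function `φ` given by the implicit function theorem (unique as a germ at `0` when
`H_y(0,0) = 0 ≠ H_yy(0,0)`). -/
def critCurve (H : ℝ × ℝ → ℝ) : ℝ → ℝ := Classical.epsilon (IsCriticalCurve H)

/-- `H₀*(x) = H(x, φ(x))`. -/
def H0star (H : ℝ × ℝ → ℝ) (x : ℝ) : ℝ := H (x, critCurve H x)

/-- `H_j*(x) = (1/(j+1)!) (∂^{j+1}H/∂y^{j+1})(x, φ(x))`, used for `j ≥ 1`. -/
def Hstar (H : ℝ × ℝ → ℝ) (j : ℕ) (x : ℝ) : ℝ :=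
  iteratedDeriv (j + 1) (fun y => H (x, y)) (critCurve H x) / ((j + 1).factorial : ℝ)

/-- `q_{j+1}(x) = (1/(j+1)!) (∂^j(p_x + q_y)/∂y^j)(x, φ(x), δ)`; note the shift of the index:
the value at `j` is `q_{j+1}`. -/
def qSucc (H : ℝ × ℝ → ℝ) (P Q : ℝ × ℝ → E → ℝ) (δ : E) (j : ℕ) (x : ℝ) : ℝ :=
  iteratedDeriv j (fun y => dX (fun z => P z δ) (x, y) + dY (fun z => Q z δ) (x, y))
    (critCurve H x) / ((j + 1).factorial : ℝ)

/-- The coefficients `a_1 = 1/√c_1, a_2, a_3, …` of the series `v = ∑_{n ≥ 1} a_n w^n` solving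
`∑_{j ≥ 1} c_j v^{j+1} = w²`, found by equating the coefficients of `w^{n+1}`: there `a_n` occurs
only in the term `2 a_1 c_1 a_n = 2 √c_1 a_n`. -/
def branchCoeff (c : ℕ → ℝ) : ℕ → ℝ
  | 0 => 0
  | 1 => 1 / √(c 1)
  | n + 2 =>
    -(∑ j ∈ Finset.Icc 1 (n + 2), c j *
        ((∑ i : Fin (n + 2), Polynomial.monomial i.1 (branchCoeff c i.1)) ^ (j + 1)).coeff (n + 3))
      / (2 * √(c 1))
  decreasing_by exact i.2

/-- The series `v_1(x,w) = ∑_{n ≥ 1} a_n(x) w^n` of the solution `v` of `H(x, φ(x) + v) = H₀*(x) + w²`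
(the solution `v_2` is `v_1(x,-w)`). -/
def branchSeries (H : ℝ × ℝ → ℝ) (x : ℝ) : PowerSeries ℝ :=
  PowerSeries.mk (branchCoeff fun j => Hstar H j x)

/-- `q̄_j(x)`: the coefficient of `w^{2j+1}` in `q̄(x, v_1(x,w)) - q̄(x, v_1(x,-w))`, where
`q̄(x,v) = ∑_{k ≥ 1} q_k(x) v^k`. -/
def qBar (H : ℝ × ℝ → ℝ) (P Q : ℝ × ℝ → E → ℝ) (δ : E) (j : ℕ) (x : ℝ) : ℝ :=
  2 * ∑ k ∈ Finset.range (2 * j + 1),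
    qSucc H P Q δ k x * PowerSeries.coeff (2 * j + 1) (branchSeries H x ^ (k + 1))

/-- `ψ(x) = sgn(x) H₀*(x)^{1/(2p)}`. -/
def psi (H : ℝ × ℝ → ℝ) (p : ℕ) (x : ℝ) : ℝ :=
  Real.sign x * H0star H x ^ (1 / (2 * (p : ℝ)))

/-- `χ` is a smooth local inverse of `ψ` at `0`. -/
def IsPsiInverse (H : ℝ × ℝ → ℝ) (p : ℕ) (χ : ℝ → ℝ) : Prop :=
  χ 0 = 0 ∧ ∃ ε > 0, ContDiffOn ℝ ∞ χ (Ioo (-ε) ε) ∧ ∀ u ∈ Ioo (-ε) ε, psi H p (χ u) = u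

/-- `ψ⁻¹` (unique as a germ at `0`). -/
def psiInv (H : ℝ × ℝ → ℝ) (p : ℕ) : ℝ → ℝ := Classical.epsilon (IsPsiInverse H p)

/-- `q̃_j(u) = q̄_j(x)/ψ'(x)` at `x = ψ⁻¹(u)`. -/
def qTilde (H : ℝ × ℝ → ℝ) (P Q : ℝ × ℝ → E → ℝ) (p : ℕ) (δ : E) (j : ℕ) (u : ℝ) : ℝ :=
  qBar H P Q δ j (psiInv H p u) / deriv (psi H p) (psiInv H p u)

/-- `r_{ij}(δ)`: the Taylor coefficient of `u^{2i}` of `q̃_j(u) + q̃_j(-u)`. -/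
def rCoeff (H : ℝ × ℝ → ℝ) (P Q : ℝ × ℝ → E → ℝ) (p : ℕ) (δ : E) (i j : ℕ) : ℝ :=
  iteratedDeriv (2 * i) (fun u => qTilde H P Q p δ j u + qTilde H P Q p δ j (-u)) 0
    / ((2 * i).factorial : ℝ)

/-- `β_{ij} = (1/p) ∫_0^1 v^{(2i+1-p)/p} (1-v²)^j √(1-v²) dv`, that is
`∫_0^1 u^{2i} (1-u^{2p})^j √(1-u^{2p}) du` after the substitution `v = u^p`. -/
def betaInt (p i j : ℕ) : ℝ :=
  1 / (p : ℝ) * ∫ v in (0 : ℝ)..1,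
    v ^ ((2 * (i : ℝ) + 1 - p) / p) * (1 - v ^ 2) ^ j * √(1 - v ^ 2)

/-- `b_l(δ) = ∑_{i + p j = l} r_{ij}(δ) β_{ij}`. -/
def bCoeff (H : ℝ × ℝ → ℝ) (P Q : ℝ × ℝ → E → ℝ) (p l : ℕ) (δ : E) : ℝ :=
  ∑ ij ∈ (Finset.range (l + 1) ×ˢ Finset.range (l + 1)).filter (fun ij => ij.1 + p * ij.2 = l),
    rCoeff H P Q p δ ij.1 ij.2 * betaInt p ij.1 ij.2

end Melnikov

end

/-! Near the origin there are coordinates `(u, w)` in which the Hamiltonian is exactly `u ^ (2 p) +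
w ^ 2`. Indeed `H_y(x, φ(x)) = 0` and `H_yy(0,0) = om > 0` give `H(x, φ(x) + v) = H₀*(x) + v² K(x,
v)` with `K(0) = om / 2`, and `u = ψ(x)`, `w = v √K` do it. The map is triangular, so its inverse
has the form `(χ(u), Y(u, w))`; it has the regularity of `H`, smooth or analytic
(`exists_normalCoords`). The levels `0 < h` small become the closed curves `u ^ (2 p) + w ^ 2 = h`,
and a change of time turns them into periodic orbits (`exists_orbit`).

Green's formula then turns the Melnikov function into an integral over a region. If `S_y = P`,
adding the exact form `dS` to `Q dx - P dy` leaves `R dx` with `R_y = P_x + Q_y`. Splitting the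
orbit at its two turning points and integrating `R_y` between the lower and the upper half gives the
integral of the density `f = (P_x + Q_y) Y_w χ'` over `u ^ (2 p) + w ^ 2 ≤ h`
(`melnikov_eq_levelIntegral`).

Over this symmetric region only monomials `u ^ (2 i) w ^ (2 j)` contribute. By scaling, each gives
`4 / (2 j + 1) β_ij` times `h` to the power `(p + 1) / (2 p) + (i + p j) / p`
(`levelIntegral_monomial`). A Taylor polynomial of `f`, with remainder uniform over the compact
parameter set, gives the expansion. For analytic data the double Taylor series converges with a
radius uniform in the parameter and may be integrated term by term.

It remains to see that the prescribed steps compute the Taylor coefficients of `f`. The branch `w ↦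
Y(u, w) - Y(u, 0)` inverts `∑ H_j* v^(j+1) = w²`, so its series is the recursive one
(`taylorSeries_branch`). In `w`, `f` is `χ'` times the derivative of `∑ q_k v^k` along the branch,
so its coefficient of `w ^ (2 j)` is `(2 j + 1) / 2 · q̄_j χ'`. With `χ' = 1 / ψ'` and the doubling
by `u ↦ -u`, `r_ij` is `4 / (2 j + 1)` times a mixed Taylor coefficient of `f` (`rCoeff_eq`). -/

namespace Melnikov

/-! ### Functions smooth or analytic in a neighbourhood of a point -/

section SmoothNear

variable {E F G : Type*} [NormedAddCommGroup E] [NormedSpace ℝ E]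
  [NormedAddCommGroup F] [NormedSpace ℝ F] [NormedAddCommGroup G] [NormedSpace ℝ G]

/-- `f` is of class `C^n` at every point of a neighbourhood of `x`. -/
def SmoothNear (n : WithTop ℕ∞) (f : E → F) (x : E) : Prop :=
  ∀ᶠ y in 𝓝 x, ContDiffAt ℝ n f y

variable {n : WithTop ℕ∞} {f : E → F} {x : E}

theorem SmoothNear.contDiffAt (hf : SmoothNear n f x) : ContDiffAt ℝ n f x := hf.self_of_nhds

theorem SmoothNear.continuousAt (hf : SmoothNear n f x) : ContinuousAt f x :=
  hf.contDiffAt.continuousAt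

theorem ContDiffOn.smoothNear {s : Set E} (hf : ContDiffOn ℝ n f s) (hs : IsOpen s)
    (hx : x ∈ s) : SmoothNear n f x := by
  filter_upwards [hs.mem_nhds hx] with y hy using hf.contDiffAt (hs.mem_nhds hy)

theorem SmoothNear.of_contDiff (hf : ContDiff ℝ n f) : SmoothNear n f x :=
  Eventually.of_forall fun _ => hf.contDiffAt

theorem SmoothNear.comp {g : F → G} (x : E) (hg : SmoothNear n g (f x)) (hf : SmoothNear n f x) :
    SmoothNear n (fun y => g (f y)) x := by
  filter_upwards [hf, hf.continuousAt.eventually hg] with y hy h' using h'.comp y hy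

theorem SmoothNear.comp_of_eq {g : F → G} {x : E} {z : F} (hg : SmoothNear n g z)
    (hf : SmoothNear n f x) (h : f x = z) : SmoothNear n (fun y => g (f y)) x := by
  subst h; exact hg.comp x hf

theorem SmoothNear.prodMk {g : E → G} (hf : SmoothNear n f x) (hg : SmoothNear n g x) :
    SmoothNear n (fun y => (f y, g y)) x := by
  filter_upwards [hf, hg] with y hy h' using hy.prodMk h'

theorem SmoothNear.fst {g : E → F × G} (hf : SmoothNear n g x) :
    SmoothNear n (fun y => (g y).1) x := by
  filter_upwards [hf] with y hy using hy.fst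

theorem SmoothNear.snd {g : E → F × G} (hf : SmoothNear n g x) :
    SmoothNear n (fun y => (g y).2) x := by
  filter_upwards [hf] with y hy using hy.snd

theorem SmoothNear.add {g : E → F} (hf : SmoothNear n f x) (hg : SmoothNear n g x) :
    SmoothNear n (fun y => f y + g y) x := by
  filter_upwards [hf, hg] with y hy h' using hy.add h'

theorem SmoothNear.sub {g : E → F} (hf : SmoothNear n f x) (hg : SmoothNear n g x) :
    SmoothNear n (fun y => f y - g y) x := by
  filter_upwards [hf, hg] with y hy h' using hy.sub h'

theorem SmoothNear.mul {f g : E → ℝ} (hf : SmoothNear n f x) (hg : SmoothNear n g x) :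
    SmoothNear n (fun y => f y * g y) x := by
  filter_upwards [hf, hg] with y hy h' using hy.mul h'

theorem SmoothNear.rpow_const {f : E → ℝ} (hf : SmoothNear n f x) (h0 : f x ≠ 0) (a : ℝ) :
    SmoothNear n (fun y => f y ^ a) x := by
  filter_upwards [hf, hf.continuousAt.eventually_ne h0] with y hy h'
    using hy.rpow_const_of_ne h'

theorem SmoothNear.sqrt {f : E → ℝ} (hf : SmoothNear n f x) (h0 : f x ≠ 0) :
    SmoothNear n (fun y => √(f y)) x := by
  filter_upwards [hf, hf.continuousAt.eventually_ne h0] with y hy h' using hy.sqrt h'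

/-- The smooth and the analytic case run in parallel: both classes `∞` and `ω` are closed under
differentiation. -/
theorem add_one_le_of_infinite (hn : n = ∞ ∨ n = ω) : n + 1 ≤ n := by
  rcases hn with rfl | rfl
  · exact le_of_eq rfl
  · exact le_top

theorem ne_zero_of_infinite (hn : n = ∞ ∨ n = ω) : n ≠ 0 := by
  rcases hn with rfl | rfl <;> simp

theorem infty_le_of_infinite (hn : n = ∞ ∨ n = ω) : ∞ ≤ n := by
  rcases hn with rfl | rfl
  · exact le_rfl
  · exact le_top

/-- One neighbourhood must serve all orders: `ContDiffAt ℝ ∞ f x` alone allows it to shrink with the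
order of differentiation. -/
theorem SmoothNear.fderiv (hn : n = ∞ ∨ n = ω) (hf : SmoothNear n f x) :
    SmoothNear n (fderiv ℝ f) x := by
  filter_upwards [hf] with y hy using hy.fderiv_right (add_one_le_of_infinite hn)

/-- The inverse function theorem for functions that are smooth in a neighbourhood. -/
theorem SmoothNear.exists_inverse [CompleteSpace E] (hn : n = ∞ ∨ n = ω)
    (hf : SmoothNear n f x) {f' : E ≃L[ℝ] F} (hf' : HasFDerivAt f (f' : E →L[ℝ] F) x) :
    ∃ g : F → E, SmoothNear n g (f x) ∧ g (f x) = x ∧ (∀ᶠ y in 𝓝 x, g (f y) = y) ∧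
      ∀ᶠ z in 𝓝 (f x), f (g z) = z := by
  have hn0 := ne_zero_of_infinite hn
  set e := hf.contDiffAt.toOpenPartialHomeomorph f hf' hn0 with he
  have hxs : x ∈ e.source := hf.contDiffAt.mem_toOpenPartialHomeomorph_source hf' hn0
  have hft : f x ∈ e.target := hf.contDiffAt.image_mem_toOpenPartialHomeomorph_target hf' hn0
  have hsx : e.symm (f x) = x := e.left_inv hxs
  have hcont : ContinuousAt e.symm (f x) := e.symm.continuousAt hft
  refine ⟨e.symm, ?_, hsx, ?_, ?_⟩
  -- The inverse must be smooth near `f x`, not only at it. Invertible operators form an open set,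
  -- so the derivative stays invertible at nearby points.
  · have h1 : ∀ᶠ y in 𝓝 x, ∃ A : E ≃L[ℝ] F, (A : E →L[ℝ] F) = _root_.fderiv ℝ f y := by
      have hc : ContinuousAt (_root_.fderiv ℝ f) x := (hf.fderiv hn).continuousAt
      have hmem : range ((↑) : (E ≃L[ℝ] F) → E →L[ℝ] F) ∈ 𝓝 (_root_.fderiv ℝ f x) := by
        rw [hf'.fderiv]; exact ContinuousLinearEquiv.nhds f'
      exact hc.eventually hmem
    have h2 : Tendsto e.symm (𝓝 (f x)) (𝓝 x) := by
      have := hcont.tendsto; rwa [hsx] at this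
    filter_upwards [e.open_target.mem_nhds hft, h2.eventually h1, h2.eventually hf] with z hz hA hd
    obtain ⟨A, hA⟩ := hA
    refine e.contDiffAt_symm (f₀' := A) hz ?_ hd
    rw [hA]
    exact (hd.differentiableAt hn0).hasFDerivAt
  · filter_upwards [e.open_source.mem_nhds hxs] with y hy using e.left_inv hy
  · filter_upwards [e.open_target.mem_nhds hft] with y hy using e.right_inv hy

end SmoothNear

/-! ### Partial derivatives in the plane -/

section Partials

variable {n : WithTop ℕ∞} {f : ℝ × ℝ → ℝ} {z : ℝ × ℝ}

theorem hasDerivAt_snd_of_hasFDerivAt {L : ℝ × ℝ →L[ℝ] ℝ} (hf : HasFDerivAt f L z) :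
    HasDerivAt (fun s => f (z.1, s)) (L (0, 1)) z.2 := by
  have h : HasDerivAt (fun s : ℝ => (z.1, s)) ((0 : ℝ), (1 : ℝ)) z.2 :=
    (hasDerivAt_const _ _).prodMk (hasDerivAt_id _)
  exact HasFDerivAt.comp_hasDerivAt z.2 (f := fun s : ℝ => (z.1, s)) hf h

theorem hasDerivAt_fst_of_hasFDerivAt {L : ℝ × ℝ →L[ℝ] ℝ} (hf : HasFDerivAt f L z) :
    HasDerivAt (fun s => f (s, z.2)) (L (1, 0)) z.1 := by
  have h : HasDerivAt (fun s : ℝ => (s, z.2)) ((1 : ℝ), (0 : ℝ)) z.1 :=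
    (hasDerivAt_id _).prodMk (hasDerivAt_const _ _)
  exact HasFDerivAt.comp_hasDerivAt z.1 (f := fun s : ℝ => (s, z.2)) hf h

theorem dY_eq_fderiv (hf : DifferentiableAt ℝ f z) : dY f z = fderiv ℝ f z (0, 1) :=
  (hasDerivAt_snd_of_hasFDerivAt hf.hasFDerivAt).deriv

theorem dX_eq_fderiv (hf : DifferentiableAt ℝ f z) : dX f z = fderiv ℝ f z (1, 0) :=
  (hasDerivAt_fst_of_hasFDerivAt hf.hasFDerivAt).deriv

theorem hasDerivAt_dY (hf : DifferentiableAt ℝ f z) :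
    HasDerivAt (fun s => f (z.1, s)) (dY f z) z.2 := by
  rw [dY_eq_fderiv hf]; exact hasDerivAt_snd_of_hasFDerivAt hf.hasFDerivAt

theorem hasDerivAt_dX (hf : DifferentiableAt ℝ f z) :
    HasDerivAt (fun s => f (s, z.2)) (dX f z) z.1 := by
  rw [dX_eq_fderiv hf]; exact hasDerivAt_fst_of_hasFDerivAt hf.hasFDerivAt

theorem fderiv_apply_eq (hf : DifferentiableAt ℝ f z) (a b : ℝ) :
    fderiv ℝ f z (a, b) = a * dX f z + b * dY f z := by
  rw [dX_eq_fderiv hf, dY_eq_fderiv hf]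
  have : ((a, b) : ℝ × ℝ) = a • ((1 : ℝ), (0 : ℝ)) + b • ((0 : ℝ), (1 : ℝ)) := by simp
  rw [this, map_add, map_smul, map_smul]; rfl

theorem contDiffOn_dY {s : Set (ℝ × ℝ)} (hn : n = ∞ ∨ n = ω) (hs : IsOpen s)
    (hf : ContDiffOn ℝ n f s) : ContDiffOn ℝ n (dY f) s := by
  have h1 : ContDiffOn ℝ n (fun z => fderiv ℝ f z (0, 1)) s :=
    (hf.fderiv_of_isOpen hs (add_one_le_of_infinite hn)).clm_apply contDiffOn_const
  refine h1.congr fun z hz => dY_eq_fderiv ?_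
  exact (hf.contDiffAt (hs.mem_nhds hz)).differentiableAt (ne_zero_of_infinite hn)

theorem contDiffOn_dX {s : Set (ℝ × ℝ)} (hn : n = ∞ ∨ n = ω) (hs : IsOpen s)
    (hf : ContDiffOn ℝ n f s) : ContDiffOn ℝ n (dX f) s := by
  have h1 : ContDiffOn ℝ n (fun z => fderiv ℝ f z (1, 0)) s :=
    (hf.fderiv_of_isOpen hs (add_one_le_of_infinite hn)).clm_apply contDiffOn_const
  refine h1.congr fun z hz => dX_eq_fderiv ?_
  exact (hf.contDiffAt (hs.mem_nhds hz)).differentiableAt (ne_zero_of_infinite hn)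

theorem SmoothNear.dY (hn : n = ∞ ∨ n = ω) (hf : SmoothNear n f z) :
    SmoothNear n (dY f) z := by
  obtain ⟨s, hs, hso, hz⟩ := eventually_nhds_iff.1 hf
  exact ContDiffOn.smoothNear (contDiffOn_dY hn hso fun y hy => (hs y hy).contDiffWithinAt) hso hz

end Partials

/-! ### Differentiation under the integral sign -/

section ParametricIntegral

theorem hasFDerivAt_integral_param {E F : Type*} [NormedAddCommGroup E] [NormedSpace ℝ E]
    [NormedAddCommGroup F] [NormedSpace ℝ F]
    {G : E × ℝ → F} {O : Set (E × ℝ)} (hO : IsOpen O) (hG : ContDiffOn ℝ 1 G O) {z : E}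
    (hz : ∀ t ∈ Icc (0 : ℝ) 1, (z, t) ∈ O) :
    HasFDerivAt (fun z => ∫ t in (0 : ℝ)..1, G (z, t))
      (∫ t in (0 : ℝ)..1, (fderiv ℝ G (z, t)).comp (ContinuousLinearMap.inl ℝ E ℝ)) z := by
  have hdc : ContinuousOn (fderiv ℝ G) O := hG.continuousOn_fderiv_of_isOpen hO le_rfl
  have hKO : ({z} : Set E) ×ˢ Icc (0 : ℝ) 1 ⊆ O := by
    rintro ⟨a, t⟩ ⟨ha, ht⟩
    rw [mem_singleton_iff] at ha
    simp only at ha; subst ha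
    exact hz t ht
  obtain ⟨C, hC⟩ := (isCompact_singleton.prod isCompact_Icc).exists_bound_of_continuousOn
    (hdc.mono hKO)
  -- The strict bound `C + 1` is an open condition that holds on `{z} × [0, 1]`; the tube lemma then
  -- yields a product neighbourhood on which the derivative is dominated by a constant.
  have hO' : IsOpen (O ∩ (fun p => ‖fderiv ℝ G p‖) ⁻¹' Iio (C + 1)) :=
    hdc.norm.isOpen_inter_preimage hO isOpen_Iio
  obtain ⟨u, v, hu, hv, hzu, hIv, huv⟩ := generalized_tube_lemma (isCompact_singleton (x := z))
    (isCompact_Icc (a := (0 : ℝ)) (b := 1)) hO'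
    (fun p hp => ⟨hKO hp, lt_of_le_of_lt (hC p hp) (lt_add_one C)⟩)
  have hzu' : z ∈ u := hzu rfl
  have hGc : ∀ y ∈ u, ContinuousOn (fun t => G (y, t)) (Icc (0 : ℝ) 1) := fun y hy =>
    hG.continuousOn.comp (by fun_prop) fun t ht => (huv ⟨hy, hIv ht⟩).1
  have hGi : ∀ y ∈ u, IntervalIntegrable (fun t => G (y, t)) MeasureTheory.volume 0 1 := by
    intro y hy
    apply ContinuousOn.intervalIntegrable
    rw [uIcc_of_le zero_le_one]; exact hGc y hy
  have hsub : uIoc (0 : ℝ) 1 ⊆ Icc 0 1 := by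
    rw [uIoc_of_le zero_le_one]; exact Ioc_subset_Icc_self
  refine intervalIntegral.hasFDerivAt_integral_of_dominated_of_fderiv_le
    (F := fun y t => G (y, t))
    (F' := fun y t => (fderiv ℝ G (y, t)).comp (ContinuousLinearMap.inl ℝ E ℝ))
    (bound := fun _ => C + 1) (hu.mem_nhds hzu') ?_ (hGi z hzu') ?_ ?_ ?_ ?_
  · filter_upwards [hu.mem_nhds hzu'] with y hy
    have := (hGi y hy).aestronglyMeasurable
    rwa [uIoc_of_le zero_le_one]
  · have hc : ContinuousOn (fun t => (fderiv ℝ G (z, t)).comp (ContinuousLinearMap.inl ℝ E ℝ))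
        (uIcc (0 : ℝ) 1) := by
      rw [uIcc_of_le zero_le_one]
      refine ContinuousOn.clm_comp (hdc.comp (by fun_prop) fun t ht => hz t ht) continuousOn_const
    have := hc.intervalIntegrable (μ := MeasureTheory.volume)
    have := this.aestronglyMeasurable
    rwa [uIoc_of_le zero_le_one]
  · refine Eventually.of_forall fun t ht y hy => ?_
    refine (ContinuousLinearMap.opNorm_comp_le _ _).trans ?_
    have h1 : ‖fderiv ℝ G (y, t)‖ < C + 1 := (huv ⟨hy, hIv (hsub ht)⟩).2
    have h2 := ContinuousLinearMap.norm_inl_le_one ℝ E ℝ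
    nlinarith [norm_nonneg (fderiv ℝ G (y, t)), norm_nonneg (ContinuousLinearMap.inl ℝ E ℝ)]
  · exact intervalIntegrable_const
  · refine Eventually.of_forall fun t ht y hy => ?_
    have h1 : (y, t) ∈ O := (huv ⟨hy, hIv (hsub ht)⟩).1
    have h2 := ((hG.contDiffAt (hO.mem_nhds h1)).differentiableAt one_ne_zero).hasFDerivAt
    have h3 : HasFDerivAt (fun y : E => (y, t)) (ContinuousLinearMap.inl ℝ E ℝ) y :=
      hasFDerivAt_prodMk_left y t
    exact h2.comp y h3

/-- Induction on the order, each step differentiating once under the integral. The target space is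
quantified after `m` because the hypothesis is applied to the operator-valued derivative; the spare
order of smoothness starts the induction. -/
theorem contDiffOn_integral_param_nat {E : Type} [NormedAddCommGroup E] [NormedSpace ℝ E]
    {O : Set (E × ℝ)} (hO : IsOpen O) {s : Set E} (hs : IsOpen s)
    (hsO : ∀ z ∈ s, ∀ t ∈ Icc (0 : ℝ) 1, (z, t) ∈ O) (m : ℕ) :
    ∀ {F : Type} [NormedAddCommGroup F] [NormedSpace ℝ F] {G : E × ℝ → F},
      ContDiffOn ℝ (m + 1) G O → ContDiffOn ℝ m (fun z => ∫ t in (0 : ℝ)..1, G (z, t)) s := by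
  induction m with
  | zero =>
    intro F _ _ G hG
    simp only [Nat.cast_zero, zero_add] at hG ⊢
    rw [contDiffOn_zero]
    exact fun z hz => (hasFDerivAt_integral_param hO hG (hsO z hz)).continuousAt.continuousWithinAt
  | succ m ih =>
    intro F _ _ G hG
    have hG1 : ContDiffOn ℝ 1 G O := hG.of_le (by simp)
    have hd := fun z hz => hasFDerivAt_integral_param hO hG1 (hsO z hz)
    push_cast
    rw [contDiffOn_succ_iff_fderiv_of_isOpen hs]
    refine ⟨fun z hz => (hd z hz).differentiableAt.differentiableWithinAt, by simp, ?_⟩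
    have hG' : ContDiffOn ℝ (m + 1)
        (fun q => (fderiv ℝ G q).comp (ContinuousLinearMap.inl ℝ E ℝ)) O := by
      refine ContDiffOn.clm_comp (hG.fderiv_of_isOpen hO ?_) contDiffOn_const
      push_cast; exact le_rfl
    exact (ih hG').congr fun z hz => (hd z hz).fderiv

theorem contDiffOn_integral_param {E F : Type} [NormedAddCommGroup E] [NormedSpace ℝ E]
    [NormedAddCommGroup F] [NormedSpace ℝ F] {G : E × ℝ → F}
    {O : Set (E × ℝ)} (hO : IsOpen O) {s : Set E} (hs : IsOpen s)
    (hsO : ∀ z ∈ s, ∀ t ∈ Icc (0 : ℝ) 1, (z, t) ∈ O) (hG : ContDiffOn ℝ ∞ G O) :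
    ContDiffOn ℝ ∞ (fun z => ∫ t in (0 : ℝ)..1, G (z, t)) s := by
  rw [contDiffOn_infty]
  intro m
  exact contDiffOn_integral_param_nat hO hs hsO m (hG.of_le (by exact_mod_cast le_top))

end ParametricIntegral

end Melnikov

namespace Melnikov

/-! ### Hadamard's lemma, smooth and analytic -/

section Hadamard

/-- An average of an analytic function over a family of linear contractions is analytic. -/
theorem hasFPowerSeriesOnBall_integral_comp {E F : Type*} [NormedAddCommGroup E] [NormedSpace ℝ E]
    [NormedAddCommGroup F] [NormedSpace ℝ F] [CompleteSpace F] {f : E → F}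
    {p : FormalMultilinearSeries ℝ E F} {r : ENNReal} (hf : HasFPowerSeriesOnBall f p 0 r)
    {A : ℝ → E →L[ℝ] E} (hA : Continuous A) (hA1 : ∀ t ∈ Icc (0 : ℝ) 1, ‖A t‖ ≤ 1) :
    HasFPowerSeriesOnBall (fun z => ∫ t in (0 : ℝ)..1, f (A t z))
      (fun n => ∫ t in (0 : ℝ)..1, (p n).compContinuousLinearMap fun _ => A t) 0 r := by
  have hcomp : ∀ n, Continuous fun t => (p n).compContinuousLinearMap fun _ => A t := by
    intro n
    have h1 : Continuous fun (g : Fin n → E →L[ℝ] E) =>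
        ContinuousMultilinearMap.compContinuousLinearMapL (𝕜 := ℝ) (F := F) g :=
      (ContinuousMultilinearMap.compContinuousLinearMapContinuousMultilinear ℝ
        (fun _ : Fin n => E) (fun _ : Fin n => E) F).cont
    exact (h1.comp (continuous_pi fun _ => hA)).clm_apply continuous_const
  have hnorm : ∀ n, ∀ t ∈ Icc (0 : ℝ) 1,
      ‖(p n).compContinuousLinearMap fun _ => A t‖ ≤ ‖p n‖ := by
    intro n t ht
    refine (ContinuousMultilinearMap.norm_compContinuousLinearMap_le _ _).trans ?_
    refine mul_le_of_le_one_right (norm_nonneg _) ?_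
    exact Finset.prod_le_one (fun _ _ => norm_nonneg _) fun _ _ => hA1 t ht
  have hsub : uIoc (0 : ℝ) 1 ⊆ Icc 0 1 := by
    rw [uIoc_of_le zero_le_one]; exact Ioc_subset_Icc_self
  refine ⟨hf.r_le.trans (FormalMultilinearSeries.radius_le_of_le fun n => ?_), hf.r_pos, ?_⟩
  · have := intervalIntegral.norm_integral_le_of_norm_le_const (a := (0 : ℝ)) (b := 1)
      (f := fun t => (p n).compContinuousLinearMap fun _ => A t) (C := ‖p n‖)
      fun t ht => hnorm n t (hsub ht)
    simpa using this
  · intro y hy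
    rw [zero_add]
    have happ : ∀ n, (∫ t in (0 : ℝ)..1, (p n).compContinuousLinearMap fun _ => A t)
        (fun _ => y) = ∫ t in (0 : ℝ)..1, p n fun _ => A t y := by
      intro n
      have := ContinuousLinearMap.intervalIntegral_comp_comm
        (ContinuousMultilinearMap.apply ℝ (fun _ : Fin n => E) F (fun _ => y))
        ((hcomp n).intervalIntegrable (μ := MeasureTheory.volume) 0 1)
      simpa using this.symm
    simp only [happ]
    have hy' : (‖y‖₊ : ENNReal) < p.radius := by
      refine lt_of_lt_of_le ?_ hf.r_le
      rw [← enorm_eq_nnnorm]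
      simpa [Metric.mem_eball, edist_zero_right] using hy
    have hsum := p.summable_norm_mul_pow hy'
    refine intervalIntegral.hasSum_integral_of_dominated_convergence
      (fun n _ => ‖p n‖ * (‖y‖₊ : ℝ) ^ n) (fun n => ?_) (fun n => ?_) ?_ ?_ ?_
    · exact ((continuous_eval_const (F := ContinuousMultilinearMap ℝ (fun _ : Fin n => E) F)
        (fun _ => y)).comp (hcomp n)).aestronglyMeasurable
    · refine Eventually.of_forall fun t ht => ?_
      have h1 := ((p n).compContinuousLinearMap fun _ => A t).le_opNorm (fun _ => y)
      simp only [ContinuousMultilinearMap.compContinuousLinearMap_apply, Finset.prod_const,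
        Finset.card_univ, Fintype.card_fin] at h1
      refine h1.trans ?_
      exact mul_le_mul_of_nonneg_right (hnorm n t (hsub ht)) (by positivity)
    · exact Eventually.of_forall fun t _ => hsum
    · exact intervalIntegrable_const
    · refine Eventually.of_forall fun t ht => ?_
      have hAy : A t y ∈ Metric.eball (0 : E) r := by
        have h1 : ‖A t y‖ ≤ ‖y‖ := by
          refine ((A t).le_opNorm y).trans ?_
          exact mul_le_of_le_one_left (norm_nonneg _) (hA1 t (hsub ht))
        simp only [Metric.mem_eball, edist_zero_right] at hy ⊢
        exact lt_of_le_of_lt (enorm_le_iff_norm_le.2 h1) hy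
      have := hf.hasSum hAy
      rwa [zero_add] at this

/-- The linear map `(x, v) ↦ (x, t v)`. -/
noncomputable def scaleSnd (t : ℝ) : ℝ × ℝ →L[ℝ] ℝ × ℝ :=
  (ContinuousLinearMap.inl ℝ ℝ ℝ).comp (ContinuousLinearMap.fst ℝ ℝ ℝ) +
    t • (ContinuousLinearMap.inr ℝ ℝ ℝ).comp (ContinuousLinearMap.snd ℝ ℝ ℝ)

theorem scaleSnd_apply (t : ℝ) (z : ℝ × ℝ) : scaleSnd t z = (z.1, t * z.2) := by
  simp [scaleSnd]

theorem norm_scaleSnd_apply_le {t : ℝ} (ht : t ∈ Icc (0 : ℝ) 1) (z : ℝ × ℝ) :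
    ‖scaleSnd t z‖ ≤ ‖z‖ := by
  rw [scaleSnd_apply, Prod.norm_def, Prod.norm_def]
  refine max_le_max le_rfl ?_
  simp only [norm_mul, Real.norm_eq_abs, abs_of_nonneg ht.1]
  exact mul_le_of_le_one_left (abs_nonneg _) ht.2

theorem contDiffOn_integral_scaleSnd {f : ℝ × ℝ → ℝ} {r : ℝ}
    (hf : ContDiffOn ℝ ∞ f (Metric.ball 0 r)) :
    ContDiffOn ℝ ∞ (fun z => ∫ t in (0 : ℝ)..1, f (scaleSnd t z)) (Metric.ball 0 r) := by
  have hc : ContDiff ℝ ∞ fun q : (ℝ × ℝ) × ℝ => scaleSnd q.2 q.1 := by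
    simp only [scaleSnd_apply]; fun_prop
  refine contDiffOn_integral_param (G := fun q => f (scaleSnd q.2 q.1))
    (O := (fun q : (ℝ × ℝ) × ℝ => scaleSnd q.2 q.1) ⁻¹' Metric.ball 0 r)
    (Metric.isOpen_ball.preimage hc.continuous) Metric.isOpen_ball ?_ ?_
  · intro z hz t ht
    simp only [mem_preimage, mem_ball_zero_iff] at hz ⊢
    exact (norm_scaleSnd_apply_le ht z).trans_lt hz
  · exact hf.comp hc.contDiffOn fun q hq => hq

/-- The two classes need different arguments: differentiation under the integral sign for `∞`,
termwise integration of the power series at the origin for `ω`. In both, the maps `scaleSnd t` do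
not leave the ball because they do not increase the norm. -/
theorem SmoothNear.integral_scaleSnd {n : WithTop ℕ∞} (hn : n = ∞ ∨ n = ω) {f : ℝ × ℝ → ℝ}
    (hf : SmoothNear n f 0) : SmoothNear n (fun z => ∫ t in (0 : ℝ)..1, f (scaleSnd t z)) 0 := by
  rcases hn with rfl | rfl
  · obtain ⟨r, hr, hr'⟩ := Metric.eventually_nhds_iff_ball.1 hf
    exact ContDiffOn.smoothNear
      (contDiffOn_integral_scaleSnd fun y hy => (hr' y hy).contDiffWithinAt) Metric.isOpen_ball
      (Metric.mem_ball_self hr)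
  · obtain ⟨p, r, hp⟩ := hf.contDiffAt.analyticAt
    have hA : Continuous scaleSnd := by
      unfold scaleSnd
      fun_prop
    have h := hasFPowerSeriesOnBall_integral_comp hp hA fun t ht =>
      ContinuousLinearMap.opNorm_le_bound _ zero_le_one fun z => by
        rw [one_mul]; exact norm_scaleSnd_apply_le ht z
    have h2 := h.analyticAt.eventually_analyticAt
    filter_upwards [h2] with y hy using hy.contDiffAt

/-- Hadamard's lemma: a smooth function vanishing on the axis `v = 0` is `v` times a smooth
function. -/
theorem SmoothNear.exists_eq_snd_mul {n : WithTop ℕ∞} (hn : n = ∞ ∨ n = ω) {f : ℝ × ℝ → ℝ}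
    (hf : SmoothNear n f 0) (h0 : ∀ᶠ x in 𝓝 (0 : ℝ), f (x, 0) = 0) :
    ∃ g : ℝ × ℝ → ℝ, SmoothNear n g 0 ∧ (∀ᶠ z in 𝓝 0, f z = z.2 * g z) ∧
      g 0 = Melnikov.dY f 0 := by
  -- The factor is `∫₀¹ f_y(x, t v) dt`, by the fundamental theorem of calculus for `t ↦ f(x, t v)`.
  refine ⟨_, (hf.dY hn).integral_scaleSnd hn, ?_, ?_⟩
  · obtain ⟨r, hr, hr'⟩ := Metric.eventually_nhds_iff_ball.1 (hf.and (hf.dY hn))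
    have h0' : ∀ᶠ z : ℝ × ℝ in 𝓝 0, f (z.1, 0) = 0 :=
      ((continuous_fst (X := ℝ) (Y := ℝ)).tendsto 0).eventually h0
    filter_upwards [Metric.ball_mem_nhds 0 hr, h0'] with z hz hz0
    have hmem : ∀ t ∈ Icc (0 : ℝ) 1, scaleSnd t z ∈ Metric.ball (0 : ℝ × ℝ) r := by
      intro t ht
      rw [mem_ball_zero_iff] at hz ⊢
      exact (norm_scaleSnd_apply_le ht z).trans_lt hz
    have hder : ∀ t ∈ uIcc (0 : ℝ) 1, HasDerivAt (fun t => f (z.1, t * z.2))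
        (z.2 * Melnikov.dY f (scaleSnd t z)) t := by
      intro t ht
      rw [uIcc_of_le zero_le_one] at ht
      have hd := (hr' _ (hmem t ht)).1.differentiableAt (ne_zero_of_infinite hn)
      have h1 := hasDerivAt_dY hd
      have h2 : HasDerivAt (fun t : ℝ => t * z.2) z.2 t := by
        simpa using (hasDerivAt_id t).mul_const z.2
      simp only [scaleSnd_apply] at h1 ⊢
      have := HasDerivAt.comp t h1 h2
      rw [mul_comm]; exact this
    have hcont : ContinuousOn (fun t => z.2 * Melnikov.dY f (scaleSnd t z)) (uIcc (0 : ℝ) 1) := by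
      rw [uIcc_of_le zero_le_one]
      intro t ht
      have h1 : ContinuousAt (Melnikov.dY f) (scaleSnd t z) := (hr' _ (hmem t ht)).2.continuousAt
      have h2 : ContinuousAt (fun t => scaleSnd t z) t := by
        simp only [scaleSnd_apply]; fun_prop
      exact (continuousAt_const.mul
        (ContinuousAt.comp (f := fun t => scaleSnd t z) h1 h2)).continuousWithinAt
    have := intervalIntegral.integral_eq_sub_of_hasDerivAt hder hcont.intervalIntegrable
    rw [intervalIntegral.integral_const_mul] at this
    simp only [one_mul, zero_mul, hz0, sub_zero] at this
    exact this.symm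
  · simp

/-- Hadamard's lemma in one variable. -/
theorem SmoothNear.exists_eq_id_mul {n : WithTop ℕ∞} (hn : n = ∞ ∨ n = ω) {f : ℝ → ℝ}
    (hf : SmoothNear n f 0) (h0 : f 0 = 0) :
    ∃ g : ℝ → ℝ, SmoothNear n g 0 ∧ ∀ᶠ x in 𝓝 0, f x = x * g x := by
  have h1 : SmoothNear n (fun z : ℝ × ℝ => f z.2) 0 :=
    SmoothNear.comp (g := f) (f := Prod.snd) 0 hf (SmoothNear.of_contDiff contDiff_snd)
  obtain ⟨g, hg, hfg, -⟩ := h1.exists_eq_snd_mul hn (by simp [h0])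
  have hc : SmoothNear n (fun x : ℝ => ((0 : ℝ), x)) 0 := SmoothNear.of_contDiff (by fun_prop)
  refine ⟨fun x => g (0, x), SmoothNear.comp (g := g) 0 hg hc, ?_⟩
  exact hc.continuousAt.eventually hfg

end Hadamard

end Melnikov

namespace Melnikov

/-! ### Asymptotic expansions and formal power series -/

section TaylorSeries

/-- `s` is the asymptotic expansion of `f` at `0`. -/
def HasTaylor (f : ℝ → ℝ) (s : PowerSeries ℝ) : Prop :=
  ∀ N : ℕ, (fun w => f w - (s.trunc N).eval w) =O[𝓝 0] fun w : ℝ => w ^ N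

theorem eval_trunc (s : PowerSeries ℝ) (N : ℕ) (w : ℝ) :
    (s.trunc N).eval w = ∑ k ∈ Finset.range N, PowerSeries.coeff k s * w ^ k := by
  induction N with
  | zero => simp
  | succ N ih => rw [PowerSeries.trunc_succ, Polynomial.eval_add, ih, Finset.sum_range_succ,
      Polynomial.eval_monomial]

theorem isBigO_eval_of_coeff_eq_zero {P : Polynomial ℝ} {N : ℕ} (h : ∀ n < N, P.coeff n = 0) :
    (fun w => P.eval w) =O[𝓝 0] fun w : ℝ => w ^ N := by
  obtain ⟨R, rfl⟩ := Polynomial.X_pow_dvd_iff.2 h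
  simp only [Polynomial.eval_mul, Polynomial.eval_pow, Polynomial.eval_X]
  have : (fun w => R.eval w) =O[𝓝 0] fun _ : ℝ => (1 : ℝ) :=
    (R.continuous.continuousAt (x := 0)).isBigO_one ℝ
  simpa using (Asymptotics.isBigO_refl (fun w : ℝ => w ^ N) (𝓝 0)).mul this

/-- Any polynomial with the right low coefficients may replace the truncation; products and
compositions produce such polynomials with surplus terms of high degree. -/
theorem hasTaylor_iff {f : ℝ → ℝ} {s : PowerSeries ℝ} :
    HasTaylor f s ↔ ∀ N : ℕ, ∃ P : Polynomial ℝ, (∀ n < N, P.coeff n = PowerSeries.coeff n s) ∧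
      (fun w => f w - P.eval w) =O[𝓝 0] fun w : ℝ => w ^ N := by
  refine ⟨fun h N => ⟨s.trunc N, fun n hn => ?_, h N⟩, fun h N => ?_⟩
  · rw [PowerSeries.coeff_trunc, if_pos hn]
  · obtain ⟨P, hP, hO⟩ := h N
    have h1 := isBigO_eval_of_coeff_eq_zero (P := P - s.trunc N) (N := N) fun n hn => by
      rw [Polynomial.coeff_sub, hP n hn, PowerSeries.coeff_trunc, if_pos hn, sub_self]
    refine (hO.add h1).congr_left fun w => ?_
    rw [Polynomial.eval_sub]; ring

/-- Otherwise `w ^ n` would be `o(w ^ n)`. This is the source of the uniqueness of expansions. -/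
theorem eq_zero_of_mul_pow_isBigO {c : ℝ} {n : ℕ}
    (h : (fun w => c * w ^ n) =O[𝓝 0] fun w : ℝ => w ^ (n + 1)) : c = 0 := by
  have h1 : (fun w : ℝ => c * w ^ n) =o[𝓝 0] fun w : ℝ => w ^ n :=
    h.trans_isLittleO (Asymptotics.isLittleO_pow_pow (Nat.lt_succ_self n))
  by_contra hc
  have h2 : (fun w : ℝ => w ^ n) =o[𝓝 0] fun w : ℝ => w ^ n :=
    (Asymptotics.isLittleO_const_mul_left_iff hc).1 h1
  refine Asymptotics.isLittleO_irrefl ?_ h2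
  have h3 : ∃ᶠ w : ℝ in 𝓝[≠] 0, w ^ n ≠ 0 :=
    Eventually.frequently (eventually_mem_nhdsWithin.mono fun w (hw : w ∈ ({0}ᶜ : Set ℝ)) =>
      pow_ne_zero n (by simpa using hw))
  exact h3.filter_mono nhdsWithin_le_nhds

theorem HasTaylor.unique {f : ℝ → ℝ} {s t : PowerSeries ℝ} (hs : HasTaylor f s)
    (ht : HasTaylor f t) : s = t := by
  ext n
  induction n using Nat.strong_induction_on with
  | _ n ih =>
    have h := ((ht (n + 1)).sub (hs (n + 1)))
    have : (fun w => (PowerSeries.coeff n s - PowerSeries.coeff n t) * w ^ n)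
        =O[𝓝 0] fun w : ℝ => w ^ (n + 1) := by
      refine h.congr_left fun w => ?_
      have h1 : s.trunc n = t.trunc n := by
        ext k; simp only [PowerSeries.coeff_trunc]
        split_ifs with hk
        · exact ih k hk
        · rfl
      rw [PowerSeries.trunc_succ, PowerSeries.trunc_succ, h1]
      simp only [Polynomial.eval_add, Polynomial.eval_monomial]
      ring
    exact sub_eq_zero.1 (eq_zero_of_mul_pow_isBigO this)

theorem HasTaylor.congr {f g : ℝ → ℝ} {s : PowerSeries ℝ} (hf : HasTaylor f s)
    (h : g =ᶠ[𝓝 0] f) : HasTaylor g s := fun N =>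
  (hf N).congr' (by filter_upwards [h] with w hw; rw [hw]) EventuallyEq.rfl

theorem hasTaylor_eval (P : Polynomial ℝ) : HasTaylor (fun w => P.eval w) P := by
  rw [hasTaylor_iff]
  exact fun N => ⟨P, fun n _ => by simp, by simpa using Asymptotics.isBigO_zero _ _⟩

theorem HasTaylor.add {f g : ℝ → ℝ} {s t : PowerSeries ℝ} (hf : HasTaylor f s)
    (hg : HasTaylor g t) : HasTaylor (fun w => f w + g w) (s + t) := by
  intro N
  refine ((hf N).add (hg N)).congr_left fun w => ?_
  rw [map_add, Polynomial.eval_add]; ring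

theorem HasTaylor.bigO_one {f : ℝ → ℝ} {s : PowerSeries ℝ} (hf : HasTaylor f s) :
    f =O[𝓝 0] fun _ : ℝ => (1 : ℝ) := by
  have := hf 0
  simpa using this

theorem HasTaylor.mul {f g : ℝ → ℝ} {s t : PowerSeries ℝ} (hf : HasTaylor f s)
    (hg : HasTaylor g t) : HasTaylor (fun w => f w * g w) (s * t) := by
  rw [hasTaylor_iff]
  intro N
  refine ⟨s.trunc N * t.trunc N, fun n hn => ?_, ?_⟩
  · rw [Polynomial.coeff_mul, PowerSeries.coeff_mul]
    refine Finset.sum_congr rfl fun ij hij => ?_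
    have := Finset.HasAntidiagonal.mem_antidiagonal.1 hij
    rw [PowerSeries.coeff_trunc, PowerSeries.coeff_trunc, if_pos (by omega), if_pos (by omega)]
  · have hP : (fun w => (s.trunc N).eval w) =O[𝓝 0] fun _ : ℝ => (1 : ℝ) :=
      ((s.trunc N).continuous.continuousAt (x := 0)).isBigO_one ℝ
    have h1 := (hf N).mul hg.bigO_one
    have h2 := hP.mul (hg N)
    simp only [mul_one, one_mul] at h1 h2
    refine (h1.add h2).congr_left fun w => ?_
    rw [Polynomial.eval_mul]; ring

theorem hasTaylor_const (c : ℝ) : HasTaylor (fun _ => c) (PowerSeries.C c) := by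
  have := hasTaylor_eval (Polynomial.C c)
  simpa using this

theorem HasTaylor.pow {f : ℝ → ℝ} {s : PowerSeries ℝ} (hf : HasTaylor f s) (k : ℕ) :
    HasTaylor (fun w => f w ^ k) (s ^ k) := by
  induction k with
  | zero => simpa using hasTaylor_const 1
  | succ k ih => simpa only [pow_succ] using ih.mul hf

theorem HasTaylor.sum {ι : Type*} {f : ι → ℝ → ℝ} {s : ι → PowerSeries ℝ} (S : Finset ι)
    (hf : ∀ i ∈ S, HasTaylor (f i) (s i)) :
    HasTaylor (fun w => ∑ i ∈ S, f i w) (∑ i ∈ S, s i) := by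
  classical
  induction S using Finset.induction_on with
  | empty => simpa using hasTaylor_const 0
  | insert a S ha ih =>
    simp only [Finset.sum_insert ha]
    exact (hf a (Finset.mem_insert_self _ _)).add
      (ih fun i hi => hf i (Finset.mem_insert_of_mem hi))

theorem coeff_pow_eq_zero_of_lt {a : PowerSeries ℝ} (ha : PowerSeries.coeff 0 a = 0) {n k : ℕ}
    (h : n < k) : PowerSeries.coeff n (a ^ k) = 0 := by
  have h1 : (PowerSeries.X : PowerSeries ℝ) ∣ a := by
    rw [PowerSeries.X_dvd_iff]; simpa using ha
  exact PowerSeries.X_pow_dvd_iff.1 (pow_dvd_pow_of_dvd h1 k) n h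

/-- The expansion of a composition is the composition of the expansions. -/
theorem HasTaylor.comp {g v : ℝ → ℝ} {c : PowerSeries ℝ} {a : PowerSeries ℝ}
    (hg : HasTaylor g c) (hv : HasTaylor v a) (ha : PowerSeries.coeff 0 a = 0) :
    HasTaylor (fun w => g (v w)) (PowerSeries.mk fun m =>
      ∑ k ∈ Finset.range (m + 1), PowerSeries.coeff k c * PowerSeries.coeff m (a ^ k)) := by
  have hv1 : v =O[𝓝 0] fun w : ℝ => w := by
    have := hv 1
    simpa [PowerSeries.trunc_succ, ha] using this
  have hv0 : Tendsto v (𝓝 0) (𝓝 0) := hv1.trans_tendsto tendsto_id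
  rw [hasTaylor_iff]
  intro N
  -- Since `v = O(w)`, substituting `v` keeps the error of `g` of order `w ^ N`, and only finitely
  -- many powers of `v` remain to be expanded.
  have h1 : (fun w => g (v w) - (c.trunc N).eval (v w)) =O[𝓝 0] fun w : ℝ => w ^ N :=
    ((hg N).comp_tendsto hv0).trans (hv1.pow N)
  have h2 : HasTaylor (fun w => ∑ k ∈ Finset.range N, PowerSeries.coeff k c * v w ^ k)
      (∑ k ∈ Finset.range N, PowerSeries.C (PowerSeries.coeff k c) * a ^ k) :=
    HasTaylor.sum _ fun k _ => (hasTaylor_const _).mul (hv.pow k)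
  refine ⟨(∑ k ∈ Finset.range N, PowerSeries.C (PowerSeries.coeff k c) * a ^ k).trunc N,
    fun n hn => ?_, ((h1.add (h2 N)).congr_left fun w => ?_)⟩
  · rw [PowerSeries.coeff_trunc, if_pos hn, map_sum, PowerSeries.coeff_mk]
    simp only [PowerSeries.coeff_C_mul]
    symm
    refine Finset.sum_subset (Finset.range_subset_range.2 hn) fun k _ hk => ?_
    rw [coeff_pow_eq_zero_of_lt ha (by simpa using hk), mul_zero]
  · rw [eval_trunc c]; ring

/-- The Taylor series of `f` at `0`. -/
noncomputable def taylorSeries (f : ℝ → ℝ) : PowerSeries ℝ :=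
  PowerSeries.mk fun n => iteratedDeriv n f 0 / (n.factorial : ℝ)

theorem hasTaylor_taylorSeries {f : ℝ → ℝ} (hf : ContDiffAt ℝ ∞ f 0) :
    HasTaylor f (taylorSeries f) := by
  intro N
  obtain ⟨u, hu, hfu⟩ := hf.contDiffOn (m := (N : ℕ∞)) (by exact_mod_cast le_top) (by simp)
  obtain ⟨r, hr, hru⟩ := Metric.mem_nhds_iff.1 hu
  have h1 := taylor_isLittleO (f := f) (n := N) (convex_ball (0 : ℝ) r) (Metric.mem_ball_self hr)
    (by exact_mod_cast hfu.mono hru)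
  rw [(Metric.isOpen_ball (x := (0 : ℝ)) (ε := r)).nhdsWithin_eq (Metric.mem_ball_self hr)] at h1
  simp only [sub_zero] at h1
  -- The Taylor polynomial of degree `N` has one term more than `trunc N`; that term is itself `O(w
  -- ^ N)`.
  have h2 : (fun w : ℝ => iteratedDeriv N f 0 / (N.factorial : ℝ) * w ^ N)
      =O[𝓝 0] fun w : ℝ => w ^ N := Asymptotics.isBigO_const_mul_self _ _ _
  refine (h1.isBigO.add h2).congr_left fun w => ?_
  rw [taylor_within_apply, Finset.sum_range_succ, taylorSeries, eval_trunc]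
  have h3 : ∀ k, iteratedDerivWithin k f (Metric.ball 0 r) 0 = iteratedDeriv k f 0 := fun k =>
    iteratedDerivWithin_of_isOpen Metric.isOpen_ball (Metric.mem_ball_self hr)
  simp only [h3, PowerSeries.coeff_mk, sub_zero, smul_eq_mul]
  have h4 : ∀ k, (k.factorial : ℝ)⁻¹ * w ^ k * iteratedDeriv k f 0
      = iteratedDeriv k f 0 / (k.factorial : ℝ) * w ^ k := fun k => by
    rw [div_eq_inv_mul]; ring
  simp only [h4]; ring

theorem HasTaylor.iteratedDeriv_eq {f : ℝ → ℝ} {s : PowerSeries ℝ} (hs : HasTaylor f s)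
    (hf : ContDiffAt ℝ ∞ f 0) (n : ℕ) :
    iteratedDeriv n f 0 = n.factorial * PowerSeries.coeff n s := by
  rw [hs.unique (hasTaylor_taylorSeries hf), taylorSeries, PowerSeries.coeff_mk,
    mul_div_cancel₀ _ (by positivity)]

theorem taylorSeries_deriv (f : ℝ → ℝ) :
    taylorSeries (deriv f) = PowerSeries.derivative ℝ (taylorSeries f) := by
  ext n
  rw [PowerSeries.coeff_derivative, taylorSeries, taylorSeries, PowerSeries.coeff_mk,
    PowerSeries.coeff_mk, ← iteratedDeriv_succ', Nat.factorial_succ]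
  push_cast
  field_simp

end TaylorSeries

end Melnikov

namespace Melnikov

/-! ### The critical curve and the quadratic factor of the Hamiltonian -/

section NormalForm

variable {n : WithTop ℕ∞} {H : ℝ × ℝ → ℝ} {om : ℝ}

theorem coeff_eq_zero_of_eval_isBigO {P : Polynomial ℝ} {N : ℕ}
    (h : (fun w => P.eval w) =O[𝓝 0] fun w : ℝ => w ^ N) : ∀ k < N, P.coeff k = 0 := by
  intro k
  induction k using Nat.strong_induction_on with
  | _ k ih =>
    intro hk
    obtain ⟨R, hR⟩ := Polynomial.X_pow_dvd_iff.2 fun j (hj : j < k) => ih j hj (hj.trans hk)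
    have h1 : (fun w => (R - Polynomial.C (R.coeff 0)).eval w) =O[𝓝 0] fun w : ℝ => w ^ 1 :=
      isBigO_eval_of_coeff_eq_zero fun j hj => by
        obtain rfl : j = 0 := by omega
        simp
    have h2 := (Asymptotics.isBigO_refl (fun w : ℝ => w ^ k) (𝓝 0)).mul h1
    have h3 : (fun w : ℝ => w ^ N) =O[𝓝 0] fun w : ℝ => w ^ (k + 1) :=
      Asymptotics.IsBigO.of_bound 1 (by
        filter_upwards [Metric.ball_mem_nhds (0 : ℝ) one_pos] with w hw
        rw [mem_ball_zero_iff] at hw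
        rw [one_mul, norm_pow, norm_pow]
        exact pow_le_pow_of_le_one (norm_nonneg _) hw.le hk)
    have h4 : (fun w => R.coeff 0 * w ^ k) =O[𝓝 0] fun w : ℝ => w ^ (k + 1) := by
      refine ((h.trans h3).sub (h2.congr_right fun w => by ring)).congr_left fun w => ?_
      rw [hR]
      simp only [Polynomial.eval_mul, Polynomial.eval_pow, Polynomial.eval_X,
        Polynomial.eval_sub, Polynomial.eval_C]
      ring
    rw [hR, Polynomial.coeff_X_pow_mul', if_pos le_rfl, Nat.sub_self]
    exact eq_zero_of_mul_pow_isBigO h4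

/-- Both normal forms agree on the axis `x = 0`, and this restriction is all that is used of them:
it gives `H_y(0,0) = 0` and `H_yy(0,0) = om`. The behaviour in `x` enters through `H₀*` only. -/
theorem isBigO_axis_of_normalForm (hnf : ElementaryForm H om ∨ NilpotentForm H om) :
    (fun y : ℝ => H (0, y) - om / 2 * y ^ 2) =O[𝓝 0] fun y : ℝ => y ^ 3 := by
  have ht : Tendsto (fun y : ℝ => ((0 : ℝ), y)) (𝓝 0) (𝓝 0) := by
    have : Continuous fun y : ℝ => ((0 : ℝ), y) := by fun_prop
    exact this.tendsto 0
  rcases hnf with h | h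
  all_goals
    have h1 := Asymptotics.IsBigO.comp_tendsto h ht
    refine (h1.congr (fun y => ?_) (fun y => ?_)).trans
      (Asymptotics.isBigO_of_le _ fun y => (?_ : ‖(|y| ^ 3 : ℝ)‖ ≤ ‖y ^ 3‖))
    · simp
    · simp [Prod.norm_def]
    · simp

theorem iteratedDeriv_axis (hH : SmoothNear n H 0) (hn : n = ∞ ∨ n = ω)
    (hax : (fun y : ℝ => H (0, y) - om / 2 * y ^ 2) =O[𝓝 0] fun y : ℝ => y ^ 3) :
    H 0 = 0 ∧ deriv (fun y => H (0, y)) 0 = 0 ∧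
      PowerSeries.coeff 2 (taylorSeries fun y => H (0, y)) = om / 2 := by
  have hs : ContDiffAt ℝ ∞ (fun y => H (0, y)) 0 :=
    (ContDiffAt.comp (0 : ℝ) (f := fun y : ℝ => ((0 : ℝ), y)) (g := H) hH.contDiffAt
      (by fun_prop)).of_le (infty_le_of_infinite hn)
  have h1 := hasTaylor_taylorSeries hs 3
  set s := taylorSeries fun y => H (0, y) with hsdef
  have h2 := coeff_eq_zero_of_eval_isBigO
    (P := s.trunc 3 - Polynomial.monomial 2 (om / 2)) (N := 3)
    ((hax.sub h1).congr_left fun w => by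
      simp only [Polynomial.eval_sub, Polynomial.eval_monomial]; ring)
  have c0 := h2 0 (by norm_num)
  have c1 := h2 1 (by norm_num)
  have c2 := h2 2 (by norm_num)
  simp [PowerSeries.coeff_trunc, Polynomial.coeff_monomial] at c0 c1 c2
  refine ⟨?_, ?_, ?_⟩
  · rw [hsdef, taylorSeries] at c0
    rw [Prod.zero_eq_mk]; simpa using c0
  · rw [hsdef, taylorSeries, PowerSeries.coeff_mk] at c1
    simpa using c1
  · linarith

/-- The lower triangular automorphism `(x, y) ↦ (d x, a x + b y)` of the plane. -/
noncomputable def triEquiv (d a b : ℝ) (hd : d ≠ 0) (hb : b ≠ 0) : (ℝ × ℝ) ≃L[ℝ] ℝ × ℝ :=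
  ContinuousLinearEquiv.equivOfInverse
    ((d • ContinuousLinearMap.fst ℝ ℝ ℝ).prod
      (a • ContinuousLinearMap.fst ℝ ℝ ℝ + b • ContinuousLinearMap.snd ℝ ℝ ℝ))
    ((d⁻¹ • ContinuousLinearMap.fst ℝ ℝ ℝ).prod
      ((-(b⁻¹ * a * d⁻¹)) • ContinuousLinearMap.fst ℝ ℝ ℝ + b⁻¹ • ContinuousLinearMap.snd ℝ ℝ ℝ))
    (fun z => by ext <;> simp <;> field_simp; ring)
    (fun z => by ext <;> simp <;> field_simp; ring)

/-- Both inversions, the one that yields `φ` and the one that yields the normal coordinates, concern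
maps of this triangular shape, for which invertibility means nonzero diagonal entries. -/
theorem hasFDerivAt_triangular {f : ℝ → ℝ} {g : ℝ × ℝ → ℝ} {z : ℝ × ℝ} {d : ℝ}
    (hf : HasDerivAt f d z.1) (hg : DifferentiableAt ℝ g z) (hd : d ≠ 0) (hb : dY g z ≠ 0) :
    HasFDerivAt (fun z : ℝ × ℝ => (f z.1, g z))
      (triEquiv d (dX g z) (dY g z) hd hb : ℝ × ℝ →L[ℝ] ℝ × ℝ) z := by
  have h1 : HasFDerivAt (fun z : ℝ × ℝ => f z.1) (d • ContinuousLinearMap.fst ℝ ℝ ℝ) z :=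
    hf.comp_hasFDerivAt z (hasFDerivAt_fst (𝕜 := ℝ) (E := ℝ) (F := ℝ) (p := z))
  refine (h1.prodMk hg.hasFDerivAt).congr_fderiv ?_
  ext1
  · ext <;> simp [triEquiv, ContinuousLinearEquiv.equivOfInverse, dX_eq_fderiv hg]
  · ext <;> simp [triEquiv, ContinuousLinearEquiv.equivOfInverse, dY_eq_fderiv hg]

/-- Existence and uniqueness of the critical curve. -/
theorem exists_critical_curve (hn : n = ∞ ∨ n = ω) (hH : SmoothNear n H 0) (h1 : dY H 0 = 0)
    (h2 : dY (dY H) 0 ≠ 0) :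
    ∃ φ : ℝ → ℝ, SmoothNear n φ 0 ∧ φ 0 = 0 ∧ (∀ᶠ x in 𝓝 0, dY H (x, φ x) = 0) ∧
      ∀ ϕ : ℝ → ℝ, ContinuousAt ϕ 0 → ϕ 0 = 0 → (∀ᶠ x in 𝓝 0, dY H (x, ϕ x) = 0) →
        ϕ =ᶠ[𝓝 0] φ := by
  have hd := hH.dY hn
  -- The implicit function is obtained by inverting `(x, y) ↦ (x, H_y(x, y))` and restricting the
  -- inverse to the first axis.
  have hF : SmoothNear n (fun z : ℝ × ℝ => (z.1, dY H z)) 0 :=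
    (SmoothNear.of_contDiff contDiff_fst).prodMk hd
  have hF' := hasFDerivAt_triangular (f := fun x => x) (g := dY H) (z := 0) (hasDerivAt_id _)
    (hd.contDiffAt.differentiableAt (ne_zero_of_infinite hn)) one_ne_zero h2
  obtain ⟨g, hg, hg0, hgl, hgr⟩ := hF.exists_inverse hn hF'
  have e0 : (((0 : ℝ × ℝ).1, dY H 0) : ℝ × ℝ) = 0 := by rw [h1]; rfl
  rw [e0] at hg hg0 hgr
  have hi : SmoothNear n (fun x : ℝ => (x, (0 : ℝ))) 0 := SmoothNear.of_contDiff (by fun_prop)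
  have hi0 : Tendsto (fun x : ℝ => (x, (0 : ℝ))) (𝓝 0) (𝓝 0) := hi.continuousAt
  have hφ : SmoothNear n (fun x : ℝ => (g (x, 0)).2) 0 :=
    (SmoothNear.comp (g := g) (f := fun x : ℝ => (x, (0 : ℝ))) 0 hg hi).snd
  have hφ0 : (g (0, 0)).2 = 0 := by
    have : g (0, 0) = 0 := hg0
    rw [this]; rfl
  refine ⟨fun x => (g (x, 0)).2, hφ, hφ0, ?_, ?_⟩
  · filter_upwards [hi0.eventually hgr] with x hx
    simp only [Prod.mk.injEq] at hx
    have : (x, (g (x, 0)).2) = g (x, 0) := Prod.ext hx.1.symm rfl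
    rw [this]; exact hx.2
  · intro ϕ hϕ hϕ0 hcrit
    have hc : Tendsto (fun x : ℝ => (x, ϕ x)) (𝓝 0) (𝓝 0) := by
      have : ContinuousAt (fun x : ℝ => (x, ϕ x)) 0 := continuousAt_id.prodMk hϕ
      have h := this.tendsto
      rwa [hϕ0] at h
    filter_upwards [hc.eventually hgl, hcrit] with x hx hx0
    simp only [hx0] at hx
    show ϕ x = (g (x, 0)).2
    rw [hx]

/-- `critCurve` is an arbitrary choice and is only known to be `C^∞`. Uniqueness of the germ
identifies it with the constructed `φ`, which is analytic when `H` is. -/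
theorem critCurve_eventuallyEq (hn : n = ∞ ∨ n = ω) (hH : SmoothNear n H 0) (h1 : dY H 0 = 0)
    (h2 : dY (dY H) 0 ≠ 0) {φ : ℝ → ℝ}
    (hφ : ∀ ϕ : ℝ → ℝ, ContinuousAt ϕ 0 → ϕ 0 = 0 → (∀ᶠ x in 𝓝 0, dY H (x, ϕ x) = 0) →
        ϕ =ᶠ[𝓝 0] φ) : critCurve H =ᶠ[𝓝 0] φ := by
  have hex : ∃ ϕ, IsCriticalCurve H ϕ := by
    obtain ⟨ϕ, hs, h0, hc, -⟩ := exists_critical_curve hn hH h1 h2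
    obtain ⟨ε, hε, hb⟩ := Metric.eventually_nhds_iff_ball.1 (hs.and hc)
    have hball : Metric.ball (0 : ℝ) ε = Ioo (-ε) ε := by simp [Real.ball_eq_Ioo]
    rw [hball] at hb
    exact ⟨ϕ, h0, ε, hε, fun x hx =>
      ((hb x hx).1.of_le (infty_le_of_infinite hn)).contDiffWithinAt, fun x hx => (hb x hx).2⟩
  obtain ⟨h0, ε, hε, hs, hc⟩ : IsCriticalCurve H (critCurve H) := Classical.epsilon_spec hex
  have hmem : Ioo (-ε) ε ∈ 𝓝 (0 : ℝ) := Ioo_mem_nhds (by linarith) hε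
  exact hφ _ (hs.continuousOn.continuousAt hmem) h0 (by filter_upwards [hmem] with x hx using hc x hx)

/-- A smooth function whose first `k` Taylor coefficients vanish is divisible by `x ^ k`. -/
theorem SmoothNear.exists_eq_pow_mul (hn : n = ∞ ∨ n = ω) {f : ℝ → ℝ} (hf : SmoothNear n f 0)
    (k : ℕ) (h0 : ∀ j < k, iteratedDeriv j f 0 = 0) :
    ∃ g : ℝ → ℝ, SmoothNear n g 0 ∧ (∀ᶠ x in 𝓝 0, f x = x ^ k * g x) ∧
      iteratedDeriv k f 0 = k.factorial * g 0 := by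
  have hval : ∀ (k : ℕ) (g : ℝ → ℝ), SmoothNear n g 0 → (∀ᶠ x in 𝓝 0, f x = x ^ k * g x) →
      iteratedDeriv k f 0 = k.factorial * g 0 := by
    intro k g hg hfg
    have h1 : HasTaylor f (PowerSeries.X ^ k * taylorSeries g) := by
      have h2 := (hasTaylor_eval (Polynomial.X ^ k)).mul
        (hasTaylor_taylorSeries (hg.contDiffAt.of_le (infty_le_of_infinite hn)))
      simp only [Polynomial.eval_pow, Polynomial.eval_X, Polynomial.coe_pow,
        Polynomial.coe_X] at h2
      exact h2.congr hfg
    rw [h1.iteratedDeriv_eq (hf.contDiffAt.of_le (infty_le_of_infinite hn)),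
      PowerSeries.coeff_X_pow_mul', if_pos le_rfl, Nat.sub_self]
    simp [taylorSeries]
  suffices ∃ g : ℝ → ℝ, SmoothNear n g 0 ∧ (∀ᶠ x in 𝓝 0, f x = x ^ k * g x) by
    obtain ⟨g, hg, hfg⟩ := this
    exact ⟨g, hg, hfg, hval k g hg hfg⟩
  induction k with
  | zero => exact ⟨f, hf, by simp⟩
  | succ k ih =>
    obtain ⟨g, hg, hfg⟩ := ih fun j hj => h0 j (by omega)
    have h1 := hval k g hg hfg
    rw [h0 k (by omega)] at h1
    have hg0 : g 0 = 0 := by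
      rcases mul_eq_zero.1 h1.symm with h | h
      · exact absurd h (by positivity)
      · exact h
    obtain ⟨g', hg', hgg⟩ := hg.exists_eq_id_mul hn hg0
    refine ⟨g', hg', ?_⟩
    filter_upwards [hfg, hgg] with x h1 h2
    rw [h1, h2]; ring

theorem dY_dY_zero (H : ℝ × ℝ → ℝ) :
    dY (dY H) 0 = 2 * PowerSeries.coeff 2 (taylorSeries fun y => H (0, y)) := by
  rw [taylorSeries, PowerSeries.coeff_mk, iteratedDeriv_succ, iteratedDeriv_one]
  rw [Nat.factorial_two, Nat.cast_ofNat, mul_div_cancel₀ _ two_ne_zero]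
  rfl

/-- `H(x, φ(x) + v) - H(x, φ(x)) = v² K(x, v)` with a smooth function `K`. -/
theorem exists_quadratic_factor (hn : n = ∞ ∨ n = ω) (hH : SmoothNear n H 0) {φ : ℝ → ℝ}
    (hφ : SmoothNear n φ 0) (hφ0 : φ 0 = 0) (hcrit : ∀ᶠ x in 𝓝 0, dY H (x, φ x) = 0)
    (hom : PowerSeries.coeff 2 (taylorSeries fun y => H (0, y)) = om / 2) :
    ∃ K : ℝ × ℝ → ℝ, SmoothNear n K 0 ∧ K 0 = om / 2 ∧
      ∀ᶠ z in 𝓝 (0 : ℝ × ℝ), H (z.1, φ z.1 + z.2) = H (z.1, φ z.1) + z.2 ^ 2 * K z := by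
  have hfst : SmoothNear n (fun z : ℝ × ℝ => z.1) 0 := SmoothNear.of_contDiff contDiff_fst
  have hsnd : SmoothNear n (fun z : ℝ × ℝ => z.2) 0 := SmoothNear.of_contDiff contDiff_snd
  have hφ1 : SmoothNear n (fun z : ℝ × ℝ => φ z.1) 0 := hφ.comp_of_eq hfst rfl
  have e0 : ((0 : ℝ), φ 0) = (0 : ℝ × ℝ) := by rw [hφ0]; rfl
  have hs1 : SmoothNear n (fun z : ℝ × ℝ => H (z.1, φ z.1 + z.2)) 0 :=
    hH.comp_of_eq (hfst.prodMk (hφ1.add hsnd)) (by simp [hφ0])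
  have hs2 : SmoothNear n (fun z : ℝ × ℝ => H (z.1, φ z.1)) 0 :=
    hH.comp_of_eq (hfst.prodMk hφ1) (by simp [hφ0])
  obtain ⟨g, hg, hfg, -⟩ := (hs1.sub hs2).exists_eq_snd_mul hn (by simp)
  have hi0 : Tendsto (fun x : ℝ => (x, (0 : ℝ))) (𝓝 0) (𝓝 0) := by
    have : Continuous fun x : ℝ => (x, (0 : ℝ)) := by fun_prop
    exact this.tendsto 0
  -- The factor `g(x, 0)` is the derivative in `v` at `v = 0`, that is `H_y(x, φ(x)) = 0`; so a
  -- second factor `v` can be split off.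
  have hgz : ∀ᶠ x in 𝓝 (0 : ℝ), g (x, 0) = 0 := by
    have hcx : Tendsto (fun x : ℝ => (x, φ x)) (𝓝 0) (𝓝 0) := by
      have : ContinuousAt (fun x : ℝ => (x, φ x)) 0 := continuousAt_id.prodMk hφ.continuousAt
      have h := this.tendsto
      rwa [hφ0] at h
    filter_upwards [hi0.eventually hg, hi0.eventually hfg.eventually_nhds, hcrit,
      hcx.eventually hH] with x h1 h2 h3 h4
    have hn0 := ne_zero_of_infinite hn
    have d1 : HasDerivAt (fun v => H (x, φ x + v) - H (x, φ x)) 0 0 := by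
      have := hasDerivAt_dY (h4.differentiableAt hn0)
      rw [h3] at this
      have h5 : HasDerivAt (fun v : ℝ => φ x + v) 1 0 := (hasDerivAt_id 0).const_add _
      have h6 : HasDerivAt (fun s => H (x, s)) 0 (φ x + 0) := by simpa using this
      have := (HasDerivAt.comp (0 : ℝ) h6 h5).sub_const (H (x, φ x))
      simpa using this
    have d2 : HasDerivAt (fun v => v * g (x, v)) (g (x, 0)) 0 := by
      have := (hasDerivAt_id (0 : ℝ)).fun_mul (hasDerivAt_dY (h1.differentiableAt hn0))
      simpa using this
    have ht : Tendsto (fun v : ℝ => (x, v)) (𝓝 0) (𝓝 (x, 0)) := by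
      have : Continuous fun v : ℝ => (x, v) := by fun_prop
      exact this.tendsto 0
    have d3 := d2.congr_of_eventuallyEq (ht.eventually h2)
    exact d3.unique d1
  obtain ⟨K, hK, hgK, -⟩ := hg.exists_eq_snd_mul hn hgz
  have hfK : ∀ᶠ z in 𝓝 (0 : ℝ × ℝ), H (z.1, φ z.1 + z.2) = H (z.1, φ z.1) + z.2 ^ 2 * K z := by
    filter_upwards [hfg, hgK] with z h1 h2
    rw [h2] at h1; linarith
  refine ⟨K, hK, ?_, hfK⟩
  have hj : SmoothNear n (fun v : ℝ => ((0 : ℝ), v)) 0 := SmoothNear.of_contDiff (by fun_prop)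
  have hK0 : SmoothNear n (fun v : ℝ => K (0, v)) 0 := hK.comp_of_eq hj rfl
  have hle := infty_le_of_infinite hn
  -- On `x = 0` the factorization reads `H(0, v) = H(0) + v² K(0, v)`; comparing coefficients of
  -- `v²` gives `K(0)`.
  have hT : HasTaylor (fun v => H (0, v)) (PowerSeries.C (H 0) +
      PowerSeries.X ^ 2 * taylorSeries fun v => K (0, v)) := by
    have h2 := (hasTaylor_const (H 0)).add ((hasTaylor_eval (Polynomial.X ^ 2)).mul
      (hasTaylor_taylorSeries (hK0.contDiffAt.of_le hle)))
    simp only [Polynomial.eval_pow, Polynomial.eval_X, Polynomial.coe_pow,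
      Polynomial.coe_X] at h2
    refine h2.congr ?_
    have := hj.continuousAt.eventually hfK
    filter_upwards [this] with v hv
    simpa [hφ0, ← Prod.zero_eq_mk] using hv
  have hH0 : SmoothNear n (fun v : ℝ => H (0, v)) 0 := hH.comp_of_eq hj rfl
  have := hT.unique (hasTaylor_taylorSeries (hH0.contDiffAt.of_le hle))
  rw [← this] at hom
  simp only [map_add, PowerSeries.coeff_C, PowerSeries.coeff_X_pow_mul'] at hom
  rw [Prod.zero_eq_mk]; simpa [taylorSeries] using hom

end NormalForm

end Melnikov

/-! ### Normal coordinates -/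

namespace Melnikov

/-- Coordinates `(u, w)` near the origin, `(x, y) = (χ(u), Y(u, w))`, in which the Hamiltonian is
`u ^ (2 p) + w ^ 2`; they are adapted to the critical curve and to the function `ψ`. -/
structure NormalCoords (n : WithTop ℕ∞) (H : ℝ × ℝ → ℝ) (U : Set (ℝ × ℝ)) (p : ℕ) where
  χ : ℝ → ℝ
  Y : ℝ × ℝ → ℝ
  Φ : ℝ × ℝ → ℝ × ℝ
  W : Set (ℝ × ℝ)
  r : ℝ
  r_pos : 0 < r
  contDiffOn_χ : ContDiffOn ℝ n χ (Ioo (-r) r)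
  contDiffOn_Y : ContDiffOn ℝ n Y (Metric.ball 0 r)
  χ_zero : χ 0 = 0
  Y_zero : Y 0 = 0
  deriv_χ_pos : ∀ u ∈ Ioo (-r) r, 0 < deriv χ u
  dY_Y_pos : ∀ c ∈ Metric.ball (0 : ℝ × ℝ) r, 0 < dY Y c
  isOpen_W : IsOpen W
  W_subset : W ⊆ U
  differentiableOn_Φ : DifferentiableOn ℝ Φ W
  Φ_mem : ∀ z ∈ W, Φ z ∈ Metric.ball (0 : ℝ × ℝ) r
  mem_W : ∀ c ∈ Metric.ball (0 : ℝ × ℝ) r, (χ c.1, Y c) ∈ W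
  left_inv : ∀ z ∈ W, (χ (Φ z).1, Y (Φ z)) = z
  right_inv : ∀ c ∈ Metric.ball (0 : ℝ × ℝ) r, Φ (χ c.1, Y c) = c
  energy : ∀ c ∈ Metric.ball (0 : ℝ × ℝ) r, H (χ c.1, Y c) = c.1 ^ (2 * p) + c.2 ^ 2
  crit : ∀ u ∈ Ioo (-r) r, critCurve H (χ u) = Y (u, 0)
  psiInv_eq : ∀ u ∈ Ioo (-r) r, psiInv H p u = χ u
  deriv_psi : ∀ u ∈ Ioo (-r) r, deriv (psi H p) (χ u) = (deriv χ u)⁻¹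

/-- The sign cancels the modulus in `(x ^ (2 p)) ^ (1 / (2 p)) = |x|`. The right-hand side is
visibly smooth at `0`, which the definition of `ψ` is not. -/
theorem psi_eventuallyEq {H : ℝ × ℝ → ℝ} {p : ℕ} (hp : 1 ≤ p) {g : ℝ → ℝ}
    (hg : ContinuousAt g 0) (hg0 : 0 < g 0)
    (hH : ∀ᶠ x in 𝓝 0, H0star H x = x ^ (2 * p) * g x) :
    psi H p =ᶠ[𝓝 0] fun x => x * g x ^ (1 / (2 * (p : ℝ))) := by
  filter_upwards [hH, hg.eventually (eventually_gt_nhds hg0)] with x hx hgx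
  have hp' : (0 : ℝ) < p := by exact_mod_cast hp
  have h1 : ((x ^ (2 * p) : ℝ)) ^ (1 / (2 * (p : ℝ))) = |x| := by
    have : x ^ (2 * p) = |x| ^ ((2 * p : ℕ) : ℝ) := by
      rw [Real.rpow_natCast, pow_mul, pow_mul, sq_abs]
    rw [this, ← Real.rpow_mul (abs_nonneg x)]
    have : ((2 * p : ℕ) : ℝ) * (1 / (2 * (p : ℝ))) = 1 := by
      push_cast; field_simp
    rw [this, Real.rpow_one]
  have h2 : Real.sign x * |x| = x := by
    rcases lt_trichotomy x 0 with h | h | h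
    · rw [Real.sign_of_neg h, abs_of_neg h]; ring
    · simp [h]
    · rw [Real.sign_of_pos h, abs_of_pos h]; ring
  have h3 : (0 : ℝ) ≤ x ^ (2 * p) := by rw [pow_mul]; positivity
  rw [psi, hx, Real.mul_rpow h3 hgx.le, h1, ← mul_assoc, h2]

/-- `psiInv` is an arbitrary continuous right inverse of `ψ` vanishing at `0`; since `χ` is also a
left inverse, the two agree near `0`. -/
theorem psiInv_eventuallyEq {n : WithTop ℕ∞} (hn : n = ∞ ∨ n = ω) {H : ℝ × ℝ → ℝ} {p : ℕ}
    {χ : ℝ → ℝ} (hχ : SmoothNear n χ 0) (hχ0 : χ 0 = 0)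
    (hr : ∀ᶠ u in 𝓝 0, psi H p (χ u) = u) (hl : ∀ᶠ x in 𝓝 0, χ (psi H p x) = x) :
    psiInv H p =ᶠ[𝓝 0] χ := by
  have hex : ∃ f, IsPsiInverse H p f := by
    obtain ⟨ε, hε, hb⟩ := Metric.eventually_nhds_iff_ball.1 (hχ.and hr)
    have hball : Metric.ball (0 : ℝ) ε = Ioo (-ε) ε := by simp [Real.ball_eq_Ioo]
    rw [hball] at hb
    exact ⟨χ, hχ0, ε, hε, fun x hx =>
      ((hb x hx).1.of_le (infty_le_of_infinite hn)).contDiffWithinAt, fun x hx => (hb x hx).2⟩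
  obtain ⟨h0, ε, hε, hs, hc⟩ : IsPsiInverse H p (psiInv H p) := Classical.epsilon_spec hex
  have hmem : Ioo (-ε) ε ∈ 𝓝 (0 : ℝ) := Ioo_mem_nhds (by linarith) hε
  have ht : Tendsto (psiInv H p) (𝓝 0) (𝓝 0) := by
    have := (hs.continuousOn.continuousAt hmem).tendsto
    rwa [h0] at this
  filter_upwards [hmem, ht.eventually hl] with u hu h
  rw [hc u hu] at h
  exact h.symm

/-- The coordinates are `u = ψ(x)` and `w = (y - φ(x)) √K(x, y - φ(x))`; the inverse function
theorem applies because the diagonal derivatives at the origin are `h_{2p} ^ (1 / (2 p))` and `√(om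
/ 2)`. -/
theorem exists_normalCoords {n : WithTop ℕ∞} (hn : n = ∞ ∨ n = ω) {H : ℝ × ℝ → ℝ}
    {U : Set (ℝ × ℝ)} (hU : IsOpen U) (hU0 : (0 : ℝ × ℝ) ∈ U) (hH : ContDiffOn ℝ n H U)
    {om : ℝ} (hom : 0 < om) (hnf : ElementaryForm H om ∨ NilpotentForm H om)
    {p : ℕ} (hp : 1 ≤ p) (hlow : ∀ j < 2 * p, iteratedDeriv j (H0star H) 0 = 0)
    (hlead : 0 < iteratedDeriv (2 * p) (H0star H) 0) :
    Nonempty (NormalCoords n H U p) := by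
  have hn0 := ne_zero_of_infinite hn
  have hHs : SmoothNear n H 0 := ContDiffOn.smoothNear hH hU hU0
  obtain ⟨hH0, hH1, hH2⟩ := iteratedDeriv_axis hHs hn (isBigO_axis_of_normalForm hnf)
  have hdd : dY (dY H) 0 ≠ 0 := by rw [dY_dY_zero, hH2]; linarith
  obtain ⟨φ, hφ, hφ0, hφc, hφu⟩ := exists_critical_curve hn hHs hH1 hdd
  have hcrit := critCurve_eventuallyEq hn hHs hH1 hdd hφu
  obtain ⟨K, hK, hK0, hHK⟩ := exists_quadratic_factor hn hHs hφ hφ0 hφc hH2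
  -- the one-variable factor
  have hx : SmoothNear n (fun x : ℝ => x) 0 := SmoothNear.of_contDiff contDiff_id
  have hH0s : SmoothNear n (fun x => H (x, φ x)) 0 :=
    hHs.comp_of_eq (hx.prodMk hφ) (by simp [hφ0])
  have hH0e : H0star H =ᶠ[𝓝 0] fun x => H (x, φ x) := by
    filter_upwards [hcrit] with x hx
    rw [H0star, hx]
  obtain ⟨g, hg, hHg, hgv⟩ := hH0s.exists_eq_pow_mul hn (2 * p) fun j hj => by
    rw [← hH0e.iteratedDeriv_eq]; exact hlow j hj
  have hg0 : 0 < g 0 := by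
    rw [← hH0e.iteratedDeriv_eq] at hgv
    rw [hgv] at hlead
    exact pos_of_mul_pos_right hlead (by positivity)
  have hpsi := psi_eventuallyEq hp hg.continuousAt hg0 (by
    filter_upwards [hH0e, hHg] with x h1 h2
    rw [h1, h2])
  set ψ : ℝ → ℝ := fun x => x * g x ^ (1 / (2 * (p : ℝ))) with hψdef
  have hψ : SmoothNear n ψ 0 := hx.mul (hg.rpow_const hg0.ne' _)
  have hψ0 : ψ 0 = 0 := by simp [hψdef]
  have hψ' : HasDerivAt ψ (g 0 ^ (1 / (2 * (p : ℝ)))) 0 := by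
    have h1 := ((hg.rpow_const hg0.ne' (1 / (2 * (p : ℝ)))).contDiffAt.differentiableAt
      hn0).hasDerivAt
    have := (hasDerivAt_id (0 : ℝ)).fun_mul h1
    simpa [hψdef] using this
  have hψe : ∀ᶠ x in 𝓝 0, H (x, φ x) = ψ x ^ (2 * p) := by
    filter_upwards [hHg, hg.continuousAt.eventually (eventually_gt_nhds hg0)] with x h1 h2
    have hp' : (0 : ℝ) < p := by exact_mod_cast hp
    rw [h1, hψdef]
    simp only [mul_pow]
    rw [← Real.rpow_natCast (g x ^ _), ← Real.rpow_mul h2.le]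
    have : 1 / (2 * (p : ℝ)) * ((2 * p : ℕ) : ℝ) = 1 := by push_cast; field_simp
    rw [this, Real.rpow_one]
  -- the transformation of the plane
  have hfst : SmoothNear n (fun z : ℝ × ℝ => z.1) 0 := SmoothNear.of_contDiff contDiff_fst
  have hsnd : SmoothNear n (fun z : ℝ × ℝ => z.2) 0 := SmoothNear.of_contDiff contDiff_snd
  have hφ1 : SmoothNear n (fun z : ℝ × ℝ => φ z.1) 0 := hφ.comp_of_eq hfst rfl
  have hv : SmoothNear n (fun z : ℝ × ℝ => z.2 - φ z.1) 0 := hsnd.sub hφ1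
  have hsh : SmoothNear n (fun z : ℝ × ℝ => (z.1, z.2 - φ z.1)) 0 := hfst.prodMk hv
  have hsh0 : Tendsto (fun z : ℝ × ℝ => (z.1, z.2 - φ z.1)) (𝓝 0) (𝓝 0) := by
    have := hsh.continuousAt.tendsto
    simpa [hφ0, ← Prod.zero_eq_mk] using this
  have hK1 : SmoothNear n (fun z : ℝ × ℝ => K (z.1, z.2 - φ z.1)) 0 :=
    hK.comp_of_eq hsh (by simp [hφ0])
  have hK10 : K ((0 : ℝ × ℝ).1, (0 : ℝ × ℝ).2 - φ (0 : ℝ × ℝ).1) = om / 2 := by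
    rw [← hK0]; simp [hφ0, ← Prod.zero_eq_mk]
  have hKne : K ((0 : ℝ × ℝ).1, (0 : ℝ × ℝ).2 - φ (0 : ℝ × ℝ).1) ≠ 0 := by
    rw [hK10]; positivity
  have hKp : ∀ᶠ z in 𝓝 (0 : ℝ × ℝ), 0 < K (z.1, z.2 - φ z.1) :=
    hK1.continuousAt.eventually (eventually_gt_nhds (by
      show 0 < K ((0 : ℝ × ℝ).1, (0 : ℝ × ℝ).2 - φ (0 : ℝ × ℝ).1)
      rw [hK10]; positivity))
  set Φ₂ : ℝ × ℝ → ℝ := fun z => (z.2 - φ z.1) * √(K (z.1, z.2 - φ z.1)) with hΦ₂def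
  have hΦ₂ : SmoothNear n Φ₂ 0 := hv.mul (hK1.sqrt hKne)
  have hΦ₂y : dY Φ₂ 0 = √(om / 2) := by
    have hs : SmoothNear n (fun s : ℝ => √(K ((0 : ℝ × ℝ).1, s - φ (0 : ℝ × ℝ).1))) 0 :=
      SmoothNear.comp_of_eq (g := fun z : ℝ × ℝ => √(K (z.1, z.2 - φ z.1)))
        (f := fun s : ℝ => ((0 : ℝ), s)) (hK1.sqrt hKne)
        (SmoothNear.of_contDiff (by fun_prop)) rfl
    have h1 := ((hasDerivAt_id (0 : ℝ)).sub_const (φ 0)).fun_mul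
      (hs.contDiffAt.differentiableAt hn0).hasDerivAt
    have h2 := h1.deriv
    rw [dY]
    simp only [hΦ₂def]
    refine Eq.trans h2 ?_
    have h3 : K (0, 0) = om / 2 := hK0
    simp [hφ0, h3]
  have hpos : 0 < √(om / 2) := by positivity
  set Φ : ℝ × ℝ → ℝ × ℝ := fun z => (ψ z.1, Φ₂ z) with hΦdef
  have hΦ : SmoothNear n Φ 0 := (hψ.comp_of_eq hfst rfl).prodMk hΦ₂
  have hΦ0 : Φ 0 = 0 := by simp [hΦdef, hψ0, hΦ₂def, hφ0, ← Prod.zero_eq_mk]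
  have hd0 : g 0 ^ (1 / (2 * (p : ℝ))) ≠ 0 := (Real.rpow_pos_of_pos hg0 _).ne'
  have hΦ' := hasFDerivAt_triangular (z := 0) hψ' (hΦ₂.contDiffAt.differentiableAt hn0) hd0
    (by rw [hΦ₂y]; exact hpos.ne')
  obtain ⟨Ψ, hΨ, hΨ0, hΨΦ, hΦΨ⟩ := hΦ.exists_inverse hn hΦ'
  rw [hΦ0] at hΨ hΨ0 hΦΨ
  have tΨ : Tendsto Ψ (𝓝 0) (𝓝 0) := by
    have := hΨ.continuousAt.tendsto
    rwa [hΨ0] at this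
  have tΨ1 : Tendsto (fun c => (Ψ c).1) (𝓝 0) (𝓝 0) :=
    (continuous_fst.tendsto (0 : ℝ × ℝ)).comp tΨ
  have tfst : Tendsto (fun z : ℝ × ℝ => z.1) (𝓝 0) (𝓝 0) := continuous_fst.tendsto (0 : ℝ × ℝ)
  have hi : SmoothNear n (fun u : ℝ => (u, (0 : ℝ))) 0 := SmoothNear.of_contDiff (by fun_prop)
  have ti : Tendsto (fun u : ℝ => (u, (0 : ℝ))) (𝓝 0) (𝓝 0) := hi.continuousAt
  set χ : ℝ → ℝ := fun u => (Ψ (u, 0)).1 with hχdef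
  have hχ : SmoothNear n χ 0 :=
    (SmoothNear.comp_of_eq (g := Ψ) (f := fun u : ℝ => (u, (0 : ℝ))) hΨ hi rfl).fst
  have hχ0 : χ 0 = 0 := by
    have : Ψ ((0 : ℝ), (0 : ℝ)) = 0 := hΨ0
    simp [hχdef, this]
  have tχ : Tendsto χ (𝓝 0) (𝓝 0) := by
    have := hχ.continuousAt.tendsto
    rwa [hχ0] at this
  have hχψ : ∀ᶠ x in 𝓝 0, χ (ψ x) = x := by
    have tc : Tendsto (fun x : ℝ => (x, φ x)) (𝓝 0) (𝓝 0) := by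
      have : ContinuousAt (fun x : ℝ => (x, φ x)) 0 := continuousAt_id.prodMk hφ.continuousAt
      have h := this.tendsto
      rwa [hφ0] at h
    filter_upwards [tc.eventually hΨΦ] with x hx
    have : Φ (x, φ x) = (ψ x, 0) := by simp [hΦdef, hΦ₂def]
    rw [this] at hx
    simp [hχdef, hx]
  -- The first component of `Φ` depends on `x` alone, hence that of the inverse on `u` alone.
  have hΨ1 : ∀ᶠ c in 𝓝 (0 : ℝ × ℝ), (Ψ c).1 = χ c.1 := by
    filter_upwards [hΦΨ, tΨ1.eventually hχψ] with c h1 h2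
    have h3 : ψ (Ψ c).1 = c.1 := congrArg Prod.fst h1
    rw [h3] at h2; exact h2.symm
  have hψχ : ∀ᶠ u in 𝓝 0, ψ (χ u) = u := by
    filter_upwards [ti.eventually hΦΨ] with u h1
    exact congrArg Prod.fst h1
  have henergy : ∀ᶠ z in 𝓝 (0 : ℝ × ℝ), H z = (Φ z).1 ^ (2 * p) + (Φ z).2 ^ 2 := by
    filter_upwards [hsh0.eventually hHK, hKp, tfst.eventually hψe] with z h1 h2 h3
    simp only [add_sub_cancel, h3] at h1
    have h1' : H z = _ := h1
    rw [h1', hΦdef, hΦ₂def]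
    simp only [mul_pow, Real.sq_sqrt h2.le]
  have hcritχ : ∀ᶠ u in 𝓝 0, critCurve H (χ u) = (Ψ (u, 0)).2 := by
    filter_upwards [ti.eventually hΦΨ, (tΨ.comp ti).eventually hKp, tχ.eventually hcrit]
      with u h1 h2 h3
    have h4 : Φ₂ (Ψ (u, 0)) = 0 := congrArg Prod.snd h1
    have h5 := (mul_eq_zero.1 h4).resolve_right (Real.sqrt_pos.2 h2).ne'
    rw [h3]
    have : φ (χ u) = φ (Ψ (u, 0)).1 := rfl
    rw [this]; linarith
  have hψ1 : ∀ᶠ u in 𝓝 0, psi H p (χ u) = u := by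
    filter_upwards [hψχ, tχ.eventually hpsi] with u h1 h2
    rw [h2, h1]
  have hψ2 : ∀ᶠ x in 𝓝 0, χ (psi H p x) = x := by
    filter_upwards [hχψ, hpsi] with x h1 h2
    rw [h2]; exact h1
  have hinv := psiInv_eventuallyEq hn hχ hχ0 hψ1 hψ2
  -- signs of derivatives
  have hprod : ∀ᶠ u in 𝓝 0, deriv ψ (χ u) * deriv χ u = 1 := by
    filter_upwards [hψχ.eventually_nhds, hχ, tχ.eventually hψ] with u h1 h2 h3
    have h4 := HasDerivAt.comp u (h3.differentiableAt hn0).hasDerivAt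
      (h2.differentiableAt hn0).hasDerivAt
    have h5 : HasDerivAt (fun u => u) (deriv ψ (χ u) * deriv χ u) u :=
      h4.congr_of_eventuallyEq (by filter_upwards [h1] with v hv; exact hv.symm)
    exact h5.unique (hasDerivAt_id u)
  have hdpsi : ∀ᶠ u in 𝓝 0, deriv (psi H p) (χ u) = (deriv χ u)⁻¹ := by
    filter_upwards [hprod, tχ.eventually hpsi.eventuallyEq_nhds] with u h1 h2
    rw [h2.deriv_eq]
    exact eq_inv_of_mul_eq_one_left h1
  have hχ'0 : 0 < deriv χ 0 := by
    have h1 := hprod.self_of_nhds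
    rw [hχ0, hψ'.deriv] at h1
    have h2 : 0 < g 0 ^ (1 / (2 * (p : ℝ))) := Real.rpow_pos_of_pos hg0 _
    by_contra h
    nlinarith
  have hχ' : ∀ᶠ u in 𝓝 0, 0 < deriv χ u := by
    have hc : ContinuousAt (deriv χ) 0 := by
      have h1 := (hχ.fderiv hn).continuousAt
      have h2 : ContinuousAt (fun u => fderiv ℝ χ u 1) 0 := h1.clm_apply continuousAt_const
      simpa only [fderiv_apply_one_eq_deriv] using h2
    exact hc.eventually (eventually_gt_nhds hχ'0)
  set Y : ℝ × ℝ → ℝ := fun c => (Ψ c).2 with hYdef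
  have hY : SmoothNear n Y 0 := hΨ.snd
  have hY'0 : 0 < dY Y 0 := by
    -- On the axis `u = 0` the second coordinate is inverted by `w ↦ Y(0, w)`; differentiating gives
    -- `√(om / 2) · Y_w(0) = 1`.
    have h1 : ∀ᶠ w in 𝓝 (0 : ℝ), Φ₂ (0, Y (0, w)) = w := by
      have hj : Tendsto (fun w : ℝ => ((0 : ℝ), w)) (𝓝 0) (𝓝 0) := by
        have : Continuous fun w : ℝ => ((0 : ℝ), w) := by fun_prop
        exact this.tendsto 0
      filter_upwards [hj.eventually hΦΨ, hj.eventually hΨ1] with w h1 h2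
      have h3 : Φ₂ (Ψ (0, w)) = w := congrArg Prod.snd h1
      have h4 : (0, Y (0, w)) = Ψ (0, w) := Prod.ext (by rw [h2]; exact hχ0.symm) rfl
      rw [h4]; exact h3
    have hY0 : Y 0 = 0 := by simp [hYdef, hΨ0]
    have h2 : HasDerivAt (fun s => Φ₂ (0, s)) (√(om / 2)) (Y (0, 0)) := by
      have := hasDerivAt_dY (hΦ₂.contDiffAt.differentiableAt hn0)
      rw [hΦ₂y] at this
      have h3 : Y (0, 0) = 0 := hY0
      rw [h3]; exact this
    have h3 : HasDerivAt (fun w => Y (0, w)) (dY Y 0) 0 :=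
      hasDerivAt_dY (hY.contDiffAt.differentiableAt hn0)
    have h4 := HasDerivAt.comp (0 : ℝ) h2 h3
    have h5 : HasDerivAt (fun w : ℝ => w) (√(om / 2) * dY Y 0) 0 :=
      h4.congr_of_eventuallyEq (by filter_upwards [h1] with v hv; exact hv.symm)
    have h6 := h5.unique (hasDerivAt_id 0)
    by_contra h
    nlinarith
  have hY' : ∀ᶠ c in 𝓝 0, 0 < dY Y c :=
    (hY.dY hn).continuousAt.eventually (eventually_gt_nhds hY'0)
  -- the domains
  obtain ⟨W₀, hW₀, hW₀o, h0W₀⟩ := eventually_nhds_iff.1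
    (hΦ.and (hΨΦ.and (henergy.and (hU.mem_nhds hU0))))
  have h1d : ∀ᶠ u in 𝓝 (0 : ℝ), ContDiffAt ℝ n χ u ∧ 0 < deriv χ u ∧
      critCurve H (χ u) = (Ψ (u, 0)).2 ∧ psiInv H p u = χ u ∧
      deriv (psi H p) (χ u) = (deriv χ u)⁻¹ :=
    hχ.and (hχ'.and (hcritχ.and (hinv.and hdpsi)))
  have h2d : ∀ᶠ c in 𝓝 (0 : ℝ × ℝ), ContDiffAt ℝ n Y c ∧ 0 < dY Y c ∧ Φ (Ψ c) = c ∧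
      (Ψ c).1 = χ c.1 ∧ Ψ c ∈ W₀ :=
    hY.and (hY'.and (hΦΨ.and (hΨ1.and (tΨ.eventually (hW₀o.mem_nhds h0W₀)))))
  obtain ⟨r₁, hr₁, hb₁⟩ := Metric.eventually_nhds_iff_ball.1 h1d
  obtain ⟨r₂, hr₂, hb₂⟩ := Metric.eventually_nhds_iff_ball.1 h2d
  set r := min r₁ r₂ with hrdef
  have hr : 0 < r := lt_min hr₁ hr₂
  have hb₁' : ∀ u ∈ Ioo (-r) r, u ∈ Metric.ball (0 : ℝ) r₁ := fun u hu => by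
    rw [Real.ball_eq_Ioo]
    have := min_le_left r₁ r₂
    exact ⟨by linarith [hu.1], by linarith [hu.2]⟩
  have hb₂' : ∀ c ∈ Metric.ball (0 : ℝ × ℝ) r, c ∈ Metric.ball (0 : ℝ × ℝ) r₂ := fun c hc =>
    Metric.ball_subset_ball (min_le_right _ _) hc
  have hΨeq : ∀ c ∈ Metric.ball (0 : ℝ × ℝ) r, (χ c.1, Y c) = Ψ c := fun c hc =>
    Prod.ext (hb₂ c (hb₂' c hc)).2.2.2.1.symm rfl
  have hcont : ContinuousOn Φ W₀ := fun z hz => (hW₀ z hz).1.continuousAt.continuousWithinAt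
  refine ⟨{
    χ := χ
    Y := Y
    Φ := Φ
    -- Cutting `W₀` down to the preimage of the ball makes `W` and the ball correspond bijectively.
    W := W₀ ∩ Φ ⁻¹' Metric.ball 0 r
    r := r
    r_pos := hr
    contDiffOn_χ := fun u hu => (hb₁ u (hb₁' u hu)).1.contDiffWithinAt
    contDiffOn_Y := fun c hc => (hb₂ c (hb₂' c hc)).1.contDiffWithinAt
    χ_zero := hχ0
    Y_zero := by simp [hYdef, hΨ0]
    deriv_χ_pos := fun u hu => (hb₁ u (hb₁' u hu)).2.1
    dY_Y_pos := fun c hc => (hb₂ c (hb₂' c hc)).2.1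
    isOpen_W := hcont.isOpen_inter_preimage hW₀o Metric.isOpen_ball
    W_subset := fun z hz => (hW₀ z hz.1).2.2.2
    differentiableOn_Φ := fun z hz =>
      ((hW₀ z hz.1).1.differentiableAt hn0).differentiableWithinAt
    Φ_mem := fun z hz => hz.2
    mem_W := fun c hc => by
      rw [hΨeq c hc]
      refine ⟨(hb₂ c (hb₂' c hc)).2.2.2.2, ?_⟩
      rw [mem_preimage, (hb₂ c (hb₂' c hc)).2.2.1]
      exact hc
    left_inv := fun z hz => by
      rw [hΨeq _ hz.2]; exact (hW₀ z hz.1).2.1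
    right_inv := fun c hc => by
      rw [hΨeq c hc]; exact (hb₂ c (hb₂' c hc)).2.2.1
    energy := fun c hc => by
      rw [hΨeq c hc, (hW₀ _ (hb₂ c (hb₂' c hc)).2.2.2.2).2.2.1, (hb₂ c (hb₂' c hc)).2.2.1]
    crit := fun u hu => (hb₁ u (hb₁' u hu)).2.2.1
    psiInv_eq := fun u hu => (hb₁ u (hb₁' u hu)).2.2.2.1
    deriv_psi := fun u hu => (hb₁ u (hb₁' u hu)).2.2.2.2 }⟩

end Melnikov

namespace Melnikov

/-! ### Reparametrization of time -/

section TimeChange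

/-- A positive continuous periodic function is the reciprocal speed of a change of time. -/
theorem exists_time_change {g : ℝ → ℝ} (hg : Continuous g) (hpos : ∀ s, 0 < g s) {L : ℝ}
    (hL : 0 < L) (hper : Function.Periodic g L) :
    ∃ θ : ℝ → ℝ, ∃ T : ℝ, 0 < T ∧ θ 0 = 0 ∧ StrictMono θ ∧ Function.Surjective θ ∧
      (∀ t, θ (t + T) = θ t + L) ∧ ∀ t, HasDerivAt θ (g (θ t))⁻¹ t := by
  -- `τ(s)` is the time needed to reach the parameter `s`; the change of time is its inverse, and
  -- the new period is `τ(L)`.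
  set τ : ℝ → ℝ := fun s => ∫ x in (0 : ℝ)..s, g x with hτ
  have hint : ∀ a b, IntervalIntegrable g MeasureTheory.volume a b := fun a b =>
    hg.intervalIntegrable a b
  have hd : ∀ s, HasDerivAt τ (g s) s := fun s =>
    intervalIntegral.integral_hasDerivAt_right (hint 0 s)
      hg.stronglyMeasurable.stronglyMeasurableAtFilter hg.continuousAt
  have hmono : StrictMono τ := strictMono_of_deriv_pos fun s => by
    rw [(hd s).deriv]; exact hpos s
  have hcont : Continuous τ := continuous_iff_continuousAt.2 fun s => (hd s).continuousAt
  have hLpos : 0 < ∫ x in (0 : ℝ)..L, g x :=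
    intervalIntegral.intervalIntegral_pos_of_pos (hint 0 L) hpos hL
  have hsurj : Function.Surjective τ :=
    hcont.surjective (hper.tendsto_atTop_intervalIntegral_of_pos hLpos hL)
      (hper.tendsto_atBot_intervalIntegral_of_pos hLpos hL)
  set e := hmono.orderIsoOfSurjective τ hsurj with he
  have hτe : ∀ s, e s = τ s := fun s => rfl
  have hes : ∀ t, τ (e.symm t) = t := fun t => by rw [← hτe, OrderIso.apply_symm_apply]
  have hshift : ∀ s, τ (s + L) = τ s + τ L := fun s => by
    have h1 := hper.intervalIntegral_add_eq 0 s
    rw [zero_add] at h1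
    have h2 := intervalIntegral.integral_add_adjacent_intervals (hint 0 s) (hint s (s + L))
    rw [← h1] at h2
    exact h2.symm
  refine ⟨e.symm, τ L, hLpos, ?_, e.symm.strictMono, e.symm.surjective, fun t => ?_, fun t => ?_⟩
  · apply hmono.injective
    rw [hes]; simp [hτ]
  · apply hmono.injective
    rw [hes, hshift, hes]
  · exact (hd (e.symm t)).of_local_left_inverse e.symm.continuous.continuousAt (hpos _).ne'
      (Eventually.of_forall hes)

end TimeChange

/-! ### Parametrization of the model level curves -/

section LevelCurve

/-- The sum `1 + x² + ⋯ + x^(2p-2)`. -/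
noncomputable def evenGeom (p : ℕ) (x : ℝ) : ℝ := ∑ k ∈ Finset.range p, (x ^ 2) ^ k

/-- With `x = sin θ` this gives `1 - sin^{2p} θ = cos² θ · S(sin θ)` with `S > 0`. So `cos θ √S` is
a signed square root that stays smooth at the turning points, where the plain square root is not. -/
theorem evenGeom_mul (p : ℕ) (x : ℝ) : (1 - x ^ 2) * evenGeom p x = 1 - x ^ (2 * p) := by
  have := mul_neg_geom_sum (x ^ 2) p
  rw [evenGeom, this, pow_mul]

theorem evenGeom_pos {p : ℕ} (hp : 1 ≤ p) (x : ℝ) : 0 < evenGeom p x := by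
  rw [evenGeom]
  obtain ⟨q, rfl⟩ : ∃ q, p = q + 1 := ⟨p - 1, by omega⟩
  rw [Finset.sum_range_succ']
  have : 0 ≤ ∑ k ∈ Finset.range q, (x ^ 2) ^ (k + 1) := Finset.sum_nonneg fun k _ => by positivity
  simp only [pow_zero]; linarith

theorem continuous_evenGeom (p : ℕ) : Continuous (evenGeom p) := by
  unfold evenGeom; fun_prop

theorem hasDerivAt_cos_mul_sqrt_evenGeom {p : ℕ} (hp : 1 ≤ p) (θ : ℝ) :
    HasDerivAt (fun θ => Real.cos θ * √(evenGeom p (Real.sin θ)))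
      (-(p * Real.sin θ ^ (2 * p - 1) / √(evenGeom p (Real.sin θ)))) θ := by
  have hdiff : Differentiable ℝ (evenGeom p) := by unfold evenGeom; fun_prop
  set x := Real.sin θ with hx
  have h1 := (hdiff x).hasDerivAt
  have hS := evenGeom_pos hp x
  have hsq := Real.sq_sqrt hS.le
  have hsp := Real.sqrt_pos.2 hS
  -- Differentiating `(1 - x²) S(x) = 1 - x ^ (2 p)` replaces the unwieldy derivative of `S`.
  have hid : -(2 * x) * evenGeom p x + (1 - x ^ 2) * deriv (evenGeom p) x
      = -((2 * p : ℕ) * x ^ (2 * p - 1)) := by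
    have h2 : HasDerivAt (fun x => (1 - x ^ 2) * evenGeom p x)
        (-(2 * x) * evenGeom p x + (1 - x ^ 2) * deriv (evenGeom p) x) x := by
      have := ((hasDerivAt_pow 2 x).const_sub 1).fun_mul h1
      simpa using this
    have h3 : HasDerivAt (fun x : ℝ => 1 - x ^ (2 * p)) (-((2 * p : ℕ) * x ^ (2 * p - 1))) x :=
      (hasDerivAt_pow (2 * p) x).const_sub 1
    simp only [evenGeom_mul] at h2
    exact h2.unique h3
  have h4 : HasDerivAt (fun θ => √(evenGeom p (Real.sin θ)))
      (deriv (evenGeom p) x * Real.cos θ / (2 * √(evenGeom p x))) θ := by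
    have h5 : HasDerivAt (fun θ => evenGeom p (Real.sin θ)) (deriv (evenGeom p) x * Real.cos θ) θ :=
      HasDerivAt.comp (h₂ := evenGeom p) (h := Real.sin) θ h1 (Real.hasDerivAt_sin θ)
    exact h5.sqrt hS.ne'
  refine ((Real.hasDerivAt_cos θ).fun_mul h4).congr_deriv ?_
  rw [← hx]
  have hc : Real.cos θ ^ 2 = 1 - x ^ 2 := by rw [hx, Real.cos_sq']
  push_cast at hid
  field_simp
  rw [hsq, hc]
  linarith

theorem exists_angle {x c : ℝ} (h : x ^ 2 + c ^ 2 = 1) :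
    ∃ θ : ℝ, Real.sin θ = x ∧ Real.cos θ = c := by
  have hz : ‖(⟨c, x⟩ : ℂ)‖ = 1 := by
    rw [Complex.norm_eq_sqrt_sq_add_sq, Real.sqrt_eq_one]; simp only; linarith
  refine ⟨Complex.arg ⟨c, x⟩, ?_, ?_⟩
  · rw [Complex.sin_arg, hz, div_one]
  · rw [Complex.cos_arg (by rintro h0; rw [h0] at hz; simp at hz), hz, div_one]

theorem angle_injOn {θ₁ θ₂ : ℝ} (h₁ : θ₁ ∈ Ico 0 (2 * Real.pi)) (h₂ : θ₂ ∈ Ico 0 (2 * Real.pi))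
    (hs : Real.sin θ₁ = Real.sin θ₂) (hc : Real.cos θ₁ = Real.cos θ₂) : θ₁ = θ₂ := by
  have h := Real.Angle.cos_sin_inj hc hs
  rw [Real.Angle.angle_eq_iff_two_pi_dvd_sub] at h
  obtain ⟨k, hk⟩ := h
  have hpi := Real.pi_pos
  have hk1 : (k : ℝ) < 1 := by
    by_contra hge; push Not at hge
    nlinarith [h₁.2, h₂.1]
  have hk2 : (-1 : ℝ) < k := by
    by_contra hge; push Not at hge
    nlinarith [h₁.1, h₂.2]
  have : k = 0 := by
    have h3 : k < 1 := by exact_mod_cast hk1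
    have h4 : -1 < k := by exact_mod_cast hk2
    omega
  rw [this] at hk
  simp at hk; linarith

/-- A parametrization of the curve `u ^ (2 p) + w ^ 2 = a ^ (2 p)`. -/
noncomputable def levelCurve (p : ℕ) (a : ℝ) (θ : ℝ) : ℝ × ℝ :=
  (a * Real.sin θ, a ^ p * (Real.cos θ * √(evenGeom p (Real.sin θ))))

theorem levelCurve_energy {p : ℕ} (hp : 1 ≤ p) (a θ : ℝ) :
    (levelCurve p a θ).1 ^ (2 * p) + (levelCurve p a θ).2 ^ 2 = a ^ (2 * p) := by
  have h := evenGeom_mul p (Real.sin θ)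
  have hsq := Real.sq_sqrt (evenGeom_pos hp (Real.sin θ)).le
  rw [← Real.cos_sq'] at h
  simp only [levelCurve, mul_pow, hsq, h]
  ring

theorem exists_levelCurve {p : ℕ} (hp : 1 ≤ p) {a : ℝ} (ha : 0 < a) {c : ℝ × ℝ}
    (hc : c.1 ^ (2 * p) + c.2 ^ 2 = a ^ (2 * p)) : ∃ θ, levelCurve p a θ = c := by
  set x := c.1 / a with hx
  have hS := evenGeom_pos hp x
  have hsp := Real.sqrt_pos.2 hS
  have hc1 : c.1 = a * x := by rw [hx]; field_simp
  have hap : 0 < a ^ p := by positivity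
  -- Dividing out the factor `√S` maps the level curve onto the unit circle, where an angle is
  -- available.
  have h1 : x ^ 2 + (c.2 / (a ^ p * √(evenGeom p x))) ^ 2 = 1 := by
    have h2 := evenGeom_mul p x
    have h3 : (c.2 / (a ^ p * √(evenGeom p x))) ^ 2 = (1 - x ^ (2 * p)) / evenGeom p x := by
      rw [div_pow, mul_pow, Real.sq_sqrt hS.le, ← pow_mul, mul_comm p 2]
      rw [hc1, mul_pow] at hc
      have h4 : c.2 ^ 2 = a ^ (2 * p) * (1 - x ^ (2 * p)) := by linarith
      rw [h4]
      have : 0 < a ^ (2 * p) := by positivity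
      field_simp
    rw [h3, ← h2, mul_div_assoc, div_self hS.ne']; ring
  obtain ⟨θ, hs, hcos⟩ := exists_angle h1
  refine ⟨θ, ?_⟩
  rw [levelCurve, hs, hcos, Prod.ext_iff]
  refine ⟨hc1.symm, ?_⟩
  simp only
  field_simp

theorem levelCurve_injOn {p : ℕ} (hp : 1 ≤ p) {a : ℝ} (ha : 0 < a) :
    InjOn (levelCurve p a) (Ico 0 (2 * Real.pi)) := by
  intro θ₁ h₁ θ₂ h₂ h
  simp only [levelCurve, Prod.mk.injEq] at h
  have hs : Real.sin θ₁ = Real.sin θ₂ := mul_left_cancel₀ ha.ne' h.1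
  have hap : a ^ p ≠ 0 := by positivity
  have h3 := mul_left_cancel₀ hap h.2
  rw [hs] at h3
  exact angle_injOn h₁ h₂ hs
    (mul_right_cancel₀ (Real.sqrt_pos.2 (evenGeom_pos hp _)).ne' h3)

theorem levelCurve_periodic (p : ℕ) (a : ℝ) : Function.Periodic (levelCurve p a) (2 * Real.pi) := by
  intro θ
  simp [levelCurve]

/-- The speed factor of `levelCurve` with respect to the Hamiltonian flow of `u ^ (2 p) + w ^ 2`. -/
noncomputable def levelSpeed (p : ℕ) (a : ℝ) (θ : ℝ) : ℝ :=
  a / (2 * a ^ p * √(evenGeom p (Real.sin θ)))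

theorem levelSpeed_pos {p : ℕ} (hp : 1 ≤ p) {a : ℝ} (ha : 0 < a) (θ : ℝ) :
    0 < levelSpeed p a θ := by
  have := Real.sqrt_pos.2 (evenGeom_pos hp (Real.sin θ))
  rw [levelSpeed]; positivity

/-- Together with the second component: the velocity is the model field `(2 w, -2 p u ^ (2 p - 1))`
times the positive factor `levelSpeed`, so only the time has to be changed. -/
theorem hasDerivAt_levelCurve_fst {p : ℕ} (hp : 1 ≤ p) {a : ℝ} (ha : 0 < a) (θ : ℝ) :
    HasDerivAt (fun θ => (levelCurve p a θ).1)
      (levelSpeed p a θ * (2 * (levelCurve p a θ).2)) θ := by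
  have := Real.sqrt_pos.2 (evenGeom_pos hp (Real.sin θ))
  refine ((Real.hasDerivAt_sin θ).const_mul a).congr_deriv ?_
  rw [levelSpeed, levelCurve]
  field_simp

theorem hasDerivAt_levelCurve_snd {p : ℕ} (hp : 1 ≤ p) {a : ℝ} (ha : 0 < a) (θ : ℝ) :
    HasDerivAt (fun θ => (levelCurve p a θ).2)
      (-(levelSpeed p a θ * (2 * p * (levelCurve p a θ).1 ^ (2 * p - 1)))) θ := by
  have := Real.sqrt_pos.2 (evenGeom_pos hp (Real.sin θ))
  refine ((hasDerivAt_cos_mul_sqrt_evenGeom hp θ).const_mul (a ^ p)).congr_deriv ?_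
  rw [levelSpeed, levelCurve]
  simp only [mul_pow]
  have h1 : a ^ p * a ^ p = a * a ^ (2 * p - 1) := by
    rw [← pow_add, ← pow_succ']; congr 1; omega
  field_simp
  linear_combination -Real.sin θ ^ (2 * p - 1) * h1

theorem continuous_levelCurve (p : ℕ) (a : ℝ) : Continuous (levelCurve p a) := by
  have := continuous_evenGeom p
  unfold levelCurve; fun_prop

theorem continuous_levelSpeed {p : ℕ} (hp : 1 ≤ p) {a : ℝ} (ha : 0 < a) :
    Continuous (levelSpeed p a) := by
  have := continuous_evenGeom p
  unfold levelSpeed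
  refine Continuous.div (by fun_prop) (by fun_prop) fun θ => ?_
  have := Real.sqrt_pos.2 (evenGeom_pos hp (Real.sin θ))
  positivity

end LevelCurve

end Melnikov

/-! ### The periodic orbits -/

namespace Melnikov

/-- The ball is a square for the maximum norm: `r ^ (2 p)` controls `u` and `r ^ 2` controls `w`. -/
theorem mem_ball_of_energy {p : ℕ} {r h : ℝ} (hr : 0 < r) {c : ℝ × ℝ}
    (hc : c.1 ^ (2 * p) + c.2 ^ 2 = h) (h1 : h < min (r ^ 2) (r ^ (2 * p))) :
    c ∈ Metric.ball (0 : ℝ × ℝ) r := by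
  have h2 := lt_min_iff.1 h1
  have e1 : 0 ≤ c.1 ^ (2 * p) := by rw [pow_mul]; positivity
  have e2 : 0 ≤ c.2 ^ 2 := by positivity
  rw [mem_ball_zero_iff, Prod.norm_def, max_lt_iff]
  constructor
  · refine lt_of_pow_lt_pow_left₀ (2 * p) hr.le ?_
    rw [Real.norm_eq_abs, pow_mul, sq_abs, ← pow_mul]
    linarith [h2.2]
  · refine lt_of_pow_lt_pow_left₀ 2 hr.le ?_
    rw [Real.norm_eq_abs, sq_abs]
    linarith [h2.1]

theorem fst_mem_Ioo_of_mem_ball {c : ℝ × ℝ} {r : ℝ} (hc : c ∈ Metric.ball (0 : ℝ × ℝ) r) :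
    c.1 ∈ Ioo (-r) r := by
  rw [mem_ball_zero_iff, Prod.norm_def, max_lt_iff] at hc
  exact abs_lt.1 hc.1

namespace NormalCoords

variable {n : WithTop ℕ∞} {H : ℝ × ℝ → ℝ} {U : Set (ℝ × ℝ)} {p : ℕ} (N : NormalCoords n H U p)

/-- The coordinate transformation `(u, w) ↦ (x, y)`. -/
def Ψ (c : ℝ × ℝ) : ℝ × ℝ := (N.χ c.1, N.Y c)

theorem hasDerivAt_χ (hn : n = ∞ ∨ n = ω) {u : ℝ} (hu : u ∈ Ioo (-N.r) N.r) :
    HasDerivAt N.χ (deriv N.χ u) u :=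
  ((N.contDiffOn_χ.contDiffAt (isOpen_Ioo.mem_nhds hu)).differentiableAt
    (ne_zero_of_infinite hn)).hasDerivAt

theorem differentiableAt_Y (hn : n = ∞ ∨ n = ω) {c : ℝ × ℝ}
    (hc : c ∈ Metric.ball (0 : ℝ × ℝ) N.r) : DifferentiableAt ℝ N.Y c :=
  (N.contDiffOn_Y.contDiffAt (Metric.isOpen_ball.mem_nhds hc)).differentiableAt
    (ne_zero_of_infinite hn)

theorem continuousOn_Ψ : ContinuousOn N.Ψ (Metric.ball 0 N.r) :=
  (N.contDiffOn_χ.continuousOn.comp continuousOn_fst fun _ hc =>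
    fst_mem_Ioo_of_mem_ball hc).prodMk N.contDiffOn_Y.continuousOn

theorem Ψ_zero : N.Ψ 0 = 0 := by
  simp [Ψ, N.χ_zero, N.Y_zero]

theorem zero_mem_W : (0 : ℝ × ℝ) ∈ N.W := by
  have := N.mem_W 0 (Metric.mem_ball_self N.r_pos)
  rwa [show (N.χ (0 : ℝ × ℝ).1, N.Y 0) = N.Ψ 0 from rfl, N.Ψ_zero] at this

theorem tendsto_Ψ : Tendsto N.Ψ (𝓝 0) (𝓝 0) := by
  have := (N.continuousOn_Ψ.continuousAt (Metric.ball_mem_nhds 0 N.r_pos)).tendsto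
  rwa [N.Ψ_zero] at this

theorem differentiableAt_hamiltonian (hn : n = ∞ ∨ n = ω) (hU : IsOpen U)
    (hH : ContDiffOn ℝ n H U) {z : ℝ × ℝ} (hz : z ∈ U) : DifferentiableAt ℝ H z :=
  (hH.contDiffAt (hU.mem_nhds hz)).differentiableAt (ne_zero_of_infinite hn)

/-- The partial derivatives of the Hamiltonian in the coordinates `(u, w)`. -/
theorem partials_H (hn : n = ∞ ∨ n = ω) (hU : IsOpen U) (hH : ContDiffOn ℝ n H U)
    {c : ℝ × ℝ} (hc : c ∈ Metric.ball (0 : ℝ × ℝ) N.r) :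
    dY H (N.Ψ c) * dY N.Y c = 2 * c.2 ∧
      dX H (N.Ψ c) * deriv N.χ c.1 + dY H (N.Ψ c) * dX N.Y c = 2 * p * c.1 ^ (2 * p - 1) := by
  have hHd := differentiableAt_hamiltonian hn hU hH (N.W_subset (N.mem_W c hc))
  have hYd := N.differentiableAt_Y hn hc
  have hχd := N.hasDerivAt_χ hn (fst_mem_Ioo_of_mem_ball hc)
  have hnear : ∀ᶠ c' in 𝓝 c, H (N.Ψ c') = c'.1 ^ (2 * p) + c'.2 ^ 2 := by
    filter_upwards [Metric.isOpen_ball.mem_nhds hc] with c' hc' using N.energy c' hc'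
  constructor
  · have h1 : HasDerivAt (fun s => N.Ψ (c.1, s)) ((0 : ℝ), dY N.Y c) c.2 :=
      (hasDerivAt_const c.2 (N.χ c.1)).prodMk (hasDerivAt_dY hYd)
    have h2 := HasFDerivAt.comp_hasDerivAt c.2 (f := fun s => N.Ψ (c.1, s)) (l := H)
      hHd.hasFDerivAt h1
    have h2' := h2.congr_deriv (fderiv_apply_eq hHd _ _)
    have h3 : HasDerivAt (fun s : ℝ => c.1 ^ (2 * p) + s ^ 2) (2 * c.2) c.2 := by
      simpa using (hasDerivAt_pow 2 c.2).const_add (c.1 ^ (2 * p))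
    have ht : Tendsto (fun s : ℝ => (c.1, s)) (𝓝 c.2) (𝓝 c) := by
      have : Continuous fun s : ℝ => (c.1, s) := by fun_prop
      exact this.tendsto c.2
    have h4 := h3.congr_of_eventuallyEq (ht.eventually hnear)
    have h5 := h2'.unique h4
    rw [zero_mul, zero_add] at h5
    rw [mul_comm]; exact h5
  · have h1 : HasDerivAt (fun s => N.Ψ (s, c.2)) (deriv N.χ c.1, dX N.Y c) c.1 :=
      hχd.prodMk (hasDerivAt_dX hYd)
    have h2 := HasFDerivAt.comp_hasDerivAt c.1 (f := fun s => N.Ψ (s, c.2)) (l := H)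
      hHd.hasFDerivAt h1
    have h2' := h2.congr_deriv (fderiv_apply_eq hHd _ _)
    have h3 : HasDerivAt (fun s : ℝ => s ^ (2 * p) + c.2 ^ 2) (2 * p * c.1 ^ (2 * p - 1)) c.1 := by
      simpa using (hasDerivAt_pow (2 * p) c.1).add_const (c.2 ^ 2)
    have ht : Tendsto (fun s : ℝ => (s, c.2)) (𝓝 c.1) (𝓝 c) := by
      have : Continuous fun s : ℝ => (s, c.2) := by fun_prop
      exact this.tendsto c.1
    have h4 := h3.congr_of_eventuallyEq (ht.eventually hnear)
    have h5 := h2'.unique h4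
    rw [← h5]; show _ = deriv N.χ c.1 * dX H (N.Ψ c) + dX N.Y c * dY H (N.Ψ c)
    ring

/-- A periodic orbit on each level. -/
theorem exists_orbit (hn : n = ∞ ∨ n = ω) (hU : IsOpen U) (hH : ContDiffOn ℝ n H U)
    (hp : 1 ≤ p) {h : ℝ} (h0 : 0 < h)
    (hlt : h < min (N.r ^ 2) (N.r ^ (2 * p))) :
    ∃ γ : ℝ → ℝ × ℝ, ∃ T : ℝ, 0 < T ∧ Function.Periodic γ T ∧ InjOn γ (Ico 0 T) ∧
      (∀ t, HasDerivAt γ (dY H (γ t), -dX H (γ t)) t) ∧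
      range γ = N.Ψ '' {c | c.1 ^ (2 * p) + c.2 ^ 2 = h} := by
  have hp' : (2 * p) ≠ 0 := by omega
  obtain ⟨a, ha, hah⟩ : ∃ a : ℝ, 0 < a ∧ a ^ (2 * p) = h :=
    ⟨h ^ (((2 * p : ℕ) : ℝ)⁻¹), Real.rpow_pos_of_pos h0 _, Real.rpow_inv_natCast_pow h0.le hp'⟩
  set c := levelCurve p a with hcdef
  have hcE : ∀ θ, (c θ).1 ^ (2 * p) + (c θ).2 ^ 2 = h := fun θ => by
    rw [hcdef, levelCurve_energy hp, hah]
  have hcb : ∀ θ, c θ ∈ Metric.ball (0 : ℝ × ℝ) N.r := fun θ =>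
    mem_ball_of_energy N.r_pos (hcE θ) hlt
  have hcc : Continuous c := continuous_levelCurve p a
  have hcper : Function.Periodic c (2 * Real.pi) := levelCurve_periodic p a
  -- In the coordinates `(u, w)` the flow is the model field divided by the Jacobian `χ' Y_w`. Hence
  -- `dt = g dθ` along the level curve.
  set g : ℝ → ℝ := fun θ => levelSpeed p a θ * (deriv N.χ (c θ).1 * dY N.Y (c θ)) with hg
  have hgpos : ∀ θ, 0 < g θ := fun θ =>
    mul_pos (levelSpeed_pos hp ha θ) (mul_pos (N.deriv_χ_pos _ (fst_mem_Ioo_of_mem_ball (hcb θ)))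
      (N.dY_Y_pos _ (hcb θ)))
  have hgc : Continuous g := by
    have h1 : ContinuousOn (deriv N.χ) (Ioo (-N.r) N.r) :=
      (N.contDiffOn_χ.of_le (m := 1) (by
        exact le_trans (by exact_mod_cast le_top) (infty_le_of_infinite hn))).continuousOn_deriv_of_isOpen
        isOpen_Ioo le_rfl
    have h2 : ContinuousOn (dY N.Y) (Metric.ball 0 N.r) :=
      (contDiffOn_dY hn Metric.isOpen_ball N.contDiffOn_Y).continuousOn
    refine (continuous_levelSpeed hp ha).mul (Continuous.mul ?_ ?_)
    · exact h1.comp_continuous (continuous_fst.comp hcc) fun θ => fst_mem_Ioo_of_mem_ball (hcb θ)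
    · exact h2.comp_continuous hcc hcb
  have hgper : Function.Periodic g (2 * Real.pi) := fun θ => by
    simp only [hg, hcper θ]
    congr 1
    simp [levelSpeed]
  obtain ⟨θ, T, hT, hθ0, hθm, hθs, hθT, hθd⟩ :=
    exists_time_change hgc hgpos Real.two_pi_pos hgper
  have hΨinj : ∀ s t, N.Ψ (c s) = N.Ψ (c t) → c s = c t := fun s t hst => by
    rw [← N.right_inv _ (hcb s), ← N.right_inv _ (hcb t)]
    exact congrArg N.Φ hst
  refine ⟨fun t => N.Ψ (c (θ t)), T, hT, fun t => ?_, ?_, fun t => ?_, ?_⟩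
  · simp only [hθT, hcper (θ t)]
  · intro s hs t ht hst
    have hI : ∀ s ∈ Ico 0 T, θ s ∈ Ico 0 (2 * Real.pi) := fun s hs => by
      constructor
      · rw [← hθ0]; exact hθm.monotone hs.1
      · have := hθm hs.2
        have h2 := hθT 0
        rw [zero_add, hθ0, zero_add] at h2
        rwa [h2] at this
    exact hθm.injective (levelCurve_injOn hp ha (hI s hs) (hI t ht) (hΨinj _ _ hst))
  · have hcb' := hcb (θ t)
    obtain ⟨hp1, hp2⟩ := N.partials_H hn hU hH hcb'
    have hYd := N.differentiableAt_Y hn hcb'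
    have hχd := N.hasDerivAt_χ hn (fst_mem_Ioo_of_mem_ball hcb')
    have d1 := HasDerivAt.comp t (hasDerivAt_levelCurve_fst hp ha (θ t)) (hθd t)
    have d2 := HasDerivAt.comp t (hasDerivAt_levelCurve_snd hp ha (θ t)) (hθd t)
    have d3 := (HasDerivAt.comp t hχd d1)
    have d12 : HasDerivAt (fun t => c (θ t)) _ t := d1.prodMk d2
    have d4 := HasFDerivAt.comp_hasDerivAt t (f := fun t => c (θ t)) (l := N.Y)
      hYd.hasFDerivAt d12
    have d4' := d4.congr_deriv (fderiv_apply_eq hYd _ _)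
    have d5 : HasDerivAt (fun t => N.Ψ (c (θ t))) _ t := d3.prodMk d4'
    refine d5.congr_deriv ?_
    have hgne := (hgpos (θ t)).ne'
    have hgdef : g (θ t) = levelSpeed p a (θ t) * (deriv N.χ (c (θ t)).1 * dY N.Y (c (θ t))) := rfl
    rw [← hcdef]
    refine Prod.ext ?_ ?_
    · show deriv N.χ (c (θ t)).1 * (levelSpeed p a (θ t) * (2 * (c (θ t)).2) * (g (θ t))⁻¹) = _
      rw [← hp1]
      field_simp
      rw [hgdef]; ring
    · show levelSpeed p a (θ t) * (2 * (c (θ t)).2) * (g (θ t))⁻¹ * dX N.Y (c (θ t)) +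
        -(levelSpeed p a (θ t) * (2 * p * (c (θ t)).1 ^ (2 * p - 1))) * (g (θ t))⁻¹ *
          dY N.Y (c (θ t)) = _
      rw [← hp1, ← hp2]
      field_simp
      rw [hgdef]; ring
  · ext z
    constructor
    · rintro ⟨t, rfl⟩
      exact ⟨c (θ t), hcE _, rfl⟩
    · rintro ⟨q, hq, rfl⟩
      obtain ⟨s, hs⟩ := exists_levelCurve hp ha (c := q) (by rw [hah]; exact hq)
      obtain ⟨t, rfl⟩ := hθs s
      exact ⟨t, by simp only [hcdef, hs]⟩

/-- The image of a small level curve is a level set. -/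
theorem image_level_eq {h : ℝ} (hlt : h < min (N.r ^ 2) (N.r ^ (2 * p))) :
    N.Ψ '' {c | c.1 ^ (2 * p) + c.2 ^ 2 = h} = {z ∈ N.W | H z = h} := by
  ext z
  constructor
  · rintro ⟨c, hc, rfl⟩
    have hcb := mem_ball_of_energy N.r_pos hc hlt
    exact ⟨N.mem_W c hcb, by rw [← hc]; exact N.energy c hcb⟩
  · rintro ⟨hz, hzh⟩
    refine ⟨N.Φ z, ?_, N.left_inv z hz⟩
    rw [mem_ofPred_eq, ← N.energy _ (N.Φ_mem z hz), N.left_inv z hz, hzh]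

/-- Small level curves lie in a given neighbourhood of the origin. -/
theorem eventually_image_subset {W : Set (ℝ × ℝ)} (hW : W ∈ 𝓝 (0 : ℝ × ℝ)) :
    ∃ η > 0, ∀ h < η, N.Ψ '' {c | c.1 ^ (2 * p) + c.2 ^ 2 = h} ⊆ W := by
  obtain ⟨r, hr, hrW⟩ := Metric.mem_nhds_iff.1 (N.tendsto_Ψ hW)
  refine ⟨min (r ^ 2) (r ^ (2 * p)), by positivity, fun h hh => ?_⟩
  rintro _ ⟨c, hc, rfl⟩
  exact hrW (mem_ball_of_energy hr hc hh)

theorem exists_centerFamily (N : NormalCoords n H U p) (hn : n = ∞ ∨ n = ω)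
    (hU : IsOpen U) (hH : ContDiffOn ℝ n H U) (hp : 1 ≤ p) : ∃ β γ T, IsCenterFamily H U β γ T := by
  set β := min (N.r ^ 2) (N.r ^ (2 * p)) with hβ
  have hr := N.r_pos
  have hβ0 : 0 < β := by positivity
  have h1 : ∀ h : ℝ, ∃ γ : ℝ → ℝ × ℝ, ∃ T : ℝ, h ∈ Ioo 0 β → 0 < T ∧ Function.Periodic γ T ∧
      InjOn γ (Ico 0 T) ∧ (∀ t, HasDerivAt γ (dY H (γ t), -dX H (γ t)) t) ∧
      range γ = N.Ψ '' {c | c.1 ^ (2 * p) + c.2 ^ 2 = h} := by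
    intro h
    by_cases hh : h ∈ Ioo 0 β
    · obtain ⟨γ, T, hγ⟩ := N.exists_orbit hn hU hH hp hh.1 hh.2
      exact ⟨γ, T, fun _ => hγ⟩
    · exact ⟨fun _ => 0, 0, fun h' => absurd h' hh⟩
  choose γ T hγ using h1
  refine ⟨β, γ, T, hβ0, fun h hh => (hγ h hh).1, fun h hh => (hγ h hh).2.1,
    fun h hh => (hγ h hh).2.2.1, fun h hh => (hγ h hh).2.2.2.1,
    ⟨N.W, N.isOpen_W.mem_nhds N.zero_mem_W, N.W_subset, fun h hh => ?_⟩, fun W hW => ?_⟩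
  · rw [(hγ h hh).2.2.2.2, N.image_level_eq hh.2]
  · obtain ⟨η, hη, hs⟩ := N.eventually_image_subset hW
    filter_upwards [Ioo_mem_nhdsGT (lt_min hη hβ0)] with h hh
    have := lt_min_iff.1 hh.2
    rw [(hγ h ⟨hh.1, this.2⟩).2.2.2.2]
    exact hs h this.1

end NormalCoords

end Melnikov

namespace Melnikov

/-! ### Closed curves and their turning points -/

section Periodic

/-- Reduced to `[0, T)` both times coincide, so they differ by an integer multiple of `T`, which
must be `0`. It shows that each turning point is passed once per period. -/
theorem eq_of_periodic_of_injOn {α : Type*} {γ : ℝ → α} {T : ℝ} (hT : 0 < T)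
    (hper : Function.Periodic γ T) (hinj : InjOn γ (Ico 0 T)) {s t : ℝ} (hst : γ s = γ t)
    (habs : |s - t| < T) : s = t := by
  have h1 : ∀ s, γ (toIcoMod hT 0 s) = γ s := fun s => by
    rw [toIcoMod]; exact hper.sub_zsmul_eq _
  have h2 : ∀ s, toIcoMod hT 0 s ∈ Ico 0 T := fun s => by
    simpa using toIcoMod_mem_Ico hT 0 s
  have h3 := hinj (h2 s) (h2 t) (by rw [h1, h1, hst])
  rw [toIcoMod, toIcoMod] at h3
  set k := toIcoDiv hT 0 s
  set l := toIcoDiv hT 0 t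
  have h4 : s - t = ((k - l : ℤ) : ℝ) * T := by
    simp only [zsmul_eq_mul] at h3
    push_cast; linarith
  rw [h4, abs_mul, abs_of_pos hT] at habs
  have h5 : |((k - l : ℤ) : ℝ)| < 1 := by
    by_contra hge; push Not at hge
    nlinarith
  have h6 : k - l = 0 := by
    have : |k - l| < 1 := by exact_mod_cast h5
    exact Int.abs_lt_one_iff.1 this
  rw [h6] at h4
  simp at h4; linarith

/-- Without zeros `w` keeps its sign; were it negative, `u` would decrease, against its values at
the end points. -/
theorem pos_of_rising {u w k : ℝ → ℝ} {t₀ t₁ : ℝ} (ht : t₀ < t₁)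
    (hu : ∀ t, HasDerivAt u (k t * w t) t) (hk : ∀ t, 0 < k t) (hw : Continuous w)
    (hne : ∀ t ∈ Ioo t₀ t₁, w t ≠ 0) (hlt : u t₀ < u t₁) : ∀ t ∈ Ioo t₀ t₁, 0 < w t := by
  by_contra hcon
  push Not at hcon
  obtain ⟨s, hs, hws⟩ := hcon
  have hws' : w s < 0 := lt_of_le_of_ne hws (hne s hs)
  have hneg : ∀ t ∈ Ioo t₀ t₁, w t < 0 := by
    intro t ht'
    by_contra hge
    push Not at hge
    obtain ⟨x, hx, hx0⟩ := isPreconnected_Ioo.intermediate_value hs ht' hw.continuousOn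
      ⟨hws'.le, hge⟩
    exact hne x hx hx0
  have hanti : StrictAntiOn u (Icc t₀ t₁) := by
    refine strictAntiOn_of_deriv_neg (convex_Icc _ _)
      (fun t _ => (hu t).continuousAt.continuousWithinAt) fun t ht' => ?_
    rw [interior_Icc] at ht'
    rw [(hu t).deriv]
    exact mul_neg_of_pos_of_neg (hk t) (hneg t ht')
  exact absurd (hanti (left_mem_Icc.2 ht.le) (right_mem_Icc.2 ht.le) ht) (not_lt.2 hlt.le)

end Periodic

/-! ### Reduction of the perturbation to a form `R dx` -/

section Primitive

theorem dY_dX_comm {S : ℝ × ℝ → ℝ} {O : Set (ℝ × ℝ)} (hO : IsOpen O) (hS : ContDiffOn ℝ ∞ S O)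
    {z : ℝ × ℝ} (hz : z ∈ O) : dY (dX S) z = dX (dY S) z := by
  have hSz := hS.contDiffAt (hO.mem_nhds hz)
  have hsd : ∀ z ∈ O, DifferentiableAt ℝ S z := fun z hz =>
    (hS.contDiffAt (hO.mem_nhds hz)).differentiableAt (by simp)
  have hd : DifferentiableAt ℝ (fderiv ℝ S) z :=
    (hSz.fderiv_right (m := 1) (by norm_cast)).differentiableAt one_ne_zero
  have key : ∀ v : ℝ × ℝ, HasFDerivAt (fun z => fderiv ℝ S z v)
      ((fderiv ℝ (fderiv ℝ S) z).flip v) z := fun v => by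
    have := hd.hasFDerivAt.clm_apply (hasFDerivAt_const v z)
    simpa using this
  have e1 : dX S =ᶠ[𝓝 z] fun z => fderiv ℝ S z (1, 0) := by
    filter_upwards [hO.mem_nhds hz] with y hy using dX_eq_fderiv (hsd y hy)
  have e2 : dY S =ᶠ[𝓝 z] fun z => fderiv ℝ S z (0, 1) := by
    filter_upwards [hO.mem_nhds hz] with y hy using dY_eq_fderiv (hsd y hy)
  have k1 := (key (1, 0)).congr_of_eventuallyEq e1
  have k2 := (key (0, 1)).congr_of_eventuallyEq e2
  rw [dY_eq_fderiv k1.differentiableAt, dX_eq_fderiv k2.differentiableAt, k1.fderiv, k2.fderiv]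
  simp only [ContinuousLinearMap.flip_apply]
  have hsymm : IsSymmSndFDerivAt ℝ S z := hSz.isSymmSndFDerivAt (by
    simp only [minSmoothness_of_isRCLikeNormedField]
    exact WithTop.coe_le_coe.2 (le_top : (2 : ℕ∞) ≤ ⊤))
  exact hsymm _ _

/-- A primitive of `P` in the second variable, and the resulting reduction of a `1`-form to
`R dx`. -/
theorem exists_primitive {P Q : ℝ × ℝ → ℝ} {ρ : ℝ} (hP : ContDiffOn ℝ ∞ P (Metric.ball 0 ρ))
    (hQ : ContDiffOn ℝ ∞ Q (Metric.ball 0 ρ)) :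
    ∃ S R : ℝ × ℝ → ℝ, (∀ z ∈ Metric.ball (0 : ℝ × ℝ) ρ, DifferentiableAt ℝ S z ∧ dY S z = P z ∧
      R z = Q z + dX S z ∧ DifferentiableAt ℝ R z ∧ dY R z = dX P z + dY Q z) := by
  set B := Metric.ball (0 : ℝ × ℝ) ρ with hB
  have hBo : IsOpen B := Metric.isOpen_ball
  -- This is `∫₀^y P(x, s) ds`, scaled to the fixed interval `[0, 1]` so that joint smoothness
  -- follows from the results on parametric integrals.
  set S : ℝ × ℝ → ℝ := fun z => z.2 * ∫ t in (0 : ℝ)..1, P (scaleSnd t z) with hS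
  have hSc : ContDiffOn ℝ ∞ S B := contDiffOn_snd.mul (contDiffOn_integral_scaleSnd hP)
  have hSd : ∀ z ∈ B, DifferentiableAt ℝ S z := fun z hz =>
    (hSc.contDiffAt (hBo.mem_nhds hz)).differentiableAt (by simp)
  have hSY : ∀ z ∈ B, dY S z = P z := by
    intro z hz
    have hmem : ∀ s ∈ Ioo (-ρ) ρ, (z.1, s) ∈ B := fun s hs => by
      rw [hB, mem_ball_zero_iff, Prod.norm_def, max_lt_iff] at hz ⊢
      exact ⟨hz.1, abs_lt.2 hs⟩
    have hz2 : z.2 ∈ Ioo (-ρ) ρ := by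
      rw [hB, mem_ball_zero_iff, Prod.norm_def, max_lt_iff] at hz
      exact abs_lt.1 hz.2
    have hρ : 0 < ρ := by linarith [hz2.1, hz2.2]
    have hPc : ContinuousOn (fun s => P (z.1, s)) (Ioo (-ρ) ρ) :=
      hP.continuousOn.comp (by fun_prop) hmem
    have hSeq : (fun s => S (z.1, s)) = fun s => ∫ x in (0 : ℝ)..s, P (z.1, x) := by
      funext s
      simp only [hS, scaleSnd_apply]
      have := intervalIntegral.mul_integral_comp_mul_right (a := (0 : ℝ)) (b := 1)
        (f := fun x => P (z.1, x)) s
      simpa using this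
    rw [dY, hSeq]
    have h0 : (0 : ℝ) ∈ Ioo (-ρ) ρ := ⟨by linarith, hρ⟩
    have hint : IntervalIntegrable (fun x => P (z.1, x)) MeasureTheory.volume 0 z.2 :=
      (hPc.mono ((ordConnected_Ioo.uIcc_subset h0 hz2))).intervalIntegrable
    exact (intervalIntegral.integral_hasDerivAt_right hint
      (hPc.stronglyMeasurableAtFilter isOpen_Ioo _ hz2)
      (hPc.continuousAt (isOpen_Ioo.mem_nhds hz2))).deriv
  have hn : (∞ : WithTop ℕ∞) = ∞ ∨ (∞ : WithTop ℕ∞) = ω := Or.inl rfl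
  have hSX : ContDiffOn ℝ ∞ (dX S) B := contDiffOn_dX hn hBo hSc
  refine ⟨S, fun z => Q z + dX S z, fun z hz => ⟨hSd z hz, hSY z hz, rfl, ?_, ?_⟩⟩
  · exact ((hQ.add hSX).contDiffAt (hBo.mem_nhds hz)).differentiableAt (by simp)
  · have hQd : DifferentiableAt ℝ Q z :=
      (hQ.contDiffAt (hBo.mem_nhds hz)).differentiableAt (by simp)
    have hXd : DifferentiableAt ℝ (dX S) z :=
      (hSX.contDiffAt (hBo.mem_nhds hz)).differentiableAt (by simp)
    have h1 : dY (fun z => Q z + dX S z) z = dY Q z + dY (dX S) z :=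
      ((hasDerivAt_dY hQd).fun_add (hasDerivAt_dY hXd)).deriv
    have h2 : dX (dY S) z = dX P z := by
      rw [dX, dX]
      refine Filter.EventuallyEq.deriv_eq ?_
      have ht : Tendsto (fun s : ℝ => (s, z.2)) (𝓝 z.1) (𝓝 z) := by
        have : Continuous fun s : ℝ => (s, z.2) := by fun_prop
        exact this.tendsto z.1
      filter_upwards [ht.eventually (hBo.mem_nhds hz)] with s hs using hSY _ hs
    rw [h1, dY_dX_comm hBo hSc hz, h2, add_comm]

end Primitive

/-! ### Integration along an orbit -/

namespace NormalCoords

variable {n : WithTop ℕ∞} {H : ℝ × ℝ → ℝ} {U : Set (ℝ × ℝ)} {p : ℕ} (N : NormalCoords n H U p)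

theorem continuousOn_deriv_χ (hn : n = ∞ ∨ n = ω) : ContinuousOn (deriv N.χ) (Ioo (-N.r) N.r) :=
  (N.contDiffOn_χ.of_le (m := 1)
    (le_trans (by exact_mod_cast le_top) (infty_le_of_infinite hn))).continuousOn_deriv_of_isOpen
    isOpen_Ioo le_rfl

/-- Integration of `f dx` over a closed orbit, by splitting it into its upper and lower halves. -/
theorem integral_orbit (hn : n = ∞ ∨ n = ω) (hU : IsOpen U) (hH : ContDiffOn ℝ n H U)
    (hp : 1 ≤ p) {a h : ℝ} (ha : 0 < a) (hah : a ^ (2 * p) = h)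
    (hlt : h < min (N.r ^ 2) (N.r ^ (2 * p))) {γ : ℝ → ℝ × ℝ} {T : ℝ} (hT : 0 < T)
    (hper : Function.Periodic γ T) (hinj : InjOn γ (Ico 0 T))
    (hsol : ∀ t, HasDerivAt γ (dY H (γ t), -dX H (γ t)) t)
    (hrange : range γ = N.Ψ '' {c | c.1 ^ (2 * p) + c.2 ^ 2 = h}) {f : ℝ × ℝ → ℝ}
    (hf : ContinuousOn f (range γ)) :
    ∫ t in (0 : ℝ)..T, f (γ t) * dY H (γ t) =
      ∫ u in (-a)..a, (f (N.Ψ (u, √(h - u ^ (2 * p)))) - f (N.Ψ (u, -√(h - u ^ (2 * p))))) *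
        deriv N.χ u := by
  have hγE : ∀ t, γ t ∈ N.W ∧ H (γ t) = h := fun t => by
    have h1 : γ t ∈ range γ := ⟨t, rfl⟩
    rw [hrange, N.image_level_eq hlt] at h1
    exact h1
  have hγc : Continuous γ := continuous_iff_continuousAt.2 fun t => (hsol t).continuousAt
  set c : ℝ → ℝ × ℝ := fun t => N.Φ (γ t) with hc
  have hcb : ∀ t, c t ∈ Metric.ball (0 : ℝ × ℝ) N.r := fun t => N.Φ_mem _ (hγE t).1
  have hcu : ∀ t, (c t).1 ∈ Ioo (-N.r) N.r := fun t => fst_mem_Ioo_of_mem_ball (hcb t)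
  have hΨc : ∀ t, N.Ψ (c t) = γ t := fun t => N.left_inv _ (hγE t).1
  have hcE : ∀ t, (c t).1 ^ (2 * p) + (c t).2 ^ 2 = h := fun t => by
    rw [← N.energy _ (hcb t)]
    exact (congrArg H (hΨc t)).trans (hγE t).2
  have hcc : Continuous c := N.differentiableOn_Φ.continuousOn.comp_continuous hγc
    fun t => (hγE t).1
  have hχpos : ∀ t, 0 < deriv N.χ (c t).1 := fun t => N.deriv_χ_pos _ (hcu t)
  have hYpos : ∀ t, 0 < dY N.Y (c t) := fun t => N.dY_Y_pos _ (hcb t)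
  have hHy : ∀ t, dY H (γ t) * dY N.Y (c t) = 2 * (c t).2 := fun t => by
    rw [← hΨc t]; exact (N.partials_H hn hU hH (hcb t)).1
  have hud : ∀ t, HasDerivAt (fun t => (c t).1) (dY H (γ t) / deriv N.χ (c t).1) t := by
    intro t
    have h1 : DifferentiableAt ℝ c t :=
      ((N.differentiableOn_Φ.differentiableAt (N.isOpen_W.mem_nhds (hγE t).1)).comp t
        (hsol t).differentiableAt)
    have h2 : HasDerivAt (fun t => (c t).1) (deriv (fun t => (c t).1) t) t :=
      h1.fst.hasDerivAt
    have h3 : HasDerivAt (fun t => (γ t).1) (deriv N.χ (c t).1 * deriv (fun t => (c t).1) t) t := by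
      refine (HasDerivAt.comp t (N.hasDerivAt_χ hn (hcu t)) h2).congr_of_eventuallyEq
        (Eventually.of_forall fun s => ?_)
      exact (congrArg Prod.fst (hΨc s)).symm
    have h4 : HasDerivAt (fun t => (γ t).1) (dY H (γ t)) t := by
      have := (ContinuousLinearMap.fst ℝ ℝ ℝ).hasFDerivAt.comp_hasDerivAt t (hsol t)
      exact this
    have h5 := h3.unique h4
    refine h2.congr_deriv ?_
    rw [← h5]
    field_simp [(hχpos t).ne']
  have hud' : ∀ t, HasDerivAt (fun t => (c t).1)
      (2 / (dY N.Y (c t) * deriv N.χ (c t).1) * (c t).2) t := fun t => by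
    refine (hud t).congr_deriv ?_
    have h1 := hχpos t
    have h2 := hYpos t
    field_simp
    linarith [hHy t]
  have hkpos : ∀ t, 0 < 2 / (dY N.Y (c t) * deriv N.χ (c t).1) := fun t =>
    div_pos two_pos (mul_pos (hYpos t) (hχpos t))
  have hwc : Continuous fun t => (c t).2 := continuous_snd.comp hcc
  have hp2 : 2 * p ≠ 0 := by omega
  have hae : Even (2 * p) := even_two_mul p
  -- the turning points
  have hzero : ∀ t, (c t).2 = 0 → (c t).1 = a ∨ (c t).1 = -a := fun t ht => by
    have h1 := hcE t
    rw [ht, ← hah] at h1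
    have h2 : |(c t).1| ^ (2 * p) = a ^ (2 * p) := by
      rw [hae.pow_abs]; linarith
    have h3 : |(c t).1| = a := (pow_left_inj₀ (abs_nonneg _) ha.le hp2).1 h2
    exact eq_or_eq_neg_of_abs_eq h3
  have hpt : ∀ v : ℝ, v ^ (2 * p) = h → ∃ t, γ t = N.Ψ (v, 0) := fun v hv => by
    have : N.Ψ (v, 0) ∈ range γ := by
      rw [hrange]; exact ⟨(v, 0), by simp [hv], rfl⟩
    exact this
  have hcpt : ∀ v : ℝ, v ^ (2 * p) = h → ∀ t, γ t = N.Ψ (v, 0) → c t = (v, 0) :=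
    fun v hv t ht => by
      simp only [hc, ht]
      exact N.right_inv (v, 0) (mem_ball_of_energy N.r_pos (h := h) (by simp [hv]) hlt)
  have hma : (-a) ^ (2 * p) = h := by rw [hae.neg_pow, hah]
  -- The orbit is cut at the left turning point `(-a, 0)` and at the passage through `(a, 0)` within
  -- the following period.
  obtain ⟨t₀, ht₀⟩ := hpt (-a) hma
  obtain ⟨s₁, hs₁⟩ := hpt a hah
  obtain ⟨t₁, ht₁, hst₁⟩ := hper.exists_mem_Ico hT s₁ t₀
  have ht₁' : γ t₁ = N.Ψ (a, 0) := by rw [← hst₁, hs₁]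
  have hc₀ := hcpt _ hma t₀ ht₀
  have hc₁ := hcpt _ hah t₁ ht₁'
  have hlt₁ : t₀ < t₁ := by
    refine lt_of_le_of_ne ht₁.1 fun h => ?_
    rw [h, hc₁, Prod.mk.injEq] at hc₀
    linarith [hc₀.1]
  have hc₂ : c (t₀ + T) = (-a, 0) := by
    simp only [hc, hper t₀]; exact hc₀
  -- `w` vanishes at turning points only, and between `t₀` and `t₀ + T` the right one, at `t₁`, is
  -- the only one met.
  have hne : ∀ t, t₀ < t → t < t₀ + T → t ≠ t₁ → (c t).2 ≠ 0 := by
    intro t h1 h2 h3 h4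
    rcases hzero t h4 with h5 | h5
    · refine h3 (eq_of_periodic_of_injOn hT hper hinj ?_ ?_)
      · rw [ht₁', ← hΨc t]; exact congrArg N.Ψ (Prod.ext h5 h4)
      · rw [abs_lt]; constructor <;> linarith [ht₁.1, ht₁.2]
    · refine h1.ne' (eq_of_periodic_of_injOn hT hper hinj ?_ ?_)
      · rw [ht₀, ← hΨc t]; exact congrArg N.Ψ (Prod.ext h5 h4)
      · rw [abs_lt]; constructor <;> linarith
  have hup : ∀ t ∈ Ioo t₀ t₁, 0 < (c t).2 :=
    pos_of_rising (u := fun t => (c t).1) (w := fun t => (c t).2) hlt₁ hud' hkpos hwc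
      (fun t ht => hne t ht.1 (ht.2.trans ht₁.2) ht.2.ne) (by rw [hc₀, hc₁]; simp; linarith)
  have hdown : ∀ t ∈ Ioo t₁ (t₀ + T), 0 < -(c t).2 :=
    pos_of_rising (u := fun t => -(c t).1) (w := fun t => -(c t).2) ht₁.2
      (fun t => (hud' t).fun_neg.congr_deriv (by ring)) hkpos hwc.neg
      (fun t ht => neg_ne_zero.2 (hne t (hlt₁.trans ht.1) ht.2 ht.1.ne'))
      (by rw [hc₁, hc₂]; simp; linarith)
  have hupe : ∀ t ∈ Icc t₀ t₁, (c t).2 = √(h - (c t).1 ^ (2 * p)) := by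
    intro t ht
    have h1 : h - (c t).1 ^ (2 * p) = (c t).2 ^ 2 := by linarith [hcE t]
    rw [h1, Real.sqrt_sq]
    rcases eq_or_lt_of_le ht.1 with h | h
    · rw [← h, hc₀]
    rcases eq_or_lt_of_le ht.2 with h' | h'
    · rw [h', hc₁]
    exact (hup t ⟨h, h'⟩).le
  have hdowne : ∀ t ∈ Icc t₁ (t₀ + T), (c t).2 = -√(h - (c t).1 ^ (2 * p)) := by
    intro t ht
    have h1 : h - (c t).1 ^ (2 * p) = (-(c t).2) ^ 2 := by linarith [hcE t, neg_sq (c t).2]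
    rw [h1, Real.sqrt_sq, neg_neg]
    rcases eq_or_lt_of_le ht.1 with h | h
    · rw [← h, hc₁]; simp
    rcases eq_or_lt_of_le ht.2 with h' | h'
    · rw [h', hc₂]; simp
    exact (hdown t ⟨h, h'⟩).le
  -- the integrals over the two halves
  have hd1 : Continuous fun t => dY H (γ t) / deriv N.χ (c t).1 := by
    have h1 : ContinuousOn (dY H) U := (contDiffOn_dY hn hU hH).continuousOn
    refine Continuous.div ?_ ?_ fun t => (hχpos t).ne'
    · exact h1.comp_continuous hγc fun t => N.W_subset (hγE t).1
    · exact (N.continuousOn_deriv_χ hn).comp_continuous (continuous_fst.comp hcc) hcu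
  have hcI : ∀ t, (c t).1 ∈ Icc (-a) a := fun t => by
    rw [mem_Icc, ← abs_le]
    have h1 : |(c t).1| ^ (2 * p) ≤ a ^ (2 * p) := by
      rw [hae.pow_abs, hah]
      linarith [hcE t, sq_nonneg (c t).2]
    exact (pow_le_pow_iff_left₀ (abs_nonneg _) ha.le hp2).1 h1
  -- The sign `σ = ±1` treats the upper and the lower half of the orbit together.
  have hbr : ∀ σ : ℝ, σ ^ 2 = 1 → ∀ u ∈ Icc (-a) a,
      u ^ (2 * p) + (σ * √(h - u ^ (2 * p))) ^ 2 = h := fun σ hσ u hu => by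
    have h1 : u ^ (2 * p) ≤ h := by
      rw [← hah, ← hae.pow_abs]
      exact pow_le_pow_left₀ (abs_nonneg _) (abs_le.2 hu) _
    rw [mul_pow, hσ, one_mul, Real.sq_sqrt (by linarith)]; ring
  have hGc : ∀ σ : ℝ, σ ^ 2 = 1 → ContinuousOn
      (fun u => f (N.Ψ (u, σ * √(h - u ^ (2 * p)))) * deriv N.χ u) (Icc (-a) a) := by
    intro σ hσ
    have hball : ∀ u ∈ Icc (-a) a, (u, σ * √(h - u ^ (2 * p))) ∈ Metric.ball (0 : ℝ × ℝ) N.r :=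
      fun u hu => mem_ball_of_energy N.r_pos (hbr σ hσ u hu) hlt
    refine ContinuousOn.mul ?_ ?_
    · refine hf.comp (N.continuousOn_Ψ.comp ?_ hball) fun u hu => ?_
      · exact Continuous.continuousOn (by fun_prop)
      · rw [hrange]; exact ⟨_, hbr σ hσ u hu, rfl⟩
    · exact (N.continuousOn_deriv_χ hn).mono fun u hu => fst_mem_Ioo_of_mem_ball (hball u hu)
  have hhalf : ∀ σ : ℝ, σ ^ 2 = 1 → ∀ s t, s ≤ t →
      (∀ x ∈ Icc s t, (c x).2 = σ * √(h - (c x).1 ^ (2 * p))) →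
      ∫ x in s..t, f (γ x) * dY H (γ x) =
        ∫ u in (c s).1..(c t).1, f (N.Ψ (u, σ * √(h - u ^ (2 * p)))) * deriv N.χ u := by
    intro σ hσ s t hst hx
    -- Substitution `u = u(t)` with `χ'(u) du = H_y dt`, the first equation of the flow.
    rw [← intervalIntegral.integral_comp_mul_deriv' (f := fun t => (c t).1)
      (f' := fun t => dY H (γ t) / deriv N.χ (c t).1)
      (g := fun u => f (N.Ψ (u, σ * √(h - u ^ (2 * p)))) * deriv N.χ u)
      (fun x _ => hud x) hd1.continuousOn
      ((hGc σ hσ).mono (by rintro _ ⟨x, -, rfl⟩; exact hcI x))]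
    refine intervalIntegral.integral_congr fun x hx' => ?_
    rw [uIcc_of_le hst] at hx'
    simp only [Function.comp]
    have h1 : N.Ψ ((c x).1, σ * √(h - (c x).1 ^ (2 * p))) = γ x := by
      rw [← hx x hx', ← hΨc x]
    rw [h1]
    have := (hχpos x).ne'
    field_simp
  have hpi : Function.Periodic (fun t => f (γ t) * dY H (γ t)) T := fun t => by
    simp only [hper t]
  have hIc : Continuous fun t => f (γ t) * dY H (γ t) := by
    have h1 : ContinuousOn (dY H) U := (contDiffOn_dY hn hU hH).continuousOn
    exact (hf.comp_continuous hγc fun t => ⟨t, rfl⟩).mul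
      (h1.comp_continuous hγc fun t => N.W_subset (hγE t).1)
  have hsplit := hpi.intervalIntegral_add_eq 0 t₀
  rw [zero_add] at hsplit
  rw [hsplit, ← intervalIntegral.integral_add_adjacent_intervals (hIc.intervalIntegrable t₀ t₁)
    (hIc.intervalIntegrable t₁ (t₀ + T)),
    hhalf 1 (by norm_num) t₀ t₁ hlt₁.le (fun x hx => by rw [one_mul]; exact hupe x hx),
    hhalf (-1) (by norm_num) t₁ (t₀ + T) ht₁.2.le (fun x hx => by
      rw [neg_one_mul]; exact hdowne x hx), hc₀, hc₁, hc₂]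
  simp only [one_mul, neg_one_mul]
  -- The lower half is run through from `a` to `-a`, whence the minus sign.
  rw [intervalIntegral.integral_symm (-a) a, ← sub_eq_add_neg, ← intervalIntegral.integral_sub]
  · refine intervalIntegral.integral_congr fun u _ => ?_
    ring
  · have := hGc 1 (by norm_num)
    simp only [one_mul] at this
    refine ContinuousOn.intervalIntegrable ?_
    rwa [uIcc_of_le (by linarith)]
  · have := hGc (-1) (by norm_num)
    simp only [neg_one_mul] at this
    refine ContinuousOn.intervalIntegrable ?_
    rwa [uIcc_of_le (by linarith)]

end NormalCoords

end Melnikov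

/-! ### The Melnikov function as an integral over the enclosed region -/

namespace Melnikov

variable {E : Type*}

/-- The integral of `f` over the region `u ^ (2 p) + w ^ 2 < h`. -/
noncomputable def levelIntegral (p : ℕ) (h : ℝ) (f : ℝ × ℝ → ℝ) : ℝ :=
  ∫ u in (-(h ^ (1 / (2 * (p : ℝ)))))..(h ^ (1 / (2 * (p : ℝ)))),
    ∫ s in (-√(h - u ^ (2 * p)))..√(h - u ^ (2 * p)), f (u, s)

theorem rpow_inv_two_mul_pow {p : ℕ} (hp : 1 ≤ p) {h : ℝ} (h0 : 0 < h) :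
    (h ^ (1 / (2 * (p : ℝ)))) ^ (2 * p) = h := by
  have hp' : (0 : ℝ) < p := by exact_mod_cast hp
  rw [← Real.rpow_natCast, ← Real.rpow_mul h0.le]
  have : 1 / (2 * (p : ℝ)) * ((2 * p : ℕ) : ℝ) = 1 := by push_cast; field_simp
  rw [this, Real.rpow_one]

theorem pow_le_of_mem_Icc {p : ℕ} {a u : ℝ} (hu : u ∈ Icc (-a) a) : u ^ (2 * p) ≤ a ^ (2 * p) := by
  rw [← (even_two_mul p).pow_abs]
  exact pow_le_pow_left₀ (abs_nonneg _) (abs_le.2 hu) _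

theorem energy_le_of_mem {p : ℕ} {a h u s : ℝ} (hah : a ^ (2 * p) = h) (hu : u ∈ Icc (-a) a)
    (hs : s ∈ Icc (-√(h - u ^ (2 * p))) √(h - u ^ (2 * p))) : u ^ (2 * p) + s ^ 2 ≤ h := by
  have h1 : u ^ (2 * p) ≤ h := hah ▸ pow_le_of_mem_Icc hu
  have h2 := Real.sq_sqrt (sub_nonneg.2 h1)
  nlinarith [sq_le_sq' hs.1 hs.2]

/-- The divergence of the perturbation. -/
noncomputable def divergence (P Q : ℝ × ℝ → E → ℝ) (δ : E) (z : ℝ × ℝ) : ℝ :=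
  dX (fun z => P z δ) z + dY (fun z => Q z δ) z

/-- The divergence of the perturbation as a density in the coordinates `(u, w)`. -/
noncomputable def NormalCoords.density {n : WithTop ℕ∞} {H : ℝ × ℝ → ℝ} {U : Set (ℝ × ℝ)} {p : ℕ}
    (N : NormalCoords n H U p) (P Q : ℝ × ℝ → E → ℝ) (δ : E) (c : ℝ × ℝ) : ℝ :=
  divergence P Q δ (N.Ψ c) * dY N.Y c * deriv N.χ c.1

theorem contDiffOn_slice [NormedAddCommGroup E] [NormedSpace ℝ E] {n : WithTop ℕ∞}
    {P : ℝ × ℝ → E → ℝ} {U : Set (ℝ × ℝ)} {V : Set E}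
    (hP : ContDiffOn ℝ n (Function.uncurry P) (U ×ˢ V)) {δ : E} (hδ : δ ∈ V) :
    ContDiffOn ℝ n (fun z => P z δ) U :=
  hP.comp (f := fun z : ℝ × ℝ => (z, δ)) (contDiff_id.prodMk contDiff_const).contDiffOn
    fun _ hz => ⟨hz, hδ⟩

namespace NormalCoords

variable {n : WithTop ℕ∞} {H : ℝ × ℝ → ℝ} {U : Set (ℝ × ℝ)} {p : ℕ} (N : NormalCoords n H U p)

theorem contDiffOn_divergence_slice [NormedAddCommGroup E] [NormedSpace ℝ E]
    {P Q : ℝ × ℝ → E → ℝ} {V : Set E} (hn : n = ∞ ∨ n = ω) (hU : IsOpen U)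
    (hP : ContDiffOn ℝ n (Function.uncurry P) (U ×ˢ V))
    (hQ : ContDiffOn ℝ n (Function.uncurry Q) (U ×ˢ V)) {δ : E} (hδ : δ ∈ V) :
    ContDiffOn ℝ n (divergence P Q δ) U :=
  (contDiffOn_dX hn hU (contDiffOn_slice hP hδ)).add
    (contDiffOn_dY hn hU (contDiffOn_slice hQ hδ))

theorem hasDerivAt_Ψ_snd (hn : n = ∞ ∨ n = ω) {c : ℝ × ℝ}
    (hc : c ∈ Metric.ball (0 : ℝ × ℝ) N.r) :
    HasDerivAt (fun s => N.Ψ (c.1, s)) ((0 : ℝ), dY N.Y c) c.2 :=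
  (hasDerivAt_const c.2 (N.χ c.1)).prodMk (hasDerivAt_dY (N.differentiableAt_Y hn hc))

/-- The Melnikov function as an integral over the region bounded by the orbit, for one orbit. -/
theorem melnikov_eq_levelIntegral [NormedAddCommGroup E] [NormedSpace ℝ E] (hn : n = ∞ ∨ n = ω)
    (hU : IsOpen U) (hH : ContDiffOn ℝ n H U) (hp : 1 ≤ p) {V : Set E} {P Q : ℝ × ℝ → E → ℝ}
    (hP : ContDiffOn ℝ n (Function.uncurry P) (U ×ˢ V))
    (hQ : ContDiffOn ℝ n (Function.uncurry Q) (U ×ˢ V)) {ρ : ℝ}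
    (hρ : Metric.ball (0 : ℝ × ℝ) ρ ⊆ U) {h : ℝ} (h0 : 0 < h)
    (hlt : h < min (N.r ^ 2) (N.r ^ (2 * p)))
    (hsmall : ∀ c : ℝ × ℝ, c.1 ^ (2 * p) + c.2 ^ 2 ≤ h → N.Ψ c ∈ Metric.ball (0 : ℝ × ℝ) ρ)
    {γ : ℝ → ℝ → ℝ × ℝ} {T : ℝ → ℝ} (hT : 0 < T h)
    (hper : Function.Periodic (γ h) (T h)) (hinj : InjOn (γ h) (Ico 0 (T h)))
    (hsol : ∀ t, HasDerivAt (γ h) (dY H (γ h t), -dX H (γ h t)) t)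
    (hrange : range (γ h) = N.Ψ '' {c | c.1 ^ (2 * p) + c.2 ^ 2 = h}) {δ : E} (hδ : δ ∈ V) :
    melnikov H P Q γ T h δ = levelIntegral p h (N.density P Q δ) := by
  have hle := infty_le_of_infinite hn
  obtain ⟨S, R, hSR⟩ := exists_primitive
    (((contDiffOn_slice hP hδ).of_le hle).mono hρ) (((contDiffOn_slice hQ hδ).of_le hle).mono hρ)
  have hγρ : ∀ t, γ h t ∈ Metric.ball (0 : ℝ × ℝ) ρ := fun t => by
    have h1 : γ h t ∈ range (γ h) := ⟨t, rfl⟩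
    rw [hrange] at h1
    obtain ⟨c, hc, hc'⟩ := h1
    rw [← hc']; exact hsmall c (le_of_eq hc)
  have hγU : ∀ t, γ h t ∈ U := fun t => hρ (hγρ t)
  have hγc : Continuous (γ h) := continuous_iff_continuousAt.2 fun t => (hsol t).continuousAt
  have hRc : ContinuousOn R (Metric.ball 0 ρ) := fun z hz =>
    (hSR z hz).2.2.2.1.continuousAt.continuousWithinAt
  have hRγ : ContinuousOn R (range (γ h)) := hRc.mono (by rintro _ ⟨t, rfl⟩; exact hγρ t)
  have hc1 : Continuous fun t => dY H (γ h t) :=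
    (contDiffOn_dY hn hU hH).continuousOn.comp_continuous hγc hγU
  have hc2 : Continuous fun t => dX H (γ h t) :=
    (contDiffOn_dX hn hU hH).continuousOn.comp_continuous hγc hγU
  have hcP : Continuous fun t => P (γ h t) δ :=
    (contDiffOn_slice hP hδ).continuousOn.comp_continuous hγc hγU
  have hcQ : Continuous fun t => Q (γ h t) δ :=
    (contDiffOn_slice hQ hδ).continuousOn.comp_continuous hγc hγU
  have hcR : Continuous fun t => R (γ h t) := hRc.comp_continuous hγc hγρ
  -- Along the flow `dS = S_x H_y dt - P H_x dt`, so the form `R dx` and the Melnikov form differ by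
  -- `dS`, which integrates to zero over a period.
  have hSd : ∀ t, HasDerivAt (fun t => S (γ h t))
      (R (γ h t) * dY H (γ h t) -
        (dY H (γ h t) * Q (γ h t) δ + dX H (γ h t) * P (γ h t) δ)) t := by
    intro t
    obtain ⟨hS, hSY, hRe, -, -⟩ := hSR _ (hγρ t)
    have h1 := HasFDerivAt.comp_hasDerivAt t (f := γ h) (l := S) hS.hasFDerivAt (hsol t)
    refine (h1.congr_deriv (fderiv_apply_eq hS _ _)).congr_deriv ?_
    rw [hSY, hRe]; ring
  have hzero : ∫ t in (0 : ℝ)..T h, (R (γ h t) * dY H (γ h t) -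
      (dY H (γ h t) * Q (γ h t) δ + dX H (γ h t) * P (γ h t) δ)) = 0 := by
    rw [intervalIntegral.integral_eq_sub_of_hasDerivAt (fun t _ => hSd t)
      (((hcR.mul hc1).sub ((hc1.mul hcQ).add (hc2.mul hcP))).intervalIntegrable _ _)]
    have := hper 0
    rw [zero_add] at this
    rw [this, sub_self]
  have hi1 : Continuous fun t => R (γ h t) * dY H (γ h t) := hcR.mul hc1
  have hi2 : Continuous fun t => dY H (γ h t) * Q (γ h t) δ + dX H (γ h t) * P (γ h t) δ :=
    (hc1.mul hcQ).add (hc2.mul hcP)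
  rw [intervalIntegral.integral_sub (hi1.intervalIntegrable _ _) (hi2.intervalIntegrable _ _),
    sub_eq_zero] at hzero
  rw [melnikov, ← hzero]
  have ha : 0 < h ^ (1 / (2 * (p : ℝ))) := Real.rpow_pos_of_pos h0 _
  have hah := rpow_inv_two_mul_pow hp h0
  rw [N.integral_orbit hn hU hH hp ha hah hlt hT hper hinj hsol hrange hRγ, levelIntegral]
  refine intervalIntegral.integral_congr fun u hu => ?_
  rw [uIcc_of_le (by linarith)] at hu
  have hmem : ∀ s ∈ Icc (-√(h - u ^ (2 * p))) √(h - u ^ (2 * p)),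
      u ^ (2 * p) + s ^ 2 ≤ h := fun s hs => energy_le_of_mem hah hu hs
  have hb : ∀ s ∈ Icc (-√(h - u ^ (2 * p))) √(h - u ^ (2 * p)),
      (u, s) ∈ Metric.ball (0 : ℝ × ℝ) N.r := fun s hs =>
    mem_ball_of_energy N.r_pos rfl ((hmem s hs).trans_lt hlt)
  have hsq : -√(h - u ^ (2 * p)) ≤ √(h - u ^ (2 * p)) := by
    linarith [Real.sqrt_nonneg (h - u ^ (2 * p))]
  -- The difference of `R` between the two halves is the integral of `R_y Y_w` across the region,
  -- and `R_y` is the divergence.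
  have hder : ∀ s ∈ uIcc (-√(h - u ^ (2 * p))) √(h - u ^ (2 * p)),
      HasDerivAt (fun s => R (N.Ψ (u, s)))
        (divergence P Q δ (N.Ψ (u, s)) * dY N.Y (u, s)) s := by
    intro s hs
    rw [uIcc_of_le hsq] at hs
    obtain ⟨-, -, -, hRd, hRY⟩ := hSR _ (hsmall (u, s) (hmem s hs))
    have h1 := HasFDerivAt.comp_hasDerivAt s (f := fun s => N.Ψ (u, s)) (l := R) hRd.hasFDerivAt
      (N.hasDerivAt_Ψ_snd hn (hb s hs))
    refine (h1.congr_deriv (fderiv_apply_eq hRd _ _)).congr_deriv ?_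
    rw [hRY, divergence]; ring
  have hcont : ContinuousOn (fun s => divergence P Q δ (N.Ψ (u, s)) * dY N.Y (u, s))
      (uIcc (-√(h - u ^ (2 * p))) √(h - u ^ (2 * p))) := by
    rw [uIcc_of_le hsq]
    have hpair : ContinuousOn (fun s : ℝ => (u, s))
        (Icc (-√(h - u ^ (2 * p))) √(h - u ^ (2 * p))) := by fun_prop
    refine ContinuousOn.mul ?_ ?_
    · refine (contDiffOn_divergence_slice hn hU hP hQ hδ).continuousOn.comp
        (N.continuousOn_Ψ.comp hpair hb) fun s hs => ?_
      exact hρ (hsmall (u, s) (hmem s hs))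
    · exact (contDiffOn_dY hn Metric.isOpen_ball N.contDiffOn_Y).continuousOn.comp hpair hb
  have hFTC := intervalIntegral.integral_eq_sub_of_hasDerivAt hder hcont.intervalIntegrable
  rw [← hFTC, ← intervalIntegral.integral_mul_const]
  rfl

/-- The Melnikov function as an integral over the region bounded by the orbit. -/
theorem exists_melnikov_eq_levelIntegral [NormedAddCommGroup E] [NormedSpace ℝ E]
    (hn : n = ∞ ∨ n = ω) (hU : IsOpen U) (hU0 : (0 : ℝ × ℝ) ∈ U) (hH : ContDiffOn ℝ n H U)
    (hp : 1 ≤ p) {V : Set E} {P Q : ℝ × ℝ → E → ℝ}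
    (hP : ContDiffOn ℝ n (Function.uncurry P) (U ×ˢ V))
    (hQ : ContDiffOn ℝ n (Function.uncurry Q) (U ×ˢ V)) {β : ℝ}
    {γ : ℝ → ℝ → ℝ × ℝ} {T : ℝ → ℝ} (hF : IsCenterFamily H U β γ T) :
    ∃ η ∈ Ioc 0 β, η ≤ min (N.r ^ 2) (N.r ^ (2 * p)) ∧ ∀ h ∈ Ioo 0 η, ∀ δ ∈ V,
      melnikov H P Q γ T h δ = levelIntegral p h (N.density P Q δ) := by
  have hr := N.r_pos
  obtain ⟨ρ, hρ, hρU⟩ := Metric.mem_nhds_iff.1 (hU.mem_nhds hU0)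
  obtain ⟨M, hM, hMU, hlevel⟩ := hF.level_set
  obtain ⟨η₁, hη₁, h₁⟩ := N.eventually_image_subset (Metric.ball_mem_nhds (0 : ℝ × ℝ) hρ)
  obtain ⟨η₂, hη₂, h₂⟩ := N.eventually_image_subset hM
  obtain ⟨η₃, hη₃, h₃⟩ := (mem_nhdsGT_iff_exists_Ioo_subset).1
    (hF.shrinks N.W (N.isOpen_W.mem_nhds N.zero_mem_W))
  have hβ := hF.beta_pos
  have hη₃' : (0 : ℝ) < η₃ := hη₃
  refine ⟨min (min β (min (N.r ^ 2) (N.r ^ (2 * p)))) (min (min η₁ η₂) η₃), ⟨by positivity, ?_⟩, ?_, ?_⟩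
  · exact (min_le_left _ _).trans (min_le_left _ _)
  · exact (min_le_left _ _).trans (min_le_right _ _)
  intro h hh δ hδ
  obtain ⟨h0, hh⟩ := hh
  simp only [lt_min_iff] at hh
  obtain ⟨⟨hhβ, hhr⟩, ⟨hh1, hh2⟩, hh3⟩ := hh
  have hhr' : h < min (N.r ^ 2) (N.r ^ (2 * p)) := lt_min hhr.1 hhr.2
  have hhβ' : h ∈ Ioo 0 β := ⟨h0, hhβ⟩
  -- The neighbourhood in `IsCenterFamily` need not be `W`. For small `h` the orbit lies in `W` by
  -- shrinking, and the model curve lies in the given neighbourhood, so both are the same level set.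
  have hrange : range (γ h) = N.Ψ '' {c | c.1 ^ (2 * p) + c.2 ^ 2 = h} := by
    apply Subset.antisymm
    · intro z hz
      have hzW : z ∈ N.W := h₃ ⟨h0, hh3⟩ hz
      rw [hlevel h hhβ'] at hz
      rw [N.image_level_eq hhr']
      exact ⟨hzW, hz.2⟩
    · intro z hz
      rw [hlevel h hhβ']
      refine ⟨h₂ h hh2 hz, ?_⟩
      rw [N.image_level_eq hhr'] at hz
      exact hz.2
  refine N.melnikov_eq_levelIntegral hn hU hH hp hP hQ hρU h0 hhr' ?_ (hF.period_pos h hhβ')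
    (hF.periodic h hhβ') (hF.injOn h hhβ') (hF.solution h hhβ') hrange hδ
  intro c hc
  exact h₁ _ (hc.trans_lt hh1) ⟨c, rfl, rfl⟩

end NormalCoords

end Melnikov

namespace Melnikov

/-! ### The recursion for the branch series -/

section Branch

open PowerSeries in
-- Factor the difference of powers as `(A - B) ∑ A^i B^(j+1-i)`. The first factor has order at least
-- `n + 2` and the sum order at least `j + 1`, so only the square, `j = 0`, reaches order `n + 3`.
theorem coeff_pow_sub_pow {A B R : PowerSeries ℝ} {n j : ℕ} (hA : coeff 0 A = 0)
    (hB : coeff 0 B = 0) (hAB : A - B = X ^ (n + 2) * R) :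
    coeff (n + 3) (A ^ (j + 2)) - coeff (n + 3) (B ^ (j + 2)) =
      if j = 0 then coeff 0 R * (coeff 1 A + coeff 1 B) else 0 := by
  obtain ⟨A', rfl⟩ : X ∣ A := by rw [X_dvd_iff]; simpa using hA
  obtain ⟨B', rfl⟩ : X ∣ B := by rw [X_dvd_iff]; simpa using hB
  have hgeom := (Commute.all (X * A') (X * B')).geom_sum₂_mul (j + 2)
  rw [← map_sub, ← hgeom, hAB, mul_comm, mul_assoc, show n + 3 = 1 + (n + 2) by ring,
    coeff_X_pow_mul]
  have hterm : ∑ i ∈ Finset.range (j + 2), (X * A') ^ i * (X * B') ^ (j + 2 - 1 - i) =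
      X ^ (j + 1) * ∑ i ∈ Finset.range (j + 2), A' ^ i * B' ^ (j + 2 - 1 - i) := by
    rw [Finset.mul_sum]
    refine Finset.sum_congr rfl fun i hi => ?_
    have hi' := Finset.mem_range.1 hi
    have : (X : PowerSeries ℝ) ^ (j + 1) = X ^ i * X ^ (j + 2 - 1 - i) := by
      rw [← pow_add]; congr 1; omega
    rw [this, mul_pow, mul_pow]; ring
  rw [hterm, mul_left_comm]
  split_ifs with hj
  · subst hj
    rw [zero_add, pow_one, show (1 : ℕ) = 0 + 1 from rfl, coeff_succ_X_mul]
    simp [Finset.sum_range_succ]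
    exact Or.inl (add_comm _ _)
  · rw [coeff_X_pow_mul', if_neg (by omega)]

open PowerSeries in
/-- The recursion for `branchCoeff` determines the series inverting `∑ c_j v^(j+1) = w²`. -/
theorem coeff_eq_branchCoeff {c : ℕ → ℝ} {A : PowerSeries ℝ} (hA0 : coeff 0 A = 0)
    (hA1 : 0 < coeff 1 A)
    (hA : ∀ m, 2 ≤ m → ∑ j ∈ Finset.Icc 1 (m - 1), c j * coeff m (A ^ (j + 1)) =
      if m = 2 then 1 else 0) (n : ℕ) : coeff n A = branchCoeff c n := by
  have hsq : c 1 * coeff 1 A ^ 2 = 1 := by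
    have h := hA 2 le_rfl
    simp only [if_true, Nat.add_one_sub_one, Finset.Icc_self, Finset.sum_singleton] at h
    obtain ⟨A', rfl⟩ : X ∣ A := by rw [X_dvd_iff]; simpa using hA0
    rw [mul_pow] at h
    have h2 : coeff (1 + 1) (X ^ (1 + 1) * A' ^ (1 + 1)) = coeff 0 A' ^ 2 := by
      rw [coeff_X_pow_mul', if_pos le_rfl, Nat.sub_self]
      simp
    rw [h2] at h
    rw [show (1 : ℕ) = 0 + 1 from rfl, coeff_succ_X_mul]
    exact h
  have hc1 : 0 < c 1 := by
    by_contra h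
    push Not at h
    nlinarith [sq_nonneg (coeff 1 A)]
  have ha1 : coeff 1 A = 1 / √(c 1) := by
    have h1 : coeff 1 A ^ 2 = (1 / √(c 1)) ^ 2 := by
      rw [div_pow, Real.sq_sqrt hc1.le, one_pow, eq_div_iff hc1.ne']; linarith
    exact (pow_left_inj₀ hA1.le (by positivity) two_ne_zero).1 h1
  induction n using Nat.strong_induction_on with
  | _ n ih =>
    match n, ih with
    | 0, _ => rw [hA0, branchCoeff]
    | 1, _ => rw [ha1, branchCoeff]
    | n + 2, ih =>
      set B : Polynomial ℝ := ∑ i : Fin (n + 2), Polynomial.monomial i.1 (branchCoeff c i.1)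
        with hBdef
      have hBtr : B = A.trunc (n + 2) := by
        rw [hBdef, Fin.sum_univ_eq_sum_range
          (fun i => Polynomial.monomial i (branchCoeff c i)) (n + 2)]
        ext k
        rw [PowerSeries.coeff_trunc, Polynomial.finsetSum_coeff]
        simp only [Polynomial.coeff_monomial]
        rw [Finset.sum_ite_eq' (Finset.range (n + 2)) k]
        by_cases hk : k < n + 2
        · rw [if_pos (Finset.mem_range.2 hk), if_pos hk, ih k hk]
        · rw [if_neg (by simpa using hk), if_neg hk]
      have hBc : ∀ k, coeff k (B : PowerSeries ℝ) = if k < n + 2 then coeff k A else 0 := by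
        intro k
        rw [Polynomial.coeff_coe, hBtr, PowerSeries.coeff_trunc]
      obtain ⟨R, hR⟩ : (X : PowerSeries ℝ) ^ (n + 2) ∣ A - B := by
        rw [X_pow_dvd_iff]
        intro k hk
        rw [map_sub, hBc, if_pos hk, sub_self]
      have hR0 : coeff 0 R = coeff (n + 2) A := by
        have h1 := congrArg (coeff (n + 2)) hR
        rw [map_sub, hBc, if_neg (lt_irrefl _), sub_zero, coeff_X_pow_mul', if_pos le_rfl,
          Nat.sub_self] at h1
        exact h1.symm
      have hB0 : coeff 0 (B : PowerSeries ℝ) = 0 := by rw [hBc, if_pos (by omega), hA0]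
      have hB1 : coeff 1 (B : PowerSeries ℝ) = coeff 1 A := by rw [hBc, if_pos (by omega)]
      have hmain := hA (n + 3) (by omega)
      rw [if_neg (by omega), show n + 3 - 1 = n + 2 by omega] at hmain
      -- Replacing `A` by its truncation `B` loses the unknown coefficient `n + 2` only in the
      -- quadratic term, where it occurs as `2 c_1 a_1 a_{n+2}`.
      have hterm : ∀ j ∈ Finset.Icc 1 (n + 2), c j * coeff (n + 3) (A ^ (j + 1)) =
          c j * (B ^ (j + 1)).coeff (n + 3) +
            if j = 1 then c 1 * (coeff (n + 2) A * (2 * coeff 1 A)) else 0 := by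
        intro j hj
        obtain ⟨i, rfl⟩ : ∃ i, j = i + 1 := ⟨j - 1, by have := (Finset.mem_Icc.1 hj).1; omega⟩
        have h1 := coeff_pow_sub_pow (n := n) (j := i) hA0 hB0 hR
        rw [hR0, hB1, ← Polynomial.coe_pow, Polynomial.coeff_coe] at h1
        by_cases hi : i = 0
        · subst hi
          rw [if_pos rfl] at h1
          rw [if_pos rfl]
          simp only [zero_add] at h1 ⊢
          linear_combination c 1 * h1
        · rw [if_neg hi] at h1
          rw [if_neg (by omega), add_zero, sub_eq_zero.1 h1]
      rw [Finset.sum_congr rfl hterm, Finset.sum_add_distrib,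
        Finset.sum_ite_eq' (Finset.Icc 1 (n + 2)) 1, if_pos (by simp)] at hmain
      rw [branchCoeff, ← hBdef]
      have hs := Real.sqrt_pos.2 hc1
      have hss := Real.mul_self_sqrt hc1.le
      rw [eq_div_iff (by positivity)]
      have h2 : c 1 * coeff 1 A = √(c 1) := by
        rw [ha1, mul_one_div, div_eq_iff hs.ne', hss]
      rw [← h2]
      linear_combination hmain

end Branch

/-! ### The chain rule for formal compositions -/

section Composition

open PowerSeries in
/-- The chain rule `(∑ d_k A^k) A' = (∑ d_k A^(k+1) / (k+1))'` on the level of coefficients. -/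
theorem coeff_comp_mul_derivative {A : PowerSeries ℝ} (hA0 : coeff 0 A = 0) (d : ℕ → ℝ) (m : ℕ) :
    coeff m ((PowerSeries.mk fun l => ∑ k ∈ Finset.range (l + 1), d k * coeff l (A ^ k)) *
        PowerSeries.derivative ℝ A) =
      (m + 1) * ∑ k ∈ Finset.range (m + 1), d k / (k + 1) * coeff (m + 1) (A ^ (k + 1)) := by
  have h1 : ∀ k : ℕ, coeff m (A ^ k * PowerSeries.derivative ℝ A) * (k + 1) =
      coeff (m + 1) (A ^ (k + 1)) * (m + 1) := by
    intro k
    have h2 := congrArg (coeff m) (Derivation.leibniz_pow (PowerSeries.derivative ℝ) A (k + 1))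
    rw [PowerSeries.coeff_derivative] at h2
    rw [h2, Nat.add_sub_cancel, nsmul_eq_mul, smul_eq_mul,
      ← map_natCast (PowerSeries.C (R := ℝ)), PowerSeries.coeff_C_mul]
    push_cast; ring
  rw [Finset.mul_sum, PowerSeries.coeff_mul]
  simp only [PowerSeries.coeff_mk]
  have h3 : ∀ ij ∈ Finset.HasAntidiagonal.antidiagonal m,
      (∑ k ∈ Finset.range (ij.1 + 1), d k * coeff ij.1 (A ^ k)) *
        coeff ij.2 (PowerSeries.derivative ℝ A) =
      ∑ k ∈ Finset.range (m + 1), d k * (coeff ij.1 (A ^ k) *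
        coeff ij.2 (PowerSeries.derivative ℝ A)) := by
    intro ij hij
    have := Finset.HasAntidiagonal.mem_antidiagonal.1 hij
    rw [Finset.sum_mul]
    simp only [mul_assoc]
    refine Finset.sum_subset (Finset.range_subset_range.2 (by omega)) fun k _ hk => ?_
    rw [coeff_pow_eq_zero_of_lt hA0 (by simpa using hk)]; ring
  rw [Finset.sum_congr rfl h3, Finset.sum_comm]
  refine Finset.sum_congr rfl fun k _ => ?_
  rw [← Finset.mul_sum, ← PowerSeries.coeff_mul]
  have h4 := h1 k
  have hk : (k : ℝ) + 1 ≠ 0 := by positivity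
  field_simp
  linear_combination d k * h4

end Composition

/-! ### Iterated partial derivatives -/

section IteratedPartials

theorem iteratedDeriv_snd (f : ℝ × ℝ → ℝ) (l : ℕ) (u w : ℝ) :
    iteratedDeriv l (fun w => f (u, w)) w = dY^[l] f (u, w) := by
  induction l generalizing w with
  | zero => simp
  | succ l ih =>
    rw [iteratedDeriv_succ, Function.iterate_succ_apply', dY]
    congr 1
    funext w; exact ih w

theorem iteratedDeriv_fst (f : ℝ × ℝ → ℝ) (k : ℕ) (u w : ℝ) :
    iteratedDeriv k (fun u => f (u, w)) u = dX^[k] f (u, w) := by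
  induction k generalizing u with
  | zero => simp
  | succ l ih =>
    rw [iteratedDeriv_succ, Function.iterate_succ_apply', dX]
    congr 1
    funext u; exact ih u

theorem contDiffOn_iterate_dY {n : WithTop ℕ∞} {f : ℝ × ℝ → ℝ} {s : Set (ℝ × ℝ)}
    (hn : n = ∞ ∨ n = ω) (hs : IsOpen s) (hf : ContDiffOn ℝ n f s) (l : ℕ) :
    ContDiffOn ℝ n (dY^[l] f) s := by
  induction l with
  | zero => exact hf
  | succ l ih => rw [Function.iterate_succ_apply']; exact contDiffOn_dY hn hs ih

theorem taylorSeries_shift (f : ℝ → ℝ) (s : ℝ) :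
    taylorSeries (fun v => f (s + v)) =
      PowerSeries.mk fun k => iteratedDeriv k f s / (k.factorial : ℝ) := by
  ext k
  rw [taylorSeries, PowerSeries.coeff_mk, PowerSeries.coeff_mk, iteratedDeriv_comp_const_add]
  simp

end IteratedPartials

/-! ### The prescribed coefficients as Taylor coefficients of the density -/

namespace NormalCoords

variable {E : Type*} {n : WithTop ℕ∞} {H : ℝ × ℝ → ℝ} {U : Set (ℝ × ℝ)} {p : ℕ}
  (N : NormalCoords n H U p)

theorem mk_mem_ball {u : ℝ} (hu : u ∈ Ioo (-N.r) N.r) :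
    (u, (0 : ℝ)) ∈ Metric.ball (0 : ℝ × ℝ) N.r := by
  rw [mem_ball_zero_iff, Prod.norm_def, max_lt_iff]
  exact ⟨abs_lt.2 hu, by simpa using N.r_pos⟩

theorem eventually_mem_ball {u : ℝ} (hu : u ∈ Ioo (-N.r) N.r) :
    ∀ᶠ w in 𝓝 (0 : ℝ), (u, w) ∈ Metric.ball (0 : ℝ × ℝ) N.r := by
  have : Continuous fun w : ℝ => (u, w) := by fun_prop
  exact (this.tendsto 0).eventually (Metric.isOpen_ball.mem_nhds (N.mk_mem_ball hu))

theorem contDiffAt_branch (hn : n = ∞ ∨ n = ω) {u : ℝ} (hu : u ∈ Ioo (-N.r) N.r) :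
    ContDiffAt ℝ ∞ (fun w => N.Y (u, w) - N.Y (u, 0)) 0 := by
  have h1 := (N.contDiffOn_Y.contDiffAt (Metric.isOpen_ball.mem_nhds (N.mk_mem_ball hu))).of_le
    (infty_le_of_infinite hn)
  exact (ContDiffAt.comp (0 : ℝ) (f := fun w : ℝ => (u, w)) h1 (by fun_prop)).sub contDiffAt_const

/-- `branchSeries` is the Taylor series of the branch `w ↦ Y(u, w) - Y(u, 0)`. -/
theorem taylorSeries_branch (hn : n = ∞ ∨ n = ω) (hU : IsOpen U) (hH : ContDiffOn ℝ n H U)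
    {u : ℝ} (hu : u ∈ Ioo (-N.r) N.r) :
    taylorSeries (fun w => N.Y (u, w) - N.Y (u, 0)) = branchSeries H (N.χ u) := by
  have hle := infty_le_of_infinite hn
  have hb := N.mk_mem_ball hu
  set A := taylorSeries (fun w => N.Y (u, w) - N.Y (u, 0)) with hA
  have hA0 : PowerSeries.coeff 0 A = 0 := by simp [hA, taylorSeries]
  have hA1 : PowerSeries.coeff 1 A = dY N.Y (u, 0) := by
    simp [hA, taylorSeries, dY]
  set g : ℝ → ℝ := fun v => H (N.χ u, N.Y (u, 0) + v) with hg
  have hpt : (N.χ u, N.Y (u, 0)) ∈ U := N.W_subset (N.mem_W _ hb)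
  have hgs : ContDiffAt ℝ ∞ g 0 := by
    have h1 : ContDiffAt ℝ ∞ H (N.χ u, N.Y (u, 0) + 0) := by
      rw [add_zero]; exact (hH.contDiffAt (hU.mem_nhds hpt)).of_le hle
    exact ContDiffAt.comp (0 : ℝ) (f := fun v : ℝ => (N.χ u, N.Y (u, 0) + v)) h1 (by fun_prop)
  have hcomp := (hasTaylor_taylorSeries hgs).comp
    (hasTaylor_taylorSeries (N.contDiffAt_branch hn hu)) hA0
  have hquad : HasTaylor (fun w => g (N.Y (u, w) - N.Y (u, 0)))
      ((Polynomial.C (u ^ (2 * p)) + Polynomial.X ^ 2 : Polynomial ℝ) : PowerSeries ℝ) := by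
    -- The energy identity: along the branch the Hamiltonian equals `u ^ (2 p) + w²` exactly, a
    -- polynomial in `w`.
    refine (hasTaylor_eval _).congr ?_
    filter_upwards [N.eventually_mem_ball hu] with w hw
    simp only [hg, add_sub_cancel, Polynomial.eval_add, Polynomial.eval_C, Polynomial.eval_pow,
      Polynomial.eval_X]
    exact N.energy (u, w) hw
  have hser := hcomp.unique hquad
  have hg1 : PowerSeries.coeff 1 (taylorSeries g) = 0 := by
    have h1 := (N.partials_H hn hU hH hb).1
    simp only [mul_zero] at h1
    have h2 : dY H (N.Ψ (u, 0)) = 0 :=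
      (mul_eq_zero.1 h1).resolve_right (N.dY_Y_pos _ hb).ne'
    rw [hg, taylorSeries_shift (fun y => H (N.χ u, y)), PowerSeries.coeff_mk]
    rw [iteratedDeriv_one]
    have h3 : deriv (fun y => H (N.χ u, y)) (N.Y (u, 0)) = 0 := h2
    rw [h3]; simp
  have hgj : ∀ j, PowerSeries.coeff (j + 1) (taylorSeries g) = Hstar H j (N.χ u) := by
    intro j
    rw [hg, taylorSeries_shift (fun y => H (N.χ u, y)), PowerSeries.coeff_mk, Hstar,
      N.crit u hu]
  ext k
  rw [branchSeries, PowerSeries.coeff_mk]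
  refine coeff_eq_branchCoeff hA0 (by rw [hA1]; exact N.dY_Y_pos _ hb) ?_ k
  intro m hm
  have h1 := congrArg (PowerSeries.coeff m) hser
  rw [PowerSeries.coeff_mk] at h1
  have hrhs : PowerSeries.coeff m
      ((Polynomial.C (u ^ (2 * p)) + Polynomial.X ^ 2 : Polynomial ℝ) : PowerSeries ℝ) =
      if m = 2 then 1 else 0 := by
    rw [Polynomial.coeff_coe, Polynomial.coeff_add, Polynomial.coeff_C, if_neg (by omega),
      Polynomial.coeff_X_pow, zero_add]
  rw [hrhs] at h1
  -- For `m ≥ 2` the constant term does not contribute, and the linear term vanishes on the critical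
  -- curve; what remains is the defining equation of the recursion.
  rw [← h1, Finset.sum_range_succ', Finset.range_eq_Ico]
  have hm1 : m = (m - 1) + 1 := by omega
  have h0 : PowerSeries.coeff m (A ^ 0) = 0 := by
    rw [pow_zero, PowerSeries.coeff_one, if_neg (by omega)]
  rw [h0, mul_zero, add_zero, Finset.sum_eq_sum_Ico_succ_bot (by omega), zero_add, hg1, zero_mul,
    zero_add]
  have hIcc : Finset.Icc 1 (m - 1) = Finset.Ico 1 m := by
    ext j; simp only [Finset.mem_Icc, Finset.mem_Ico]; omega
  rw [hIcc]
  refine Finset.sum_congr rfl fun j _ => ?_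
  rw [hgj]

theorem contDiffAt_div_slice [NormedAddCommGroup E] [NormedSpace ℝ E] {V : Set E}
    {P Q : ℝ × ℝ → E → ℝ} (hn : n = ∞ ∨ n = ω) (hU : IsOpen U)
    (hP : ContDiffOn ℝ n (Function.uncurry P) (U ×ˢ V))
    (hQ : ContDiffOn ℝ n (Function.uncurry Q) (U ×ˢ V)) {δ : E} (hδ : δ ∈ V) {z : ℝ × ℝ}
    (hz : z ∈ U) : ContDiffAt ℝ ∞ (divergence P Q δ) z :=
  ((contDiffOn_divergence_slice hn hU hP hQ hδ).contDiffAt (hU.mem_nhds hz)).of_le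
    (infty_le_of_infinite hn)

/-- The coefficients `q̄_j` from the derivatives of the density. -/
theorem iteratedDeriv_density [NormedAddCommGroup E] [NormedSpace ℝ E] {V : Set E}
    {P Q : ℝ × ℝ → E → ℝ} (hn : n = ∞ ∨ n = ω) (hU : IsOpen U) (hH : ContDiffOn ℝ n H U)
    (hP : ContDiffOn ℝ n (Function.uncurry P) (U ×ˢ V))
    (hQ : ContDiffOn ℝ n (Function.uncurry Q) (U ×ˢ V)) {δ : E} (hδ : δ ∈ V)
    {u : ℝ} (hu : u ∈ Ioo (-N.r) N.r) (j : ℕ) :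
    iteratedDeriv (2 * j) (fun w => N.density P Q δ (u, w)) 0 =
      (2 * j).factorial * ((2 * j + 1) / 2 * qBar H P Q δ j (N.χ u) * deriv N.χ u) := by
  have hle := infty_le_of_infinite hn
  have hb := N.mk_mem_ball hu
  have hbr := N.contDiffAt_branch hn hu
  set v : ℝ → ℝ := fun w => N.Y (u, w) - N.Y (u, 0) with hv
  have hA := hasTaylor_taylorSeries hbr
  rw [N.taylorSeries_branch hn hU hH hu] at hA
  have hA0 : PowerSeries.coeff 0 (branchSeries H (N.χ u)) = 0 := by
    rw [branchSeries, PowerSeries.coeff_mk, branchCoeff]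
  have hpt : (N.χ u, N.Y (u, 0)) ∈ U := N.W_subset (N.mem_W _ hb)
  set d : ℝ → ℝ := fun s => divergence P Q δ (N.χ u, N.Y (u, 0) + s) with hd
  have hds : ContDiffAt ℝ ∞ d 0 := by
    have h1 : ContDiffAt ℝ ∞ (divergence P Q δ) (N.χ u, N.Y (u, 0) + 0) := by
      rw [add_zero]; exact contDiffAt_div_slice hn hU hP hQ hδ hpt
    exact ContDiffAt.comp (0 : ℝ) (f := fun s : ℝ => (N.χ u, N.Y (u, 0) + s)) h1 (by fun_prop)
  have hdv := (hasTaylor_taylorSeries hds).comp hA hA0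
  have hv's : ContDiffAt ℝ ∞ (deriv v) 0 := by
    have h1 : ContDiffAt ℝ ∞ (fderiv ℝ v) 0 := hbr.fderiv_right (by simp)
    have h2 : deriv v = fun w => fderiv ℝ v w 1 := by funext w; simp
    rw [h2]; exact h1.clm_apply contDiffAt_const
  have hv' := hasTaylor_taylorSeries hv's
  rw [taylorSeries_deriv, hv, N.taylorSeries_branch hn hU hH hu] at hv'
  have hmul := (hdv.mul hv').mul (hasTaylor_const (deriv N.χ u))
  -- Up to `χ'(u)` the density is `d(v(w)) v'(w)`, the derivative in `w` of `∑ q_k v^k`; hence its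
  -- coefficient of `w ^ (2 j)` is `2 j + 1` times the coefficient of `w ^ (2 j + 1)` of that sum.
  have hdens : (fun w => N.density P Q δ (u, w)) = fun w =>
      d (v w) * deriv v w * deriv N.χ u := by
    funext w
    simp only [hd, hv, add_sub_cancel, NormalCoords.density, NormalCoords.Ψ]
    congr 2
    rw [deriv_sub_const]
    rfl
  have hsm : ContDiffAt ℝ ∞ (fun w => N.density P Q δ (u, w)) 0 := by
    rw [hdens]
    have h1 : ContDiffAt ℝ ∞ d (v 0) := by simpa [hv] using hds
    exact ((h1.comp 0 hbr).mul hv's).mul contDiffAt_const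
  rw [← hdens] at hmul
  rw [hmul.iteratedDeriv_eq hsm, PowerSeries.coeff_mul_C, coeff_comp_mul_derivative hA0, qBar]
  have hq : ∀ k, PowerSeries.coeff k (taylorSeries d) / ((k : ℝ) + 1) =
      qSucc H P Q δ k (N.χ u) := by
    intro k
    rw [hd, taylorSeries_shift (fun y => divergence P Q δ (N.χ u, y)), PowerSeries.coeff_mk, qSucc,
      N.crit u hu, Nat.factorial_succ]
    simp only [divergence]
    push_cast
    rw [div_div, mul_comm ((k : ℝ) + 1)]
  simp only [hq]
  push_cast
  ring

/-- The coefficients `r_ij` are the mixed Taylor coefficients of the density. -/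
theorem rCoeff_eq [NormedAddCommGroup E] [NormedSpace ℝ E] {V : Set E}
    {P Q : ℝ × ℝ → E → ℝ} (hn : n = ∞ ∨ n = ω) (hU : IsOpen U) (hH : ContDiffOn ℝ n H U)
    (hP : ContDiffOn ℝ n (Function.uncurry P) (U ×ˢ V))
    (hQ : ContDiffOn ℝ n (Function.uncurry Q) (U ×ˢ V)) {δ : E} (hδ : δ ∈ V)
    (hdens : ContDiffOn ℝ n (N.density P Q δ) (Metric.ball 0 N.r)) (i j : ℕ) :
    rCoeff H P Q p δ i j = 4 / (2 * j + 1) *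
      (dX^[2 * i] (dY^[2 * j] (N.density P Q δ)) 0 /
        ((2 * i).factorial * (2 * j).factorial)) := by
  set G : ℝ → ℝ := fun u => dY^[2 * j] (N.density P Q δ) (u, 0) with hG
  have hqt : ∀ u ∈ Ioo (-N.r) N.r, qTilde H P Q p δ j u =
      2 / ((2 * j + 1) * (2 * j).factorial) * G u := by
    intro u hu
    rw [qTilde, N.psiInv_eq u hu, N.deriv_psi u hu, hG]
    simp only
    rw [← iteratedDeriv_snd, N.iteratedDeriv_density hn hU hH hP hQ hδ hu j, div_inv_eq_mul]
    have : ((2 * j).factorial : ℝ) ≠ 0 := by positivity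
    have : (2 * (j : ℝ) + 1) ≠ 0 := by positivity
    field_simp
  have hGs : ContDiffAt ℝ ∞ G 0 := by
    have h1 := ((contDiffOn_iterate_dY hn Metric.isOpen_ball hdens (2 * j)).contDiffAt
      (Metric.ball_mem_nhds 0 N.r_pos)).of_le (infty_le_of_infinite hn)
    exact ContDiffAt.comp (0 : ℝ) (f := fun u : ℝ => (u, (0 : ℝ))) h1 (by fun_prop)
  set κ : ℝ := 2 / ((2 * j + 1) * (2 * j).factorial) with hκ
  have hev : (fun u => qTilde H P Q p δ j u + qTilde H P Q p δ j (-u)) =ᶠ[𝓝 0]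
      fun u => κ * (G u + G (-u)) := by
    filter_upwards [Ioo_mem_nhds (neg_lt_zero.2 N.r_pos) N.r_pos] with u hu
    rw [hqt u hu, hqt (-u) ⟨by linarith [hu.2], by linarith [hu.1]⟩]; ring
  have hGn : ContDiffAt ℝ ∞ (fun u => G (-u)) 0 := by
    have h1 : ContDiffAt ℝ ∞ G (-0) := by simpa using hGs
    exact ContDiffAt.comp (0 : ℝ) (f := fun u : ℝ => -u) h1 (by fun_prop)
  have hle2 : ((2 * i : ℕ) : WithTop ℕ∞) ≤ ∞ :=
    WithTop.coe_le_coe.2 (le_top : ((2 * i : ℕ) : ℕ∞) ≤ ⊤)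
  -- Derivatives of even order at `0` do not see the reflection, so symmetrizing doubles them; this
  -- turns `2 / (2 j + 1)` into `4 / (2 j + 1)`.
  have hder : iteratedDeriv (2 * i) (fun u => κ * (G u + G (-u))) 0 =
      κ * (2 * iteratedDeriv (2 * i) G 0) := by
    rw [iteratedDeriv_const_mul_field]
    have h2 : (fun u => G u + G (-u)) = G + fun u => G (-u) := rfl
    rw [h2, iteratedDeriv_add (hGs.of_le hle2) (hGn.of_le hle2), iteratedDeriv_comp_neg]
    rw [Even.neg_one_pow (even_two_mul i), one_smul, neg_zero]
    ring
  rw [rCoeff, hev.iteratedDeriv_eq, hder, hG, iteratedDeriv_fst, hκ]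
  have : ((2 * j).factorial : ℝ) ≠ 0 := by positivity
  have : ((2 * i).factorial : ℝ) ≠ 0 := by positivity
  have : (2 * (j : ℝ) + 1) ≠ 0 := by positivity
  have e0 : ((0 : ℝ), (0 : ℝ)) = 0 := rfl
  rw [e0]
  field_simp
  ring

end NormalCoords

end Melnikov

/-! ### Integrals of monomials over the level region -/

namespace Melnikov

open MeasureTheory

/-- The closed region enclosed by the level curve `u ^ (2 p) + w ^ 2 = h`. -/
def levelRegion (p : ℕ) (h : ℝ) : Set (ℝ × ℝ) := {z | z.1 ^ (2 * p) + z.2 ^ 2 ≤ h}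

theorem isClosed_levelRegion (p : ℕ) (h : ℝ) : IsClosed (levelRegion p h) :=
  isClosed_le (by fun_prop) continuous_const

theorem mem_levelRegion_iff {p : ℕ} (hp : 1 ≤ p) {h : ℝ} (h0 : 0 < h) {u s : ℝ} :
    (u, s) ∈ levelRegion p h ↔ u ∈ Icc (-(h ^ (1 / (2 * (p : ℝ))))) (h ^ (1 / (2 * (p : ℝ)))) ∧
      s ∈ Icc (-√(h - u ^ (2 * p))) √(h - u ^ (2 * p)) := by
  constructor
  · intro hz
    have hz' : u ^ (2 * p) + s ^ 2 ≤ h := hz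
    refine ⟨?_, ?_⟩
    · refine abs_le.1 ?_
      have h1 : |u| ^ (2 * p) ≤ (h ^ (1 / (2 * (p : ℝ)))) ^ (2 * p) := by
        rw [rpow_inv_two_mul_pow hp h0, (even_two_mul p).pow_abs]; nlinarith [sq_nonneg s]
      exact (pow_le_pow_iff_left₀ (abs_nonneg u) (by positivity) (by omega)).1 h1
    · exact abs_le.1 (Real.abs_le_sqrt (by linarith))
  · rintro ⟨hu, hs⟩
    exact energy_le_of_mem (rpow_inv_two_mul_pow hp h0) hu hs

theorem levelRegion_subset {p : ℕ} (hp : 1 ≤ p) {h : ℝ} (h0 : 0 < h) :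
    levelRegion p h ⊆ Icc (-(h ^ (1 / (2 * (p : ℝ))))) (h ^ (1 / (2 * (p : ℝ)))) ×ˢ
      Icc (-√h) √h := by
  rintro ⟨u, s⟩ hz
  obtain ⟨hu, hs⟩ := (mem_levelRegion_iff hp h0).1 hz
  refine ⟨hu, ?_⟩
  have h1 : √(h - u ^ (2 * p)) ≤ √h :=
    Real.sqrt_le_sqrt (by have := (even_two_mul p).pow_nonneg u; linarith)
  exact ⟨by linarith [hs.1], hs.2.trans h1⟩

theorem isCompact_levelRegion {p : ℕ} (hp : 1 ≤ p) {h : ℝ} (h0 : 0 < h) :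
    IsCompact (levelRegion p h) :=
  (isCompact_Icc.prod isCompact_Icc).of_isClosed_subset (isClosed_levelRegion p h)
    (levelRegion_subset hp h0)

theorem rpow_mul_sqrt_eq {p : ℕ} (hp : 1 ≤ p) {h : ℝ} (h0 : 0 < h) :
    h ^ (1 / (2 * (p : ℝ))) * √h = h ^ (((p : ℝ) + 1) / (2 * p)) := by
  have hp' : (0 : ℝ) < p := by exact_mod_cast hp
  rw [Real.sqrt_eq_rpow, ← Real.rpow_add h0]
  congr 1
  field_simp
  ring

/-- The enclosing box has sides `2 h ^ (1 / (2 p))` and `2 √h`; this is where the leading exponent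
comes from. -/
theorem measureReal_levelRegion_le {p : ℕ} (hp : 1 ≤ p) {h : ℝ} (h0 : 0 < h) :
    volume.real (levelRegion p h) ≤ 4 * h ^ (((p : ℝ) + 1) / (2 * p)) := by
  have ha : 0 ≤ h ^ (1 / (2 * (p : ℝ))) := by positivity
  refine (measureReal_mono (levelRegion_subset hp h0)
    (isCompact_Icc.prod isCompact_Icc).measure_lt_top.ne).trans ?_
  rw [Measure.volume_eq_prod, measureReal_prod_prod, Real.volume_real_Icc_of_le (by linarith),
    Real.volume_real_Icc_of_le (by linarith [Real.sqrt_nonneg h]), ← rpow_mul_sqrt_eq hp h0]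
  exact le_of_eq (by ring)

/-- Fubini's theorem. Estimates and termwise integration are easier on the planar region, while
monomials are easier as iterated integrals. -/
theorem levelIntegral_eq_setIntegral {p : ℕ} (hp : 1 ≤ p) {h : ℝ} (h0 : 0 < h) {f : ℝ × ℝ → ℝ}
    (hf : ContinuousOn f (levelRegion p h)) :
    levelIntegral p h f = ∫ z in levelRegion p h, f z := by
  have hm := (isClosed_levelRegion p h).measurableSet
  have hint : Integrable ((levelRegion p h).indicator f) (volume.prod volume) :=
    (integrable_indicator_iff hm).2 (hf.integrableOn_compact (isCompact_levelRegion hp h0))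
  have ha : 0 ≤ h ^ (1 / (2 * (p : ℝ))) := by positivity
  rw [← integral_indicator hm, Measure.volume_eq_prod, integral_prod _ hint, levelIntegral,
    intervalIntegral.integral_of_le (by linarith), ← integral_Icc_eq_integral_Ioc,
    ← integral_indicator measurableSet_Icc]
  congr 1
  funext u
  by_cases hu : u ∈ Icc (-(h ^ (1 / (2 * (p : ℝ))))) (h ^ (1 / (2 * (p : ℝ))))
  · rw [indicator_of_mem hu,
      intervalIntegral.integral_of_le (by linarith [Real.sqrt_nonneg (h - u ^ (2 * p))]),
      ← integral_Icc_eq_integral_Ioc, ← integral_indicator measurableSet_Icc]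
    congr 1
    funext s
    by_cases hs : s ∈ Icc (-√(h - u ^ (2 * p))) √(h - u ^ (2 * p))
    · rw [indicator_of_mem hs, indicator_of_mem ((mem_levelRegion_iff hp h0).2 ⟨hu, hs⟩)]
    · rw [indicator_of_notMem hs,
        indicator_of_notMem fun hz => hs ((mem_levelRegion_iff hp h0).1 hz).2]
  · rw [indicator_of_notMem hu]
    have : ∀ s, (levelRegion p h).indicator f (u, s) = 0 := fun s =>
      indicator_of_notMem (fun hz => hu ((mem_levelRegion_iff hp h0).1 hz).1) _
    simp [this]

/-- The substitution `v = u ^ p`, made on the half line with indicator functions since the exponent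
of `v` may be negative. -/
theorem betaInt_eq {p : ℕ} (hp : 1 ≤ p) (i j : ℕ) :
    betaInt p i j = ∫ u in (0 : ℝ)..1, u ^ (2 * i) * (1 - u ^ (2 * p)) ^ j * √(1 - u ^ (2 * p)) := by
  have hp' : (0 : ℝ) < p := by exact_mod_cast hp
  set g : ℝ → ℝ := (Ioc (0 : ℝ) 1).indicator fun v =>
    v ^ ((2 * (i : ℝ) + 1 - p) / p) * (1 - v ^ 2) ^ j * √(1 - v ^ 2) with hg
  have hsub : Ioc (0 : ℝ) 1 ⊆ Ioi 0 := fun x hx => hx.1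
  have h1 : ∫ v in (0 : ℝ)..1, v ^ ((2 * (i : ℝ) + 1 - p) / p) * (1 - v ^ 2) ^ j * √(1 - v ^ 2) =
      ∫ v in Ioi (0 : ℝ), g v := by
    rw [intervalIntegral.integral_of_le zero_le_one, hg, setIntegral_indicator measurableSet_Ioc,
      inter_eq_right.2 hsub]
  rw [betaInt, h1, ← integral_comp_rpow_Ioi g hp'.ne', ← integral_const_mul,
    intervalIntegral.integral_of_le zero_le_one]
  rw [← inter_eq_right.2 hsub, ← setIntegral_indicator measurableSet_Ioc]
  refine setIntegral_congr_fun measurableSet_Ioi fun x hx => ?_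
  have hx0 : (0 : ℝ) < x := hx
  simp only [Real.rpow_natCast]
  by_cases hx1 : x ≤ 1
  · have hm : x ^ p ∈ Ioc (0 : ℝ) 1 := ⟨by positivity, pow_le_one₀ hx0.le hx1⟩
    rw [indicator_of_mem (show x ∈ Ioc (0 : ℝ) 1 from ⟨hx0, hx1⟩), hg, indicator_of_mem hm]
    have e1 : (x ^ p) ^ 2 = x ^ (2 * p) := by rw [← pow_mul, mul_comm]
    have e2 : x ^ ((p : ℝ) - 1) * (x ^ p) ^ ((2 * (i : ℝ) + 1 - p) / p) = x ^ (2 * i) := by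
      rw [← Real.rpow_natCast x p, ← Real.rpow_mul hx0.le, ← Real.rpow_add hx0,
        ← Real.rpow_natCast]
      congr 1
      push_cast
      field_simp
      ring
    rw [e1, abs_of_pos hp', smul_eq_mul, ← e2]
    field_simp
  · have hm : x ^ p ∉ Ioc (0 : ℝ) 1 := fun hm =>
      hx1 ((pow_le_one_iff_of_nonneg hx0.le (by omega)).1 hm.2)
    rw [indicator_of_notMem (fun h => hx1 h.2), hg, indicator_of_notMem hm]
    simp

theorem intervalIntegral_odd {f : ℝ → ℝ} (hf : ∀ x, f (-x) = -f x) (a : ℝ) :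
    ∫ x in (-a)..a, f x = 0 := by
  have h1 := intervalIntegral.integral_comp_neg f (a := -a) (b := a)
  simp only [hf, neg_neg, intervalIntegral.integral_neg] at h1
  linarith

theorem intervalIntegral_even {f : ℝ → ℝ} (hc : Continuous f) (hf : ∀ x, f (-x) = f x) (a : ℝ) :
    ∫ x in (-a)..a, f x = 2 * ∫ x in (0 : ℝ)..a, f x := by
  have h1 := intervalIntegral.integral_comp_neg f (a := 0) (b := a)
  simp only [hf, neg_zero] at h1
  rw [← intervalIntegral.integral_add_adjacent_intervals (b := 0) (hc.intervalIntegrable _ _)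
    (hc.intervalIntegrable _ _), ← h1]
  ring

theorem levelIntegral_monomial_of_odd_fst {p k l : ℕ} (h : ℝ) (hk : Odd k) :
    levelIntegral p h (fun z => z.1 ^ k * z.2 ^ l) = 0 := by
  refine intervalIntegral_odd (fun u => ?_) _
  simp only [(even_two_mul p).neg_pow, hk.neg_pow, neg_mul, intervalIntegral.integral_neg]

theorem levelIntegral_monomial_of_odd_snd {p k l : ℕ} (h : ℝ) (hl : Odd l) :
    levelIntegral p h (fun z => z.1 ^ k * z.2 ^ l) = 0 := by
  rw [levelIntegral]
  have : ∀ u : ℝ, ∫ s in (-√(h - u ^ (2 * p)))..√(h - u ^ (2 * p)), u ^ k * s ^ l = 0 := fun u =>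
    intervalIntegral_odd (fun s => by rw [hl.neg_pow]; ring) _
  simp [this]

/-- The inner integral gives `2 / (2 j + 1) · u ^ (2 i) (h - u ^ (2 p)) ^ j √(h - u ^ (2 p))`.
Evenness in `u` gives another factor `2`, and scaling `u` by `a = h ^ (1 / (2 p))` extracts `a ^ (2
i + 1) h ^ j √h`. -/
theorem levelIntegral_monomial {p : ℕ} (hp : 1 ≤ p) (i j : ℕ) {h : ℝ} (h0 : 0 < h) :
    levelIntegral p h (fun z => z.1 ^ (2 * i) * z.2 ^ (2 * j)) =
      4 / (2 * j + 1) * betaInt p i j *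
        (h ^ (((p : ℝ) + 1) / (2 * p)) * h ^ (((i + p * j : ℕ) : ℝ) / p)) := by
  have hp' : (0 : ℝ) < p := by exact_mod_cast hp
  set a := h ^ (1 / (2 * (p : ℝ))) with ha
  have ha0 : 0 < a := by positivity
  have hah : a ^ (2 * p) = h := rpow_inv_two_mul_pow hp h0
  have hin : ∀ u ∈ uIcc (-a) a,
      ∫ s in (-√(h - u ^ (2 * p)))..√(h - u ^ (2 * p)), u ^ (2 * i) * s ^ (2 * j) =
        2 / (2 * j + 1) * (u ^ (2 * i) * (h - u ^ (2 * p)) ^ j * √(h - u ^ (2 * p))) := by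
    intro u hu
    rw [uIcc_of_le (by linarith)] at hu
    have h1 : 0 ≤ h - u ^ (2 * p) := sub_nonneg.2 (hah ▸ pow_le_of_mem_Icc hu)
    rw [intervalIntegral.integral_const_mul, integral_pow, (odd_two_mul_add_one j).neg_pow,
      pow_succ, pow_mul (√(h - u ^ (2 * p))), Real.sq_sqrt h1]
    push_cast
    ring
  rw [levelIntegral, intervalIntegral.integral_congr hin, intervalIntegral.integral_const_mul,
    intervalIntegral_even (by fun_prop) (fun u => by
      rw [(even_two_mul p).neg_pow, (even_two_mul i).neg_pow]), betaInt_eq hp]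
  have hsub : ∫ u in (0 : ℝ)..a, u ^ (2 * i) * (h - u ^ (2 * p)) ^ j * √(h - u ^ (2 * p)) =
      a ^ (2 * i) * h ^ j * √h * a *
        ∫ u in (0 : ℝ)..1, u ^ (2 * i) * (1 - u ^ (2 * p)) ^ j * √(1 - u ^ (2 * p)) := by
    have h1 := intervalIntegral.mul_integral_comp_mul_left (a := 0) (b := 1) a
      (f := fun u => u ^ (2 * i) * (h - u ^ (2 * p)) ^ j * √(h - u ^ (2 * p)))
    rw [mul_zero, mul_one] at h1
    rw [← h1, mul_comm _ a, mul_assoc a]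
    congr 1
    rw [← intervalIntegral.integral_const_mul]
    congr 1
    funext u
    have h2 : h - (a * u) ^ (2 * p) = h * (1 - u ^ (2 * p)) := by rw [mul_pow, hah]; ring
    rw [h2, Real.sqrt_mul h0.le, mul_pow, mul_pow]
    ring
  have hpow : a ^ (2 * i) * h ^ j = h ^ (((i + p * j : ℕ) : ℝ) / p) := by
    rw [ha, ← Real.rpow_natCast, ← Real.rpow_natCast, ← Real.rpow_mul h0.le, ← Real.rpow_add h0]
    congr 1
    push_cast
    field_simp
  rw [hsub, ← hpow, ← rpow_mul_sqrt_eq hp h0, ← ha]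
  ring

theorem abs_setIntegral_levelRegion_le {p : ℕ} (hp : 1 ≤ p) {h : ℝ} (h0 : 0 < h) {f : ℝ × ℝ → ℝ}
    {C : ℝ} (hC : ∀ z ∈ levelRegion p h, |f z| ≤ C) :
    |∫ z in levelRegion p h, f z| ≤ 4 * C * h ^ (((p : ℝ) + 1) / (2 * p)) := by
  have hC0 : 0 ≤ C := (abs_nonneg _).trans
    (hC (0, 0) (by simp [levelRegion, h0.le, show p ≠ 0 by omega]))
  have h1 := norm_setIntegral_le_of_norm_le_const (f := f) (μ := volume)
    (isCompact_levelRegion hp h0).measure_lt_top hC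
  refine h1.trans ?_
  nlinarith [mul_le_mul_of_nonneg_left (measureReal_levelRegion_le hp h0) hC0]

end Melnikov

namespace Melnikov

/-! ### Joint regularity in phase variables and parameter -/

section Joint

variable {E : Type*} [NormedAddCommGroup E] [NormedSpace ℝ E] {n : WithTop ℕ∞}

/-- A partial derivative of a slice is the joint derivative in a fixed direction. Joint regularity
is what later makes constants and radii uniform on the compact parameter set. -/
theorem contDiffOn_uncurry_dY {f : E → ℝ × ℝ → ℝ} {s : Set (ℝ × ℝ)} {V : Set E}
    (hn : n = ∞ ∨ n = ω) (hs : IsOpen s) (hV : IsOpen V)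
    (hf : ContDiffOn ℝ n (fun x : (ℝ × ℝ) × E => f x.2 x.1) (s ×ˢ V)) :
    ContDiffOn ℝ n (fun x : (ℝ × ℝ) × E => dY (f x.2) x.1) (s ×ˢ V) := by
  have h1 : ContDiffOn ℝ n (fun x => fderiv ℝ (fun x : (ℝ × ℝ) × E => f x.2 x.1) x ((0, 1), 0))
      (s ×ˢ V) :=
    (hf.fderiv_of_isOpen (hs.prod hV) (add_one_le_of_infinite hn)).clm_apply contDiffOn_const
  refine h1.congr fun x hx => ?_
  have hd := ((hf.contDiffAt ((hs.prod hV).mem_nhds hx)).differentiableAt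
    (ne_zero_of_infinite hn)).hasFDerivAt
  have hc : HasDerivAt (fun t : ℝ => (((x.1.1, t), x.2) : (ℝ × ℝ) × E)) ((0, 1), 0) x.1.2 :=
    ((hasDerivAt_const _ _).prodMk (hasDerivAt_id _)).prodMk (hasDerivAt_const _ _)
  exact (hd.comp_hasDerivAt x.1.2 hc).deriv

theorem contDiffOn_uncurry_dX {f : E → ℝ × ℝ → ℝ} {s : Set (ℝ × ℝ)} {V : Set E}
    (hn : n = ∞ ∨ n = ω) (hs : IsOpen s) (hV : IsOpen V)
    (hf : ContDiffOn ℝ n (fun x : (ℝ × ℝ) × E => f x.2 x.1) (s ×ˢ V)) :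
    ContDiffOn ℝ n (fun x : (ℝ × ℝ) × E => dX (f x.2) x.1) (s ×ˢ V) := by
  have h1 : ContDiffOn ℝ n (fun x => fderiv ℝ (fun x : (ℝ × ℝ) × E => f x.2 x.1) x ((1, 0), 0))
      (s ×ˢ V) :=
    (hf.fderiv_of_isOpen (hs.prod hV) (add_one_le_of_infinite hn)).clm_apply contDiffOn_const
  refine h1.congr fun x hx => ?_
  have hd := ((hf.contDiffAt ((hs.prod hV).mem_nhds hx)).differentiableAt
    (ne_zero_of_infinite hn)).hasFDerivAt
  have hc : HasDerivAt (fun t : ℝ => (((t, x.1.2), x.2) : (ℝ × ℝ) × E)) ((1, 0), 0) x.1.1 :=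
    ((hasDerivAt_id _).prodMk (hasDerivAt_const _ _)).prodMk (hasDerivAt_const _ _)
  exact (hd.comp_hasDerivAt x.1.1 hc).deriv

theorem contDiffOn_uncurry_iterate {f : E → ℝ × ℝ → ℝ} {s : Set (ℝ × ℝ)} {V : Set E}
    (hn : n = ∞ ∨ n = ω) (hs : IsOpen s) (hV : IsOpen V)
    (hf : ContDiffOn ℝ n (fun x : (ℝ × ℝ) × E => f x.2 x.1) (s ×ˢ V)) (k l : ℕ) :
    ContDiffOn ℝ n (fun x : (ℝ × ℝ) × E => dX^[k] (dY^[l] (f x.2)) x.1) (s ×ˢ V) := by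
  have hl : ContDiffOn ℝ n (fun x : (ℝ × ℝ) × E => dY^[l] (f x.2) x.1) (s ×ˢ V) := by
    induction l with
    | zero => exact hf
    | succ l ih =>
      simp only [Function.iterate_succ_apply']
      exact contDiffOn_uncurry_dY (f := fun δ => dY^[l] (f δ)) hn hs hV ih
  induction k with
  | zero => exact hl
  | succ k ih =>
    simp only [Function.iterate_succ_apply']
    exact contDiffOn_uncurry_dX (f := fun δ => dX^[k] (dY^[l] (f δ))) hn hs hV ih

theorem contDiffOn_of_uncurry {f : E → ℝ × ℝ → ℝ} {s : Set (ℝ × ℝ)} {V : Set E}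
    (hf : ContDiffOn ℝ n (fun x : (ℝ × ℝ) × E => f x.2 x.1) (s ×ˢ V)) {δ : E} (hδ : δ ∈ V) :
    ContDiffOn ℝ n (f δ) s :=
  hf.comp (f := fun z : ℝ × ℝ => (z, δ)) (contDiff_id.prodMk contDiff_const).contDiffOn
    fun _ hz => ⟨hz, hδ⟩

theorem NormalCoords.contDiffOn_density {H : ℝ × ℝ → ℝ} {U : Set (ℝ × ℝ)} {p : ℕ}
    (N : NormalCoords n H U p) {P Q : ℝ × ℝ → E → ℝ} {V : Set E} (hn : n = ∞ ∨ n = ω)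
    (hU : IsOpen U) (hV : IsOpen V)
    (hP : ContDiffOn ℝ n (Function.uncurry P) (U ×ˢ V))
    (hQ : ContDiffOn ℝ n (Function.uncurry Q) (U ×ˢ V)) :
    ContDiffOn ℝ n (fun x : (ℝ × ℝ) × E => N.density P Q x.2 x.1)
      (Metric.ball 0 N.r ×ˢ V) := by
  have hfst : ContDiffOn ℝ n (fun x : (ℝ × ℝ) × E => x.1) (Metric.ball 0 N.r ×ˢ V) :=
    contDiff_fst.contDiffOn
  have hdiv : ContDiffOn ℝ n (fun x : (ℝ × ℝ) × E => divergence P Q x.2 x.1) (U ×ˢ V) :=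
    (contDiffOn_uncurry_dX (f := fun δ z => P z δ) hn hU hV hP).add
      (contDiffOn_uncurry_dY (f := fun δ z => Q z δ) hn hU hV hQ)
  have hχ : ContDiffOn ℝ n (fun c : ℝ × ℝ => N.χ c.1) (Metric.ball 0 N.r) :=
    N.contDiffOn_χ.comp contDiff_fst.contDiffOn fun _ hc => fst_mem_Ioo_of_mem_ball hc
  have hΨ : ContDiffOn ℝ n (fun x : (ℝ × ℝ) × E => (N.Ψ x.1, x.2)) (Metric.ball 0 N.r ×ˢ V) :=
    ((hχ.prodMk N.contDiffOn_Y).comp hfst fun x hx => hx.1).prodMk contDiff_snd.contDiffOn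
  have h1 := hdiv.comp hΨ fun x hx => ⟨N.W_subset (N.mem_W _ hx.1), hx.2⟩
  have h2 : ContDiffOn ℝ n (fun x : (ℝ × ℝ) × E => dY N.Y x.1) (Metric.ball 0 N.r ×ˢ V) :=
    (contDiffOn_dY hn Metric.isOpen_ball N.contDiffOn_Y).comp hfst fun x hx => hx.1
  have h3 : ContDiffOn ℝ n (fun x : (ℝ × ℝ) × E => deriv N.χ x.1.1) (Metric.ball 0 N.r ×ˢ V) := by
    have h4 : ContDiffOn ℝ n (deriv N.χ) (Ioo (-N.r) N.r) :=
      N.contDiffOn_χ.deriv_of_isOpen isOpen_Ioo (add_one_le_of_infinite hn)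
    exact h4.comp (contDiff_fst.comp contDiff_fst).contDiffOn fun x hx =>
      fst_mem_Ioo_of_mem_ball hx.1
  exact (h1.mul h2).mul h3

end Joint

/-! ### Taylor's formula with uniform remainder -/

section UniformTaylor

/-- Induction through `g'` and the mean value inequality. The factorial in the remainder is not
needed, so the same `C` serves at every step. -/
theorem abs_sub_taylor_le {g : ℝ → ℝ} {r r' C : ℝ} (hr : r' < r) (N : ℕ)
    (hg : ContDiffOn ℝ ∞ g (Ioo (-r) r)) (hC : ∀ x, |x| ≤ r' → |iteratedDeriv N g x| ≤ C)
    {x : ℝ} (hx : |x| ≤ r') :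
    |g x - ∑ k ∈ Finset.range N, iteratedDeriv k g 0 / (k.factorial : ℝ) * x ^ k| ≤
      C * |x| ^ N := by
  induction N generalizing g x with
  | zero => simpa using hC x hx
  | succ N ih =>
    have hIoo : ∀ y, |y| ≤ r' → y ∈ Ioo (-r) r := fun y hy => abs_lt.1 (hy.trans_lt hr)
    have hg' : ContDiffOn ℝ ∞ (deriv g) (Ioo (-r) r) :=
      hg.deriv_of_isOpen isOpen_Ioo (by simp)
    have hC0 : 0 ≤ C := (abs_nonneg _).trans (hC x hx)
    have ih' := fun y hy => @ih (deriv g) hg' (fun x hx => by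
      rw [← iteratedDeriv_succ']; exact hC x hx) y hy
    set R : ℝ → ℝ := fun x =>
      g x - ∑ k ∈ Finset.range (N + 1), iteratedDeriv k g 0 / (k.factorial : ℝ) * x ^ k with hR
    have hR0 : R 0 = 0 := by
      simp only [hR, Finset.sum_range_succ', pow_succ, mul_zero, Finset.sum_const_zero]
      simp
    have hder : ∀ y, |y| ≤ |x| → HasDerivWithinAt R (deriv g y - ∑ k ∈ Finset.range N,
        iteratedDeriv k (deriv g) 0 / (k.factorial : ℝ) * y ^ k) (Metric.closedBall 0 |x|) y := by
      intro y hy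
      refine HasDerivAt.hasDerivWithinAt ?_
      have h1 : HasDerivAt g (deriv g y) y :=
        ((hg.contDiffAt (isOpen_Ioo.mem_nhds (hIoo y (hy.trans hx)))).differentiableAt
          (by simp)).hasDerivAt
      refine h1.sub ?_
      have h2 : HasDerivAt (fun x => ∑ k ∈ Finset.range (N + 1),
          iteratedDeriv k g 0 / (k.factorial : ℝ) * x ^ k)
          (∑ k ∈ Finset.range (N + 1), iteratedDeriv k g 0 / (k.factorial : ℝ) *
            (k * y ^ (k - 1))) y :=
        HasDerivAt.fun_sum fun k _ => (hasDerivAt_pow k y).const_mul _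
      refine h2.congr_deriv ?_
      rw [Finset.sum_range_succ']
      simp only [Nat.cast_zero, zero_mul, mul_zero, add_zero]
      refine Finset.sum_congr rfl fun k _ => ?_
      rw [← iteratedDeriv_succ', Nat.factorial_succ, Nat.add_sub_cancel]
      have : ((k.factorial : ℕ) : ℝ) ≠ 0 := by positivity
      push_cast
      field_simp
    have hb := (convex_closedBall (0 : ℝ) |x|).norm_image_sub_le_of_norm_hasDerivWithin_le
      (f := R) (C := C * |x| ^ N) (x := 0) (y := x)
      (fun y hy => hder y (by simpa using hy))
      (fun y hy => by
        have hy' : |y| ≤ |x| := by simpa using hy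
        refine (ih' y (hy'.trans hx)).trans ?_
        gcongr)
      (by simp) (by simp)
    rw [hR0, sub_zero, sub_zero, Real.norm_eq_abs, Real.norm_eq_abs] at hb
    rwa [pow_succ, ← mul_assoc]

/-- The Taylor coefficient of `u ^ k * w ^ l` at the origin. -/
noncomputable def mixedCoeff (f : ℝ × ℝ → ℝ) (k l : ℕ) : ℝ :=
  dX^[k] (dY^[l] f) 0 / (k.factorial * l.factorial)

variable {E : Type*} [NormedAddCommGroup E] [NormedSpace ℝ E]

theorem exists_bound_iterate {f : E → ℝ × ℝ → ℝ} {V D : Set E} {r r' : ℝ} (hr : r' < r)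
    (hV : IsOpen V) (hD : IsCompact D) (hDV : D ⊆ V)
    (hf : ContDiffOn ℝ ∞ (fun x : (ℝ × ℝ) × E => f x.2 x.1) (Metric.ball 0 r ×ˢ V)) (k l : ℕ) :
    ∃ C, ∀ δ ∈ D, ∀ u w : ℝ, |u| ≤ r' → |w| ≤ r' → |dX^[k] (dY^[l] (f δ)) (u, w)| ≤ C := by
  have h1 := (contDiffOn_uncurry_iterate (Or.inl rfl) Metric.isOpen_ball hV hf k l).continuousOn
  have hsub : Metric.closedBall (0 : ℝ × ℝ) r' ×ˢ D ⊆ Metric.ball 0 r ×ˢ V :=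
    prod_mono (Metric.closedBall_subset_ball hr) hDV
  obtain ⟨C, hC⟩ := ((isCompact_closedBall (0 : ℝ × ℝ) r').prod hD).exists_bound_of_continuousOn
    (h1.mono hsub)
  refine ⟨C, fun δ hδ u w hu hw => hC ((u, w), δ) ⟨?_, hδ⟩⟩
  rw [mem_closedBall_zero_iff, Prod.norm_def]
  exact max_le hu hw

/-- First expand in `w` with coefficients depending on `u`, then each coefficient in `u`. The
constants come from compactness of a closed ball times `D`. -/
theorem exists_abs_sub_taylor_le {f : E → ℝ × ℝ → ℝ} {V D : Set E} {r r' : ℝ} (hr0 : 0 ≤ r')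
    (hr : r' < r) (hV : IsOpen V) (hD : IsCompact D) (hDV : D ⊆ V)
    (hf : ContDiffOn ℝ ∞ (fun x : (ℝ × ℝ) × E => f x.2 x.1) (Metric.ball 0 r ×ˢ V)) (N : ℕ) :
    ∃ C, ∀ δ ∈ D, ∀ u w : ℝ, |u| ≤ r' → |w| ≤ r' →
      |f δ (u, w) - ∑ l ∈ Finset.range N, ∑ k ∈ Finset.range N,
        mixedCoeff (f δ) k l * (u ^ k * w ^ l)| ≤ C * (|u| ^ N + |w| ^ N) := by
  choose B hB using fun k l => exists_bound_iterate hr hV hD hDV hf k l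
  set C' : ℝ := ∑ l ∈ Finset.range N, |B N l| / (l.factorial : ℝ) * r' ^ l with hC'
  have hC'0 : 0 ≤ C' := Finset.sum_nonneg fun l _ => by positivity
  refine ⟨|B 0 N| + C', fun δ hδ u w hu hw => ?_⟩
  have hball : ∀ a b : ℝ, |a| < r → |b| < r → (a, b) ∈ Metric.ball (0 : ℝ × ℝ) r := by
    intro a b ha hb
    rw [mem_ball_zero_iff, Prod.norm_def]
    exact max_lt ha hb
  have hfδ := contDiffOn_of_uncurry hf (hDV hδ)
  have hw1 : |f δ (u, w) - ∑ l ∈ Finset.range N, dY^[l] (f δ) (u, 0) / (l.factorial : ℝ) * w ^ l| ≤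
      |B 0 N| * |w| ^ N := by
    have h1 : ContDiffOn ℝ ∞ (fun w => f δ (u, w)) (Ioo (-r) r) :=
      hfδ.comp (f := fun w : ℝ => (u, w)) (by fun_prop) fun w hw =>
        hball _ _ (hu.trans_lt hr) (abs_lt.2 hw)
    have h2 := abs_sub_taylor_le (C := |B 0 N|) hr N h1 (fun x hx => by
      rw [iteratedDeriv_snd]; exact (hB 0 N δ hδ u x hu hx).trans (le_abs_self _)) hw
    simpa only [iteratedDeriv_snd] using h2
  have hu1 : ∀ l, |dY^[l] (f δ) (u, 0) - ∑ k ∈ Finset.range N,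
      dX^[k] (dY^[l] (f δ)) 0 / (k.factorial : ℝ) * u ^ k| ≤ |B N l| * |u| ^ N := by
    intro l
    have h1 : ContDiffOn ℝ ∞ (fun u => dY^[l] (f δ) (u, 0)) (Ioo (-r) r) :=
      (contDiffOn_iterate_dY (Or.inl rfl) Metric.isOpen_ball hfδ l).comp
        (f := fun u : ℝ => (u, (0 : ℝ))) (by fun_prop) fun u hu =>
        hball _ _ (abs_lt.2 hu) (by simpa using hr0.trans_lt hr)
    have h2 := abs_sub_taylor_le (C := |B N l|) hr N h1 (fun x hx => by
      rw [iteratedDeriv_fst (dY^[l] (f δ))]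
      exact (hB N l δ hδ x 0 hx (by simpa using hr0)).trans (le_abs_self _)) hu
    simpa only [iteratedDeriv_fst (dY^[l] (f δ)), Prod.mk_zero_zero] using h2
  have hsplit : f δ (u, w) - ∑ l ∈ Finset.range N, ∑ k ∈ Finset.range N,
        mixedCoeff (f δ) k l * (u ^ k * w ^ l) =
      (f δ (u, w) - ∑ l ∈ Finset.range N, dY^[l] (f δ) (u, 0) / (l.factorial : ℝ) * w ^ l) +
      ∑ l ∈ Finset.range N, (dY^[l] (f δ) (u, 0) - ∑ k ∈ Finset.range N,
        dX^[k] (dY^[l] (f δ)) 0 / (k.factorial : ℝ) * u ^ k) * (w ^ l / (l.factorial : ℝ)) := by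
    have h1 : ∀ l, (dY^[l] (f δ) (u, 0) - ∑ k ∈ Finset.range N,
        dX^[k] (dY^[l] (f δ)) 0 / (k.factorial : ℝ) * u ^ k) * (w ^ l / (l.factorial : ℝ)) =
        dY^[l] (f δ) (u, 0) / (l.factorial : ℝ) * w ^ l - ∑ k ∈ Finset.range N,
          mixedCoeff (f δ) k l * (u ^ k * w ^ l) := by
      intro l
      rw [sub_mul, Finset.sum_mul]
      congr 1
      · ring
      · refine Finset.sum_congr rfl fun k _ => ?_
        rw [mixedCoeff, div_mul_eq_mul_div, div_mul_div_comm]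
        ring
    simp only [h1, Finset.sum_sub_distrib]
    ring
  rw [hsplit]
  refine (abs_add_le _ _).trans ?_
  have h3 : |∑ l ∈ Finset.range N, (dY^[l] (f δ) (u, 0) - ∑ k ∈ Finset.range N,
      dX^[k] (dY^[l] (f δ)) 0 / (k.factorial : ℝ) * u ^ k) * (w ^ l / (l.factorial : ℝ))| ≤
      C' * |u| ^ N := by
    refine (Finset.abs_sum_le_sum_abs _ _).trans ?_
    rw [hC', Finset.sum_mul]
    refine Finset.sum_le_sum fun l _ => ?_
    rw [abs_mul, abs_div, abs_pow, Nat.abs_cast]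
    calc _ ≤ |B N l| * |u| ^ N * (r' ^ l / (l.factorial : ℝ)) := by
          gcongr
          exact hu1 l
      _ = _ := by ring
  nlinarith [mul_nonneg (abs_nonneg (B 0 N)) (pow_nonneg (abs_nonneg u) N),
    mul_nonneg hC'0 (pow_nonneg (abs_nonneg w) N)]

end UniformTaylor

end Melnikov

/-! ### The asymptotic expansion -/

namespace Melnikov

open MeasureTheory

theorem sum_range_two_mul_of_odd_eq_zero {g : ℕ → ℝ} (hg : ∀ k, Odd k → g k = 0) (n : ℕ) :
    ∑ k ∈ Finset.range (2 * n), g k = ∑ i ∈ Finset.range n, g (2 * i) := by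
  induction n with
  | zero => simp
  | succ n ih =>
    rw [show 2 * (n + 1) = 2 * n + 1 + 1 by ring, Finset.sum_range_succ, Finset.sum_range_succ,
      Finset.sum_range_succ, ih, hg _ (odd_two_mul_add_one n), add_zero]

/-- The contribution of the monomial `u ^ (2 i) * w ^ (2 j)` of `f` to the expansion of
`levelIntegral p h f`. -/
noncomputable def levelTerm (p : ℕ) (f : ℝ × ℝ → ℝ) (i j : ℕ) : ℝ :=
  4 / (2 * j + 1) * mixedCoeff f (2 * i) (2 * j) * betaInt p i j

/-- The coefficients of the expansion of `levelIntegral p h f` in powers of `h ^ (1 / p)`. -/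
noncomputable def levelCoeff (p : ℕ) (f : ℝ × ℝ → ℝ) (l : ℕ) : ℝ :=
  ∑ ij ∈ (Finset.range (l + 1) ×ˢ Finset.range (l + 1)).filter (fun ij => ij.1 + p * ij.2 = l),
    levelTerm p f ij.1 ij.2

/-- Regrouping by the value of `i + p j`. Since `p ≥ 1`, this value bounds both indices, so the
differing index ranges are harmless. -/
theorem sum_levelCoeff {p : ℕ} (hp : 1 ≤ p) (f : ℝ × ℝ → ℝ) (x : ℕ → ℝ) (n : ℕ) :
    ∑ l ∈ Finset.range n, levelCoeff p f l * x l =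
      ∑ ij ∈ (Finset.range n ×ˢ Finset.range n).filter (fun ij => ij.1 + p * ij.2 < n),
        levelTerm p f ij.1 ij.2 * x (ij.1 + p * ij.2) := by
  rw [← Finset.sum_fiberwise_of_maps_to
    (s := (Finset.range n ×ˢ Finset.range n).filter (fun ij => ij.1 + p * ij.2 < n))
    (t := Finset.range n) (g := fun ij => ij.1 + p * ij.2)
    (fun ij hij => Finset.mem_range.2 (Finset.mem_filter.1 hij).2)]
  refine Finset.sum_congr rfl fun l hl => ?_
  rw [levelCoeff, Finset.sum_mul, Finset.filter_filter]
  have hl' := Finset.mem_range.1 hl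
  refine Finset.sum_congr ?_ fun ij hij => ?_
  · ext ij
    simp only [Finset.mem_filter, Finset.mem_product, Finset.mem_range]
    have : ij.2 ≤ p * ij.2 := Nat.le_mul_of_pos_left _ hp
    constructor <;> rintro ⟨_, h2⟩ <;> refine ⟨⟨?_, ?_⟩, ?_⟩ <;> omega
  · rw [(Finset.mem_filter.1 hij).2.2]

theorem setIntegral_monomial {p : ℕ} (hp : 1 ≤ p) {h : ℝ} (h0 : 0 < h) (k l : ℕ) :
    ∫ z in levelRegion p h, z.1 ^ k * z.2 ^ l =
      levelIntegral p h (fun z => z.1 ^ k * z.2 ^ l) :=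
  (levelIntegral_eq_setIntegral hp h0 (by fun_prop)).symm

theorem integrableOn_monomial {p : ℕ} (hp : 1 ≤ p) {h : ℝ} (h0 : 0 < h) (k l : ℕ) :
    IntegrableOn (fun z : ℝ × ℝ => z.1 ^ k * z.2 ^ l) (levelRegion p h) :=
  ContinuousOn.integrableOn_compact (isCompact_levelRegion hp h0) (by fun_prop)

theorem setIntegral_taylorPolynomial {p : ℕ} (hp : 1 ≤ p) {h : ℝ} (h0 : 0 < h) (f : ℝ × ℝ → ℝ)
    (n : ℕ) :
    ∫ z in levelRegion p h, ∑ l ∈ Finset.range (2 * n), ∑ k ∈ Finset.range (2 * n),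
        mixedCoeff f k l * (z.1 ^ k * z.2 ^ l) =
      h ^ (((p : ℝ) + 1) / (2 * p)) * ∑ ij ∈ Finset.range n ×ˢ Finset.range n,
        levelTerm p f ij.1 ij.2 * h ^ (((ij.1 + p * ij.2 : ℕ) : ℝ) / p) := by
  have hint : ∀ k l, IntegrableOn (fun z : ℝ × ℝ => mixedCoeff f k l * (z.1 ^ k * z.2 ^ l))
      (levelRegion p h) := fun k l => (integrableOn_monomial hp h0 k l).const_mul _
  rw [integral_finsetSum _ fun l _ => integrable_finsetSum _ fun k _ => hint k l]
  simp only [integral_finsetSum _ fun k _ => hint k _, integral_const_mul,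
    setIntegral_monomial hp h0]
  rw [sum_range_two_mul_of_odd_eq_zero fun l hl => by
    simp [levelIntegral_monomial_of_odd_snd h hl]]
  rw [Finset.mul_sum, Finset.sum_product_right]
  refine Finset.sum_congr rfl fun j _ => ?_
  rw [sum_range_two_mul_of_odd_eq_zero fun k hk => by
    simp [levelIntegral_monomial_of_odd_fst h hk]]
  refine Finset.sum_congr rfl fun i _ => ?_
  rw [levelIntegral_monomial hp i j h0, levelTerm]
  ring

theorem sqrt_le_rpow {p : ℕ} (hp : 1 ≤ p) {h : ℝ} (h0 : 0 < h) (h1 : h ≤ 1) :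
    √h ≤ h ^ (1 / (2 * (p : ℝ))) := by
  have hp' : (1 : ℝ) ≤ p := by exact_mod_cast hp
  rw [Real.sqrt_eq_rpow]
  exact Real.rpow_le_rpow_of_exponent_ge h0 h1
    (one_div_le_one_div_of_le (by norm_num) (by linarith))

theorem rpow_inv_two_mul_lt {p : ℕ} (hp : 1 ≤ p) {h r : ℝ} (h0 : 0 < h) (hr : 0 < r)
    (hh : h < r ^ (2 * p)) : h ^ (1 / (2 * (p : ℝ))) < r := by
  have h1 : (h ^ (1 / (2 * (p : ℝ)))) ^ (2 * p) < r ^ (2 * p) := by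
    rwa [rpow_inv_two_mul_pow hp h0]
  exact lt_of_pow_lt_pow_left₀ _ hr.le h1

theorem rpow_inv_two_mul_pow_two_mul {p : ℕ} (hp : 1 ≤ p) {h : ℝ} (h0 : 0 < h) (n : ℕ) :
    (h ^ (1 / (2 * (p : ℝ)))) ^ (2 * n) = h ^ ((n : ℝ) / p) := by
  have hp' : (0 : ℝ) < p := by exact_mod_cast hp
  rw [← Real.rpow_natCast, ← Real.rpow_mul h0.le]
  congr 1
  push_cast
  field_simp

theorem abs_le_of_mem_levelRegion {p : ℕ} (hp : 1 ≤ p) {h : ℝ} (h0 : 0 < h) (h1 : h ≤ 1)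
    {z : ℝ × ℝ} (hz : z ∈ levelRegion p h) :
    |z.1| ≤ h ^ (1 / (2 * (p : ℝ))) ∧ |z.2| ≤ h ^ (1 / (2 * (p : ℝ))) :=
  ⟨abs_le.2 (levelRegion_subset hp h0 hz).1,
    (abs_le.2 (levelRegion_subset hp h0 hz).2).trans (sqrt_le_rpow hp h0 h1)⟩

theorem mk_mem_ball_zero {a b r : ℝ} (ha : |a| < r) (hb : |b| < r) :
    (a, b) ∈ Metric.ball (0 : ℝ × ℝ) r := by
  rw [mem_ball_zero_iff, Prod.norm_def]
  exact max_lt ha hb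

variable {E : Type*} [NormedAddCommGroup E] [NormedSpace ℝ E]

/-- On the region both coordinates are at most `h ^ (1 / (2 p))` when `h ≤ 1`, so a Taylor remainder
of order `2 n` is `O(h ^ (n / p))`, and the area supplies the prefactor. -/
theorem exists_levelIntegral_expansion {p : ℕ} (hp : 1 ≤ p) {f : E → ℝ × ℝ → ℝ} {V D : Set E}
    {r : ℝ} (hr : 0 < r) (hV : IsOpen V) (hD : IsCompact D) (hDV : D ⊆ V)
    (hf : ContDiffOn ℝ ∞ (fun x : (ℝ × ℝ) × E => f x.2 x.1) (Metric.ball 0 r ×ˢ V)) (n : ℕ) :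
    ∃ C : ℝ, ∃ η > 0, ∀ δ ∈ D, ∀ h ∈ Ioo 0 η,
      |levelIntegral p h (f δ) - h ^ (((p : ℝ) + 1) / (2 * p)) *
          ∑ l ∈ Finset.range n, levelCoeff p (f δ) l * h ^ ((l : ℝ) / p)| ≤
        C * (h ^ (((p : ℝ) + 1) / (2 * p)) * h ^ ((n : ℝ) / p)) := by
  have hp' : (0 : ℝ) < p := by exact_mod_cast hp
  have hr2 : r / 2 < r := by linarith
  obtain ⟨C, hC⟩ := exists_abs_sub_taylor_le (by linarith : 0 ≤ r / 2) hr2 hV hD hDV hf (2 * n)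
  choose B hB using fun k l => exists_bound_iterate hr2 hV hD hDV hf k l
  set S := Finset.range n ×ˢ Finset.range n with hS
  set K : ℕ × ℕ → ℝ := fun ij => 4 / (2 * ij.2 + 1) *
    (|B (2 * ij.1) (2 * ij.2)| / ((2 * ij.1).factorial * (2 * ij.2).factorial)) *
      |betaInt p ij.1 ij.2| with hK
  have hK0 : ∀ ij, 0 ≤ K ij := fun ij => by positivity
  have hterm : ∀ δ ∈ D, ∀ ij : ℕ × ℕ, |levelTerm p (f δ) ij.1 ij.2| ≤ K ij := by
    intro δ hδ ij
    rw [levelTerm, mixedCoeff, hK, abs_mul, abs_mul, abs_div, abs_div]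
    have h1 : |dX^[2 * ij.1] (dY^[2 * ij.2] (f δ)) 0| ≤ |B (2 * ij.1) (2 * ij.2)| :=
      (hB _ _ δ hδ 0 0 (by rw [abs_zero]; positivity) (by rw [abs_zero]; positivity)).trans (le_abs_self _)
    have h2 : |(2 * (ij.2 : ℝ) + 1)| = 2 * ij.2 + 1 := abs_of_pos (by positivity)
    have h3 : |(((2 * ij.1).factorial : ℝ) * ((2 * ij.2).factorial : ℝ))| =
      (2 * ij.1).factorial * (2 * ij.2).factorial := abs_of_pos (by positivity)
    have h4 : |(4 : ℝ)| = 4 := by norm_num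
    rw [h2, h3, h4]
    refine mul_le_mul_of_nonneg_right (mul_le_mul_of_nonneg_left ?_ (by positivity)) (abs_nonneg _)
    exact div_le_div_of_nonneg_right h1 (by positivity)
  -- The first part bounds the remainder: area constant `4`, and `2` for the two powers in Taylor's
  -- estimate. The sum bounds the terms of the polynomial with `i, j < n` but `i + p j ≥ n`.
  refine ⟨4 * (|C| * 2) + ∑ ij ∈ S, K ij, min 1 ((r / 2) ^ (2 * p)), by positivity,
    fun δ hδ h hh => ?_⟩
  have h0 := hh.1
  have hh1 : h ≤ 1 := hh.2.le.trans (min_le_left _ _)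
  set A := h ^ (((p : ℝ) + 1) / (2 * p)) with hA
  have hA0 : 0 ≤ A := by positivity
  set a := h ^ (1 / (2 * (p : ℝ))) with ha
  have ha0 : 0 ≤ a := by positivity
  have har : a ≤ r / 2 := (rpow_inv_two_mul_lt hp h0 (by linarith)
    (hh.2.trans_le (min_le_right _ _))).le
  have hcont : ContinuousOn (f δ) (levelRegion p h) := by
    refine (contDiffOn_of_uncurry hf (hDV hδ)).continuousOn.mono fun z hz => ?_
    have h2 := abs_le_of_mem_levelRegion hp h0 hh1 hz
    exact mk_mem_ball_zero (by linarith [h2.1]) (by linarith [h2.2])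
  set T : ℝ × ℝ → ℝ := fun z => ∑ l ∈ Finset.range (2 * n), ∑ k ∈ Finset.range (2 * n),
        mixedCoeff (f δ) k l * (z.1 ^ k * z.2 ^ l) with hT
  have hTc : ContinuousOn T (levelRegion p h) := by fun_prop
  have hcpt := isCompact_levelRegion hp h0
  have hrem : |levelIntegral p h (f δ) - ∫ z in levelRegion p h, T z| ≤
      4 * (|C| * (2 * h ^ ((n : ℝ) / p))) * A := by
    rw [levelIntegral_eq_setIntegral hp h0 hcont,
      ← integral_sub (hcont.integrableOn_compact hcpt) (hTc.integrableOn_compact hcpt)]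
    refine abs_setIntegral_levelRegion_le hp h0 fun z hz => ?_
    have h2 := abs_le_of_mem_levelRegion hp h0 hh1 hz
    have h3 := hC δ hδ z.1 z.2 (h2.1.trans har) (h2.2.trans har)
    refine h3.trans ?_
    have h4 : |z.1| ^ (2 * n) + |z.2| ^ (2 * n) ≤ 2 * h ^ ((n : ℝ) / p) := by
      rw [← rpow_inv_two_mul_pow_two_mul hp h0 n, two_mul (_ ^ (2 * n))]
      exact add_le_add (pow_le_pow_left₀ (abs_nonneg _) h2.1 _)
        (pow_le_pow_left₀ (abs_nonneg _) h2.2 _)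
    exact mul_le_mul (le_abs_self _) h4 (by positivity) (abs_nonneg _)
  have hpoly := setIntegral_taylorPolynomial hp h0 (f δ) n
  have hsum := sum_levelCoeff hp (f δ) (fun l => h ^ ((l : ℝ) / p)) n
  have hsplit := Finset.sum_filter_add_sum_filter_not S (fun ij => ij.1 + p * ij.2 < n)
    (fun ij => levelTerm p (f δ) ij.1 ij.2 * h ^ (((ij.1 + p * ij.2 : ℕ) : ℝ) / p))
  have htail : |∑ ij ∈ S.filter (fun ij => ¬ ij.1 + p * ij.2 < n),
      levelTerm p (f δ) ij.1 ij.2 * h ^ (((ij.1 + p * ij.2 : ℕ) : ℝ) / p)| ≤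
      (∑ ij ∈ S, K ij) * h ^ ((n : ℝ) / p) := by
    refine (Finset.abs_sum_le_sum_abs _ _).trans ?_
    rw [Finset.sum_mul]
    refine (Finset.sum_le_sum fun ij hij => ?_).trans
      (Finset.sum_le_sum_of_subset_of_nonneg (Finset.filter_subset _ _) fun ij _ _ =>
        mul_nonneg (hK0 ij) (by positivity))
    have hge : n ≤ ij.1 + p * ij.2 := not_lt.1 (Finset.mem_filter.1 hij).2
    rw [abs_mul, abs_of_nonneg (by positivity : 0 ≤ h ^ (((ij.1 + p * ij.2 : ℕ) : ℝ) / p))]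
    refine mul_le_mul (hterm δ hδ ij) ?_ (by positivity) (hK0 ij)
    refine Real.rpow_le_rpow_of_exponent_ge h0 hh1 ?_
    gcongr
  have heq : levelIntegral p h (f δ) - A *
      ∑ l ∈ Finset.range n, levelCoeff p (f δ) l * h ^ ((l : ℝ) / p) =
      (levelIntegral p h (f δ) - ∫ z in levelRegion p h, T z) +
      A * ∑ ij ∈ S.filter (fun ij => ¬ ij.1 + p * ij.2 < n),
      levelTerm p (f δ) ij.1 ij.2 * h ^ (((ij.1 + p * ij.2 : ℕ) : ℝ) / p) := by
    rw [hT, hpoly, hsum, ← hsplit]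
    ring
  rw [heq]
  refine (abs_add_le _ _).trans ((add_le_add hrem ?_).trans_eq
    (b := 4 * (|C| * (2 * h ^ ((n : ℝ) / p))) * A +
      A * ((∑ ij ∈ S, K ij) * h ^ ((n : ℝ) / p))) (by ring))
  rw [abs_mul, abs_of_nonneg hA0]
  exact mul_le_mul_of_nonneg_left htail hA0

end Melnikov

namespace Melnikov

/-! ### Convergent double Taylor series -/

section DoubleSeries

theorem map_piecewise_smul_smul {X : Type*} [NormedAddCommGroup X] [NormedSpace ℝ X] {n : ℕ}
    (q : ContinuousMultilinearMap ℝ (fun _ : Fin n => X) ℝ) (s : Finset (Fin n)) (u w : ℝ)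
    (e₁ e₂ : X) :
    q (s.piecewise (fun _ => u • e₁) fun _ => w • e₂) =
      u ^ s.card * w ^ (n - s.card) * q (s.piecewise (fun _ => e₁) fun _ => e₂) := by
  have h1 : (s.piecewise (fun _ => u • e₁) fun _ => w • e₂) = fun i =>
      (s.piecewise (fun _ => u) (fun _ => w) i) •
        (s.piecewise (fun _ => e₁) (fun _ => e₂) i : X) := by
    funext i
    by_cases hi : i ∈ s <;> simp [hi]
  rw [h1, q.map_smul_univ, Finset.prod_piecewise, smul_eq_mul]
  congr 1
  simp [Finset.card_sdiff, Finset.prod_const]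

theorem norm_piecewise_le {X : Type*} [NormedAddCommGroup X] [NormedSpace ℝ X] {n : ℕ}
    (q : ContinuousMultilinearMap ℝ (fun _ : Fin n => X) ℝ) (s : Finset (Fin n)) {e₁ e₂ : X}
    (h₁ : ‖e₁‖ ≤ 1) (h₂ : ‖e₂‖ ≤ 1) :
    |q (s.piecewise (fun _ => e₁) fun _ => e₂)| ≤ ‖q‖ := by
  refine (q.le_opNorm _).trans (mul_le_of_le_one_right (norm_nonneg _) ?_)
  refine Finset.prod_le_one (fun _ _ => norm_nonneg _) fun i _ => ?_
  by_cases hi : i ∈ s <;> simp [hi, h₁, h₂]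

/-- A power series restricted to a plane is a double series in the two coordinates. -/
theorem exists_hasSum_of_hasFPowerSeriesOnBall {X : Type*} [NormedAddCommGroup X]
    [NormedSpace ℝ X] {g : X → ℝ} {q : FormalMultilinearSeries ℝ X ℝ} {x : X} {ρ : ℝ}
    (hg : HasFPowerSeriesOnBall g q x (ENNReal.ofReal ρ)) {e₁ e₂ : X} (h₁ : ‖e₁‖ ≤ 1)
    (h₂ : ‖e₂‖ ≤ 1) :
    ∃ c : ℕ → ℕ → ℝ, ∀ u w : ℝ, |u| + |w| < ρ →
      HasSum (fun kl : ℕ × ℕ => c kl.1 kl.2 * (u ^ kl.1 * w ^ kl.2))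
        (g (x + (u • e₁ + w • e₂))) := by
  -- Multilinear expansion of `q n` at `u e₁ + w e₂`: the finite set records the slots filled with
  -- `e₁`.
  set Q : (Σ n, Finset (Fin n)) → ℝ := fun b => q b.1 (b.2.piecewise (fun _ => e₁) fun _ => e₂)
    with hQ
  set m : (Σ n, Finset (Fin n)) → ℕ × ℕ := fun b => (b.2.card, b.1 - b.2.card) with hm
  refine ⟨fun k l => ∑' b : m ⁻¹' {(k, l)}, Q b, fun u w huw => ?_⟩
  have hρ : 0 < ρ := lt_of_le_of_lt (by positivity) huw
  set F : (Σ n, Finset (Fin n)) → ℝ := fun b => u ^ b.2.card * w ^ (b.1 - b.2.card) * Q b with hF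
  -- The binomial formula over subsets produces `(|u| + |w|) ^ n`, hence the domain `|u| + |w| < ρ`.
  have hfin : ∀ n, ∑ s : Finset (Fin n), ‖F ⟨n, s⟩‖ ≤ ‖q n‖ * (|u| + |w|) ^ n := by
    intro n
    have h3 := Fintype.sum_pow_mul_eq_add_pow (Fin n) |u| |w|
    rw [Fintype.card_fin] at h3
    rw [← h3, Finset.mul_sum]
    refine Finset.sum_le_sum fun s _ => ?_
    simp only [hF, norm_mul, norm_pow, Real.norm_eq_abs]
    rw [mul_comm]
    exact mul_le_mul_of_nonneg_right (norm_piecewise_le (q n) s h₁ h₂) (by positivity)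
  have hsummable : Summable F := by
    refine Summable.of_norm ((summable_sigma_of_nonneg fun _ => norm_nonneg _).2 ⟨fun n =>
      (hasSum_fintype _).summable, ?_⟩)
    have hr : (((|u| + |w|).toNNReal : NNReal) : ENNReal) < q.radius :=
      lt_of_lt_of_le ((ENNReal.ofReal_lt_ofReal_iff hρ).2 huw) hg.r_le
    have h4 := q.summable_norm_mul_pow hr
    rw [Real.coe_toNNReal _ (by positivity)] at h4
    refine Summable.of_nonneg_of_le (fun n => tsum_nonneg fun _ => norm_nonneg _) (fun n => ?_) h4
    rw [tsum_fintype]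
    exact hfin n
  have hy : u • e₁ + w • e₂ ∈ Metric.eball (0 : X) (ENNReal.ofReal ρ) := by
    rw [Metric.mem_eball, edist_zero_right, ← ofReal_norm]
    refine (ENNReal.ofReal_lt_ofReal_iff hρ).2 (lt_of_le_of_lt ?_ huw)
    refine (norm_add_le _ _).trans (add_le_add ?_ ?_) <;> rw [norm_smul, Real.norm_eq_abs]
    · exact mul_le_of_le_one_right (abs_nonneg _) h₁
    · exact mul_le_of_le_one_right (abs_nonneg _) h₂
  have hsum : HasSum F (g (x + (u • e₁ + w • e₂))) := by
    refine HasSum.sigma_of_hasSum (hg.hasSum hy) (fun n => ?_) hsummable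
    have h5 : (q n fun _ => u • e₁ + w • e₂) = ∑ s : Finset (Fin n), F ⟨n, s⟩ := by
      have h6 := (q n).map_add_univ (fun _ => u • e₁) fun _ => w • e₂
      refine h6.trans (Finset.sum_congr rfl fun s _ => ?_)
      exact map_piecewise_smul_smul (q n) s u w e₁ e₂
    rw [h5]
    exact hasSum_fintype _
  refine (hsum.tsum_fiberwise m).congr_fun ?_
  rintro ⟨k, l⟩
  rw [mul_comm, ← tsum_mul_left]
  refine tsum_congr fun b => ?_
  have hb : m b.1 = (k, l) := b.2
  have hb1 : b.1.2.card = k := congrArg Prod.fst hb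
  have hb2 : b.1.1 - b.1.2.card = l := congrArg Prod.snd hb
  rw [hF]
  simp only [hb2]
  rw [hb1]

theorem iteratedDeriv_zero_of_hasSum {g : ℝ → ℝ} {a : ℕ → ℝ}
    (hg : ∀ᶠ x in 𝓝 0, HasSum (fun n => a n * x ^ n) (g x)) (n : ℕ) :
    iteratedDeriv n g 0 = n.factorial * a n := by
  have h1 : HasFPowerSeriesAt g (FormalMultilinearSeries.ofScalars ℝ a) 0 := by
    rw [hasFPowerSeriesAt_iff]
    filter_upwards [hg] with x hx
    simpa [FormalMultilinearSeries.coeff_ofScalars, mul_comm] using hx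
  have h2 := h1.eq_formalMultilinearSeries h1.analyticAt.hasFPowerSeriesAt
  have h3 := congrFun (FormalMultilinearSeries.ofScalars_series_injective ℝ ℝ h2) n
  have : ((n.factorial : ℕ) : ℝ) ≠ 0 := by positivity
  rw [h3]
  field_simp

/-- Uniqueness of power series in one variable is applied first in `w`, with `u` fixed, and then in
`u` to the resulting coefficient. -/
theorem eq_mixedCoeff_of_hasSum {f : ℝ × ℝ → ℝ} {c : ℕ → ℕ → ℝ} {ρ : ℝ} (hρ : 0 < ρ)
    (hf : ∀ u w : ℝ, |u| + |w| < ρ →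
      HasSum (fun kl : ℕ × ℕ => c kl.1 kl.2 * (u ^ kl.1 * w ^ kl.2)) (f (u, w))) (k l : ℕ) :
    c k l = mixedCoeff f k l := by
  have hswap : ∀ u w : ℝ, |u| + |w| < ρ →
      HasSum (fun lk : ℕ × ℕ => c lk.2 lk.1 * (u ^ lk.2 * w ^ lk.1)) (f (u, w)) := fun u w huw =>
    (Equiv.prodComm ℕ ℕ).hasSum_iff.2 (hf u w huw)
  have hev : ∀ᶠ x : ℝ in 𝓝 0, |x| < ρ / 2 := by
    have : Tendsto (fun x : ℝ => |x|) (𝓝 0) (𝓝 0) := by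
      simpa using (continuous_abs.tendsto (0 : ℝ))
    exact this.eventually (gt_mem_nhds (by linarith))
  have hY : ∀ u : ℝ, |u| < ρ / 2 → ∀ l, dY^[l] f (u, 0) =
      l.factorial * ∑' k, c k l * u ^ k := by
    intro u hu l
    rw [← iteratedDeriv_snd]
    refine iteratedDeriv_zero_of_hasSum (a := fun l => ∑' k, c k l * u ^ k) ?_ l
    filter_upwards [hev] with w hw
    have h1 := hswap u w (by linarith)
    refine (h1.prod_fiberwise fun b => (h1.summable.prod_factor b).hasSum).congr_fun fun b => ?_
    rw [← tsum_mul_right]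
    exact tsum_congr fun k => by ring
  have hX : ∀ᶠ u : ℝ in 𝓝 0,
      HasSum (fun k => l.factorial * c k l * u ^ k) (dY^[l] f (u, 0)) := by
    filter_upwards [hev] with u hu
    rw [hY u hu l]
    -- Any nonzero admissible `w` would do: it extracts the summability of a single row of the
    -- double series.
    have h1 := (hswap u (ρ / 4) (by
      rw [abs_of_pos (by linarith : 0 < ρ / 4)]; linarith)).summable.prod_factor l
    have h2 : Summable fun k => c k l * u ^ k := by
      have h3 : (fun k => c k l * (u ^ k * (ρ / 4) ^ l)) =
        fun k => c k l * u ^ k * (ρ / 4) ^ l := by funext k; ring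
      simp only at h1
      rw [h3] at h1
      exact (summable_mul_right_iff (by positivity)).1 h1
    refine (h2.hasSum.mul_left (l.factorial : ℝ)).congr_fun fun k => ?_
    ring
  have h4 := iteratedDeriv_zero_of_hasSum hX k
  rw [iteratedDeriv_fst (dY^[l] f), Prod.mk_zero_zero] at h4
  have : ((k.factorial : ℕ) : ℝ) ≠ 0 := by positivity
  have : ((l.factorial : ℕ) : ℝ) ≠ 0 := by positivity
  rw [mixedCoeff, h4]
  field_simp

variable {E : Type*} [NormedAddCommGroup E] [NormedSpace ℝ E]

/-- The double Taylor series at the origin converges with a radius that is locally uniform in the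
parameter. -/
theorem exists_radius_hasSum_mixedCoeff {f : E → ℝ × ℝ → ℝ} {V D : Set E} {r : ℝ} (hr : 0 < r)
    (hV : IsOpen V) (hD : IsCompact D) (hDV : D ⊆ V)
    (hf : ContDiffOn ℝ ω (fun x : (ℝ × ℝ) × E => f x.2 x.1) (Metric.ball 0 r ×ˢ V)) :
    ∃ ρ > 0, ∀ δ ∈ D, ∀ u w : ℝ, |u| + |w| < ρ →
      HasSum (fun kl : ℕ × ℕ => mixedCoeff (f δ) kl.1 kl.2 * (u ^ kl.1 * w ^ kl.2))
        (f δ (u, w)) := by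
  suffices hloc : ∃ ρ > 0, ∀ δ ∈ D, ∃ q, HasFPowerSeriesOnBall
      (fun x : (ℝ × ℝ) × E => f x.2 x.1) q ((0 : ℝ × ℝ), δ) (ENNReal.ofReal ρ) by
    obtain ⟨ρ, hρ, hq⟩ := hloc
    refine ⟨ρ, hρ, fun δ hδ => ?_⟩
    obtain ⟨q, hq⟩ := hq δ hδ
    obtain ⟨c, hc⟩ := exists_hasSum_of_hasFPowerSeriesOnBall hq
      (e₁ := ((1, 0), 0)) (e₂ := ((0, 1), 0)) (by simp [Prod.norm_def]) (by simp [Prod.norm_def])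
    have hc' : ∀ u w : ℝ, |u| + |w| < ρ →
        HasSum (fun kl : ℕ × ℕ => c kl.1 kl.2 * (u ^ kl.1 * w ^ kl.2)) (f δ (u, w)) := by
      intro u w huw
      simpa using hc u w huw
    intro u w huw
    simpa only [eq_mixedCoeff_of_hasSum hρ hc'] using hc' u w huw
  refine hD.induction_on (p := fun s => ∃ ρ > 0, ∀ δ ∈ s, ∃ q, HasFPowerSeriesOnBall
      (fun x : (ℝ × ℝ) × E => f x.2 x.1) q ((0 : ℝ × ℝ), δ) (ENNReal.ofReal ρ)) ?_ ?_ ?_ ?_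
  · exact ⟨1, one_pos, by simp⟩
  · rintro s t hst ⟨ρ, hρ, h⟩
    exact ⟨ρ, hρ, fun δ hδ => h δ (hst hδ)⟩
  · rintro s t ⟨ρ, hρ, h⟩ ⟨ρ', hρ', h'⟩
    refine ⟨min ρ ρ', lt_min hρ hρ', ?_⟩
    have hpos : 0 < ENNReal.ofReal (min ρ ρ') := ENNReal.ofReal_pos.2 (lt_min hρ hρ')
    rintro δ (hδ | hδ)
    · obtain ⟨q, hq⟩ := h δ hδ
      exact ⟨q, hq.mono hpos (ENNReal.ofReal_le_ofReal (min_le_left _ _))⟩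
    · obtain ⟨q, hq⟩ := h' δ hδ
      exact ⟨q, hq.mono hpos (ENNReal.ofReal_le_ofReal (min_le_right _ _))⟩
  · intro δ₀ hδ₀
    have han : AnalyticAt ℝ (fun x : (ℝ × ℝ) × E => f x.2 x.1) (0, δ₀) :=
      (hf.contDiffAt ((Metric.isOpen_ball.prod hV).mem_nhds
        ⟨Metric.mem_ball_self hr, hDV hδ₀⟩)).analyticAt
    obtain ⟨q, R, hq⟩ := han
    -- With radius at least `2 ρ` at `δ₀`, recentring at a point closer than `ρ` leaves radius at
    -- least `ρ`; compactness then gives a common radius.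
    obtain ⟨ρ, hρ, hρR⟩ : ∃ ρ : ℝ, 0 < ρ ∧ ENNReal.ofReal (ρ + ρ) ≤ R := by
      obtain ⟨t, ht0, htR⟩ := ENNReal.lt_iff_exists_nnreal_btwn.1 hq.r_pos
      refine ⟨t / 2, half_pos (by exact_mod_cast ht0), ?_⟩
      rw [add_halves, ENNReal.ofReal_coe_nnreal]
      exact htR.le
    have hq' := hq.mono (ENNReal.ofReal_pos.2 (by linarith)) hρR
    refine ⟨Metric.ball δ₀ ρ, mem_nhdsWithin_of_mem_nhds (Metric.ball_mem_nhds _ hρ), ρ, hρ,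
      fun δ hδ => ?_⟩
    have hn : ‖((0 : ℝ × ℝ), δ - δ₀)‖ < ρ := by
      simpa [Prod.norm_def, dist_eq_norm, hρ] using hδ
    have hn' : (‖((0 : ℝ × ℝ), δ - δ₀)‖₊ : ENNReal) = ENNReal.ofReal ‖((0 : ℝ × ℝ), δ - δ₀)‖ :=
      (ofReal_norm _).symm
    have h1 := hq'.changeOrigin (y := ((0 : ℝ × ℝ), δ - δ₀)) (by
      rw [hn']; exact (ENNReal.ofReal_lt_ofReal_iff (by linarith)).2 (by linarith))
    have e : ((0 : ℝ × ℝ), δ₀) + ((0 : ℝ × ℝ), δ - δ₀) = (0, δ) := by simp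
    rw [e, hn', ← ENNReal.ofReal_sub _ (norm_nonneg _)] at h1
    exact ⟨_, h1.mono (ENNReal.ofReal_pos.2 hρ) (ENNReal.ofReal_le_ofReal (by linarith))⟩

end DoubleSeries

end Melnikov

/-! ### Termwise integration and analyticity -/

namespace Melnikov

open MeasureTheory

/-- Every term is dominated on the region by its value at the corner `(a, a)` with `a = h ^ (1 / (2
p))`, where the double series converges absolutely because `2 a < ρ`. -/
theorem hasSum_setIntegral_monomial {p : ℕ} (hp : 1 ≤ p) {f : ℝ × ℝ → ℝ} {ρ h : ℝ}
    (hf : ∀ u w : ℝ, |u| + |w| < ρ →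
      HasSum (fun kl : ℕ × ℕ => mixedCoeff f kl.1 kl.2 * (u ^ kl.1 * w ^ kl.2)) (f (u, w)))
    (h0 : 0 < h) (h1 : h ≤ 1) (hh : 2 * h ^ (1 / (2 * (p : ℝ))) < ρ)
    (hcont : ContinuousOn f (levelRegion p h)) :
    HasSum (fun kl : ℕ × ℕ =>
        mixedCoeff f kl.1 kl.2 * levelIntegral p h (fun z => z.1 ^ kl.1 * z.2 ^ kl.2))
      (levelIntegral p h f) := by
  set a := h ^ (1 / (2 * (p : ℝ))) with ha
  have ha0 : 0 ≤ a := by positivity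
  have hsum := (hf a a (by rw [abs_of_nonneg ha0]; linarith)).summable.norm
  have hbd : ∀ z ∈ levelRegion p h, |z.1| ≤ a ∧ |z.2| ≤ a := fun z hz =>
    abs_le_of_mem_levelRegion hp h0 h1 hz
  have hint : ∀ kl : ℕ × ℕ, Integrable (fun z : ℝ × ℝ => mixedCoeff f kl.1 kl.2 *
      (z.1 ^ kl.1 * z.2 ^ kl.2)) (volume.restrict (levelRegion p h)) := fun kl =>
    (integrableOn_monomial hp h0 kl.1 kl.2).const_mul _
  have hs : Summable fun kl : ℕ × ℕ => ∫ z in levelRegion p h,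
      ‖mixedCoeff f kl.1 kl.2 * (z.1 ^ kl.1 * z.2 ^ kl.2)‖ := by
    refine Summable.of_nonneg_of_le (fun kl => integral_nonneg fun _ => norm_nonneg _)
      (fun kl => ?_) ((hsum.mul_left 4).mul_right (h ^ (((p : ℝ) + 1) / (2 * p))))
    refine (le_abs_self _).trans (abs_setIntegral_levelRegion_le hp h0 fun z hz => ?_)
    rw [abs_norm]
    simp only [norm_mul, norm_pow, Real.norm_eq_abs, abs_of_nonneg ha0]
    have h2 := hbd z hz
    gcongr
    · exact h2.1
    · exact h2.2
  have hmain := hasSum_integral_of_summable_integral_norm hint hs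
  have heq : ∫ z in levelRegion p h, ∑' kl : ℕ × ℕ,
      mixedCoeff f kl.1 kl.2 * (z.1 ^ kl.1 * z.2 ^ kl.2) = levelIntegral p h f := by
    rw [levelIntegral_eq_setIntegral hp h0 hcont]
    refine setIntegral_congr_fun (isClosed_levelRegion p h).measurableSet fun z hz => ?_
    have h2 := hbd z hz
    exact (hf z.1 z.2 (by linarith)).tsum_eq
  rw [heq] at hmain
  simpa only [integral_const_mul, setIntegral_monomial hp h0] using hmain

theorem hasSum_levelCoeff {p : ℕ} (hp : 1 ≤ p) {f : ℝ × ℝ → ℝ} {ρ h : ℝ}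
    (hf : ∀ u w : ℝ, |u| + |w| < ρ →
      HasSum (fun kl : ℕ × ℕ => mixedCoeff f kl.1 kl.2 * (u ^ kl.1 * w ^ kl.2)) (f (u, w)))
    (h0 : 0 < h) (h1 : h ≤ 1) (hh : 2 * h ^ (1 / (2 * (p : ℝ))) < ρ)
    (hcont : ContinuousOn f (levelRegion p h)) :
    HasSum (fun l : ℕ => h ^ (((p : ℝ) + 1) / (2 * p)) * (levelCoeff p f l * h ^ ((l : ℝ) / p)))
      (levelIntegral p h f) := by
  have hmono := hasSum_setIntegral_monomial hp hf h0 h1 hh hcont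
  have hinj : Function.Injective fun ij : ℕ × ℕ => (2 * ij.1, 2 * ij.2) := by
    rintro ⟨i, j⟩ ⟨i', j'⟩ hij
    simp only [Prod.mk.injEq] at hij ⊢
    omega
  have heven := (hinj.hasSum_iff (fun kl hkl => by
    rcases Nat.even_or_odd' kl.1 with ⟨i, hi | hi⟩
    · rcases Nat.even_or_odd' kl.2 with ⟨j, hj | hj⟩
      · exact absurd ⟨(i, j), by simp [← hi, ← hj]⟩ hkl
      · rw [levelIntegral_monomial_of_odd_snd h (hj ▸ odd_two_mul_add_one j), mul_zero]
    · rw [levelIntegral_monomial_of_odd_fst h (hi ▸ odd_two_mul_add_one i), mul_zero])).2 hmono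
  set g : ℕ × ℕ → ℕ := fun ij => ij.1 + p * ij.2 with hg
  refine (heven.tsum_fiberwise g).congr_fun fun l => ?_
  set S := (Finset.range (l + 1) ×ˢ Finset.range (l + 1)).filter
    (fun ij : ℕ × ℕ => ij.1 + p * ij.2 = l) with hS
  have hset : g ⁻¹' {l} = (S : Set (ℕ × ℕ)) := by
    ext ij
    simp only [hg, hS, mem_preimage, mem_singleton_iff, Finset.coe_filter, Finset.mem_product,
      Finset.mem_range, mem_ofPred_eq]
    have : ij.2 ≤ p * ij.2 := Nat.le_mul_of_pos_left _ hp
    constructor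
    · intro h; exact ⟨⟨by omega, by omega⟩, h⟩
    · exact fun h => h.2
  rw [hset, Finset.tsum_subtype' S (fun ij : ℕ × ℕ => ((fun kl : ℕ × ℕ => mixedCoeff f kl.1 kl.2 *
    levelIntegral p h (fun z => z.1 ^ kl.1 * z.2 ^ kl.2)) ∘ fun ij => (2 * ij.1, 2 * ij.2)) ij),
    levelCoeff, Finset.sum_mul, Finset.mul_sum]
  refine Finset.sum_congr rfl fun ij hij => ?_
  have hl : ij.1 + p * ij.2 = l := (Finset.mem_filter.1 hij).2
  simp only [Function.comp_apply]
  rw [levelIntegral_monomial hp ij.1 ij.2 h0, hl, levelTerm]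
  ring

/-- A function given by a convergent series in fractional powers is analytic. -/
theorem analyticOnNhd_of_hasSum_rpow {M : ℝ → ℝ} {b : ℕ → ℝ} {p : ℕ} (hp : 1 ≤ p) {s η : ℝ}
    (hM : ∀ h ∈ Ioo 0 η, HasSum (fun l : ℕ => h ^ s * (b l * h ^ ((l : ℝ) / p))) (M h)) :
    AnalyticOnNhd ℝ M (Ioo 0 η) := by
  intro h₀ hh₀
  have hp' : (0 : ℝ) < p := by exact_mod_cast hp
  have hpow : ∀ h : ℝ, 0 < h → ∀ l : ℕ, h ^ ((l : ℝ) / p) = (h ^ (1 / (p : ℝ))) ^ l := by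
    intro h h0 l
    rw [← Real.rpow_natCast, ← Real.rpow_mul h0.le]
    congr 1
    field_simp
  have hM' : ∀ h ∈ Ioo 0 η, HasSum (fun l : ℕ => b l * (h ^ (1 / (p : ℝ))) ^ l)
      (M h / h ^ s) := by
    intro h hh
    have h1 := (hM h hh).div_const (h ^ s)
    have h2 : h ^ s ≠ 0 := (Real.rpow_pos_of_pos hh.1 s).ne'
    simpa only [mul_div_cancel_left₀ _ h2, hpow h hh.1] using h1
  set q := FormalMultilinearSeries.ofScalars ℝ b with hq
  -- In the variable `h ^ (1 / p)` the series is a power series; convergence at some `h₁ > h₀` puts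
  -- `h₀ ^ (1 / p)` strictly inside its disc of convergence.
  obtain ⟨h₁, hh₁⟩ := exists_between hh₀.2
  have h₁0 : 0 < h₁ := hh₀.1.trans hh₁.1
  set x₁ : NNReal := ⟨h₁ ^ (1 / (p : ℝ)), by positivity⟩ with hx₁
  have hrad : (x₁ : ENNReal) ≤ q.radius := by
    have h3 := (hM' h₁ ⟨h₁0, hh₁.2⟩).summable.norm
    refine q.le_radius_of_bound (∑' l, ‖b l * (h₁ ^ (1 / (p : ℝ))) ^ l‖) fun n => ?_
    rw [hq, FormalMultilinearSeries.ofScalars_norm]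
    refine le_trans (le_of_eq ?_) (h3.le_tsum n fun _ _ => norm_nonneg _)
    rw [norm_mul, norm_pow, Real.norm_eq_abs (h₁ ^ _), abs_of_nonneg (by positivity)]
    rfl
  have hlt : h₀ ^ (1 / (p : ℝ)) < h₁ ^ (1 / (p : ℝ)) :=
    Real.rpow_lt_rpow hh₀.1.le hh₁.1 (by positivity)
  have hx₀ : h₀ ^ (1 / (p : ℝ)) ∈ Metric.eball (0 : ℝ) q.radius := by
    rw [Metric.mem_eball, edist_zero_right]
    refine lt_of_lt_of_le ?_ hrad
    rw [← ofReal_norm, Real.norm_eq_abs, abs_of_nonneg (Real.rpow_nonneg hh₀.1.le _)]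
    have h4 : (x₁ : ENNReal) = ENNReal.ofReal (h₁ ^ (1 / (p : ℝ))) :=
      (ENNReal.ofReal_eq_coe_nnreal _).symm
    rw [h4]
    exact (ENNReal.ofReal_lt_ofReal_iff (by positivity)).2 hlt
  have hqpos : 0 < q.radius :=
    lt_of_lt_of_le (by rw [ENNReal.coe_pos]; exact Real.rpow_pos_of_pos h₁0 _) hrad
  have hsum : AnalyticAt ℝ q.sum (h₀ ^ (1 / (p : ℝ))) :=
    (q.hasFPowerSeriesOnBall hqpos).analyticAt_of_mem hx₀
  have hrp : ∀ c : ℝ, AnalyticAt ℝ (fun h : ℝ => h ^ c) h₀ := fun c =>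
    (Real.contDiffAt_rpow_const_of_ne (n := ω) hh₀.1.ne').analyticAt
  have hprod := (hrp s).mul (AnalyticAt.comp (f := fun h : ℝ => h ^ (1 / (p : ℝ))) hsum
    (hrp (1 / (p : ℝ))))
  refine hprod.congr ?_
  filter_upwards [isOpen_Ioo.mem_nhds hh₀] with h hh
  have h5 : q.sum (h ^ (1 / (p : ℝ))) = M h / h ^ s := by
    rw [← (hM' h hh).tsum_eq]
    exact FormalMultilinearSeries.ofScalars_sum_eq b _
  simp only [Pi.mul_apply, Function.comp_apply, h5]
  exact mul_div_cancel₀ _ (Real.rpow_pos_of_pos hh.1 s).ne'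

end Melnikov

/-! ### Assembly of the theorem -/

namespace Melnikov

variable {E : Type*} [NormedAddCommGroup E] [NormedSpace ℝ E] {n : WithTop ℕ∞}
  {H : ℝ × ℝ → ℝ} {U : Set (ℝ × ℝ)} {p : ℕ}

namespace NormalCoords

theorem bCoeff_eq (N : NormalCoords n H U p) {V : Set E} {P Q : ℝ × ℝ → E → ℝ}
    (hn : n = ∞ ∨ n = ω) (hU : IsOpen U) (hV : IsOpen V) (hH : ContDiffOn ℝ n H U)
    (hP : ContDiffOn ℝ n (Function.uncurry P) (U ×ˢ V))
    (hQ : ContDiffOn ℝ n (Function.uncurry Q) (U ×ˢ V)) {δ : E} (hδ : δ ∈ V) (l : ℕ) :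
    bCoeff H P Q p l δ = levelCoeff p (N.density P Q δ) l := by
  have hdens := contDiffOn_of_uncurry (N.contDiffOn_density hn hU hV hP hQ) hδ
  refine Finset.sum_congr rfl fun ij _ => ?_
  rw [N.rCoeff_eq hn hU hH hP hQ hδ hdens, levelTerm, mixedCoeff]

theorem exists_melnikov_expansion (N : NormalCoords n H U p) {V D : Set E} {P Q : ℝ × ℝ → E → ℝ}
    (hn : n = ∞ ∨ n = ω) (hU : IsOpen U) (hU0 : (0 : ℝ × ℝ) ∈ U) (hV : IsOpen V)
    (hD : IsCompact D) (hDV : D ⊆ V) (hH : ContDiffOn ℝ n H U) (hp : 1 ≤ p)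
    (hP : ContDiffOn ℝ n (Function.uncurry P) (U ×ˢ V))
    (hQ : ContDiffOn ℝ n (Function.uncurry Q) (U ×ˢ V)) {β : ℝ} {γ : ℝ → ℝ → ℝ × ℝ} {T : ℝ → ℝ}
    (hF : IsCenterFamily H U β γ T) (k : ℕ) :
    ∃ C : ℝ, ∃ η ∈ Ioc 0 β, ∀ δ ∈ D, ∀ h ∈ Ioo 0 η,
      |melnikov H P Q γ T h δ - h ^ (((p : ℝ) + 1) / (2 * p)) *
          ∑ l ∈ Finset.range k, bCoeff H P Q p l δ * h ^ ((l : ℝ) / p)| ≤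
        C * (h ^ (((p : ℝ) + 1) / (2 * p)) * h ^ ((k : ℝ) / p)) := by
  obtain ⟨η₁, hη₁, -, hM⟩ := N.exists_melnikov_eq_levelIntegral hn hU hU0 hH hp hP hQ hF
  obtain ⟨C, η₂, hη₂, hC⟩ := exists_levelIntegral_expansion hp (f := fun δ => N.density P Q δ)
    N.r_pos hV hD hDV ((N.contDiffOn_density hn hU hV hP hQ).of_le (infty_le_of_infinite hn)) k
  refine ⟨C, min η₁ η₂, ⟨lt_min hη₁.1 hη₂, (min_le_left _ _).trans hη₁.2⟩, fun δ hδ h hh => ?_⟩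
  have h1 := hC δ hδ h ⟨hh.1, hh.2.trans_le (min_le_right _ _)⟩
  rw [hM h ⟨hh.1, hh.2.trans_le (min_le_left _ _)⟩ δ (hDV hδ)]
  simpa only [N.bCoeff_eq hn hU hV hH hP hQ (hDV hδ)] using h1

theorem exists_melnikov_hasSum (N : NormalCoords ω H U p) {V D : Set E} {P Q : ℝ × ℝ → E → ℝ}
    (hU : IsOpen U) (hU0 : (0 : ℝ × ℝ) ∈ U) (hV : IsOpen V)
    (hD : IsCompact D) (hDV : D ⊆ V) (hH : ContDiffOn ℝ ω H U) (hp : 1 ≤ p)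
    (hP : ContDiffOn ℝ ω (Function.uncurry P) (U ×ˢ V))
    (hQ : ContDiffOn ℝ ω (Function.uncurry Q) (U ×ˢ V)) {β : ℝ} {γ : ℝ → ℝ → ℝ × ℝ} {T : ℝ → ℝ}
    (hF : IsCenterFamily H U β γ T) :
    ∃ η ∈ Ioc 0 β, ∀ δ ∈ D, ∀ h ∈ Ioo 0 η,
      HasSum (fun l : ℕ => h ^ (((p : ℝ) + 1) / (2 * p)) *
          (bCoeff H P Q p l δ * h ^ ((l : ℝ) / p))) (melnikov H P Q γ T h δ) := by
  have hn : (ω : WithTop ℕ∞) = ∞ ∨ (ω : WithTop ℕ∞) = ω := Or.inr rfl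
  have hdens := N.contDiffOn_density hn hU hV hP hQ
  obtain ⟨η₁, hη₁, -, hM⟩ := N.exists_melnikov_eq_levelIntegral hn hU hU0 hH hp hP hQ hF
  obtain ⟨ρ, hρ, hsum⟩ := exists_radius_hasSum_mixedCoeff (f := fun δ => N.density P Q δ)
    N.r_pos hV hD hDV hdens
  -- `ρ / 2` ensures convergence of the double series on the region, `N.r` that the region lies in
  -- the coordinate ball.
  set s := min (ρ / 2) N.r with hs
  have hs0 : 0 < s := lt_min (by linarith) N.r_pos
  refine ⟨min η₁ (min 1 (s ^ (2 * p))), ⟨lt_min hη₁.1 (by positivity),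
    (min_le_left _ _).trans hη₁.2⟩, fun δ hδ h hh => ?_⟩
  have h0 := hh.1
  have h1 : h ≤ 1 := hh.2.le.trans ((min_le_right _ _).trans (min_le_left _ _))
  have ha := rpow_inv_two_mul_lt hp h0 hs0
    (hh.2.trans_le ((min_le_right _ _).trans (min_le_right _ _)))
  have ha1 := ha.trans_le (min_le_left _ _)
  have ha2 := ha.trans_le (min_le_right _ _)
  have hcont : ContinuousOn (N.density P Q δ) (levelRegion p h) := by
    refine (contDiffOn_of_uncurry hdens (hDV hδ)).continuousOn.mono fun z hz => ?_
    have h2 := abs_le_of_mem_levelRegion hp h0 h1 hz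
    exact mk_mem_ball_zero (h2.1.trans_lt ha2) (h2.2.trans_lt ha2)
  have h3 := hasSum_levelCoeff hp (hsum δ hδ) h0 h1 (by linarith) hcont
  rw [hM h ⟨h0, hh.2.trans_le (min_le_left _ _)⟩ δ (hDV hδ)]
  simpa only [N.bCoeff_eq hn hU hV hH hP hQ (hDV hδ)] using h3

end NormalCoords

end Melnikov

theorem theorem2 {m : ℕ}
    -- the phase domain, the parameter domain and the compact parameter set
    (U : Set (ℝ × ℝ)) (hU : IsOpen U) (hU0 : (0 : ℝ × ℝ) ∈ U)
    (V D : Set (EuclideanSpace ℝ (Fin m))) (hV : IsOpen V) (hD : IsCompact D) (hDV : D ⊆ V)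
    -- the smooth near-Hamiltonian system
    (H : ℝ × ℝ → ℝ) (P Q : ℝ × ℝ → EuclideanSpace ℝ (Fin m) → ℝ)
    (hH : ContDiffOn ℝ ∞ H U)
    (hP : ContDiffOn ℝ ∞ (Function.uncurry P) (U ×ˢ V))
    (hQ : ContDiffOn ℝ ∞ (Function.uncurry Q) (U ×ˢ V))
    -- the normal form
    (om : ℝ) (hom : 0 < om)
    (hnf : Melnikov.ElementaryForm H om ∨ Melnikov.NilpotentForm H om)
    -- the expansion of `H₀*` starts with `h_{2p} x^{2p}`, `h_{2p} > 0`
    (p : ℕ) (hp : 1 ≤ p)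
    (hlow : ∀ j < 2 * p, iteratedDeriv j (Melnikov.H0star H) 0 = 0)
    (hlead : 0 < iteratedDeriv (2 * p) (Melnikov.H0star H) 0) :
    -- the family of periodic orbits exists
    (∃ β γ T, Melnikov.IsCenterFamily H U β γ T) ∧
    ∀ β γ T, Melnikov.IsCenterFamily H U β γ T →
      -- the expansion, uniformly in the parameter
      (∀ n : ℕ, ∃ C : ℝ, ∃ η ∈ Ioc 0 β, ∀ δ ∈ D, ∀ h ∈ Ioo 0 η,
        |Melnikov.melnikov H P Q γ T h δ
            - h ^ (((p : ℝ) + 1) / (2 * p)) *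
              ∑ l ∈ Finset.range n, Melnikov.bCoeff H P Q p l δ * h ^ ((l : ℝ) / p)|
          ≤ C * (h ^ (((p : ℝ) + 1) / (2 * p)) * h ^ ((n : ℝ) / p))) ∧
      -- the case `p = 1`
      (p = 1 → ∀ n : ℕ, ∃ C : ℝ, ∃ η ∈ Ioc 0 β, ∀ δ ∈ D, ∀ h ∈ Ioo 0 η,
        |Melnikov.melnikov H P Q γ T h δ
            - h * ∑ l ∈ Finset.range n, Melnikov.bCoeff H P Q 1 l δ * h ^ l|
          ≤ C * h ^ (n + 1)) ∧
      -- the analytic case: the series converges to `M`, which is analytic in `h`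
      (AnalyticOnNhd ℝ H U → AnalyticOnNhd ℝ (Function.uncurry P) (U ×ˢ V) →
        AnalyticOnNhd ℝ (Function.uncurry Q) (U ×ˢ V) →
        ∃ η ∈ Ioc 0 β, ∀ δ ∈ D,
          (∀ h ∈ Ioo 0 η,
            HasSum (fun l : ℕ => h ^ (((p : ℝ) + 1) / (2 * p)) *
                (Melnikov.bCoeff H P Q p l δ * h ^ ((l : ℝ) / p)))
              (Melnikov.melnikov H P Q γ T h δ)) ∧
          AnalyticOnNhd ℝ (fun h => Melnikov.melnikov H P Q γ T h δ) (Ioo 0 η)) := by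
  have hn : (∞ : WithTop ℕ∞) = ∞ ∨ (∞ : WithTop ℕ∞) = ω := Or.inl rfl
  obtain ⟨N⟩ := Melnikov.exists_normalCoords hn hU hU0 hH hom hnf hp hlow hlead
  refine ⟨N.exists_centerFamily hn hU hH hp, fun β γ T hF => ⟨fun n =>
    N.exists_melnikov_expansion hn hU hU0 hV hD hDV hH hp hP hQ hF n, ?_, ?_⟩⟩
  · rintro rfl n
    obtain ⟨C, η, hη, hC⟩ :=
      N.exists_melnikov_expansion hn hU hU0 hV hD hDV hH hp hP hQ hF n
    refine ⟨C, η, hη, fun δ hδ h hh => ?_⟩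
    have h1 := hC δ hδ h hh
    have e : ((1 : ℝ) + 1) / (2 * 1) = 1 := by norm_num
    simp only [e, Real.rpow_one, Nat.cast_one, div_one, Real.rpow_natCast] at h1
    rwa [pow_succ']
  · intro haH haP haQ
    have hn' : (ω : WithTop ℕ∞) = ∞ ∨ (ω : WithTop ℕ∞) = ω := Or.inr rfl
    have hH' := haH.contDiffOn (n := ω) hU.uniqueDiffOn
    -- Analytic coordinates are constructed anew. The coefficients are defined from `H`, `P`, `Q`
    -- alone, so they are those of the smooth expansion.
    obtain ⟨N'⟩ := Melnikov.exists_normalCoords hn' hU hU0 hH' hom hnf hp hlow hlead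
    obtain ⟨η, hη, hs⟩ := N'.exists_melnikov_hasSum hU hU0 hV hD hDV hH' hp
      (haP.contDiffOn (hU.prod hV).uniqueDiffOn) (haQ.contDiffOn (hU.prod hV).uniqueDiffOn) hF
    exact ⟨η, hη, fun δ hδ => ⟨hs δ hδ,
      Melnikov.analyticOnNhd_of_hasSum_rpow hp (hs δ hδ)⟩⟩
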